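/- **Setting.** Let $W$ be a standard $d$-dimensional Brownian motion on a probability space $(\Omega,\mathcal F,\mathbf P)$, $\mathbb F=(\mathcal F(t))_{t\in[0,T]}$ its augmented filtration, $T>0$, $r\ge 0$. Let $\Sigma=\sigma\sigma'\in\mathbb R^{d\times d}$ be positive definite and $\Lambda\in\mathbb R^{d\times d}$ diagonal with positive diagonal. Let $\mathcal H^2$ (resp. $\mathcal H^\infty$) be the set of optional $X:[0,T]\times\Omega\to\mathbb R^d$ with $\mathbb E\int_0^T\|X(t)\|_2^2\,dt<\infty$ (resp. $\operatorname{ess\,sup}_{\omega}\operatorname{ess\,sup}_{t}\|X(t)\|_2<\infty$). Let $\mathcal A$ be the set of continuous semimartingales $dX(t)=a^X(t)\,dt+dM^X(t)$ with $X(T)=0$, $a^X\in\mathcal H^\infty$ and $M^X\in\mathcal H^\infty$ a continuous $\mathbb F$-martingale, and let $\mathcal W_{\mathcal A}$ be the set of $X(t)=\int_0^t\dot X(s)\,ds$ with $\dot X\in\mathcal A$. There are $N\ge 2$ investors $m\in\{1,\dots,N\}$ with risk tolerances $\delta_m>0$ and exposures $\zeta_m\in\mathcal H^\infty$, and noise traders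 with demand $\psi\in\mathcal W_{\mathcal A}$. Assume that all $\delta_m$ are equal. Given a return process $\nu$, the objective of investor $m$ with transaction costs is, for a trading rate $\dot\phi$ and $\phi(t)=\int_0^t\dot\phi(s)\,ds$, $$\mathcal F_{\Lambda,m}(\dot\phi;\nu)=\mathbb E\Big[\int_0^Te^{-rt}\Big(\phi(t)'\nu(t)-\tfrac1{2\delta_m}(\phi(t)+\zeta_m(t))'\Sigma(\phi(t)+\zeta_m(t))-\dot\phi(t)'\Lambda\dot\phi(t)\Big)dt\Big];$$ without transaction costs, the objective $\mathcal F_m(\phi;\nu)$ of a demand $\phi\in\mathcal H^2$ is the same expression without its last term. Fix an investor $n$. *Equilibrium with transaction costs when only $n$ is strategic.* A price taker $m\ne n$ facing $\nu\in\mathcal H^\infty$ maximizes $\mathcal F_{\Lambda,m}(\cdot\,;\nu)$ over $\dot\phi_m\in\mathcal H^2$. A price impact of $n$ assigns to each $\phi_n\in\mathcal W_{\mathcal A}$ a process $\nu(\phi_n)\in\mathcal H^\infty$ for which there are optimal demands $\phi_m$ of the price takers facing $\nu(\phi_n)$ such that $\phi_n(t)+\sum_{m\ne n}\phi_m(t)+\psi(t)=0$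 for all $t\in[0,T]$, a.s. A process $\nu$ is an equilibrium return process if $\nu=\nu(\phi_n)$ for some price impact $\nu(\cdot)$ and some $\phi_n\in\mathcal W_{\mathcal A}$ which maximizes $\phi\mapsto\mathcal F_{\Lambda,n}(\dot\phi;\nu(\phi))$ over $\mathcal W_{\mathcal A}$. *Without transaction costs* the equilibrium is defined in the same way, with $\mathcal F_m$ in place of $\mathcal F_{\Lambda,m}$, with $\mathcal H^2$ as the class of returns and of the demands of all investors, and with clearing $dt\otimes\mathbf P$-a.e. Put $\delta=\sum_m\delta_m$, $\delta_{-n}=\sum_{m\ne n}\delta_m$, $\zeta=\sum_m\zeta_m$, $\zeta_{-n}=\sum_{m\ne n}\zeta_m$, $\lambda_n=\delta_n/\delta$, and $$\widetilde\mu_n=\frac{\lambda_n}{\lambda_n+1}\,\frac{\Sigma(\zeta_{-n}-\psi)}{\delta_{-n}}+\frac1{\lambda_n+1}\,\frac{\Sigma(\zeta-\psi)}{\delta}.$$ **Corollary 4.4.** Up to $dt\otimes\mathbf P$-null sets, $\widetilde\mu_n$ is the unique equilibrium return process without transaction costs when only investor $n$ is strategic; and the unique equilibrium return process with transaction costs when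 only investor $n$ is strategic is $$\mu_{\Lambda,n}=\widetilde\mu_n+\frac{2N\Lambda}{N^2-1}\big(a^{\dot\psi}-r\dot\psi\big),$$ which belongs to $\mathcal H^\infty$. -/

import Mathlib

open MeasureTheory ProbabilityTheory Matrix Filter Topology
open scoped NNReal ENNReal

noncomputable section

/-- An `ℝ^d`-valued stochastic process; only its values at times in `[0, T]` will matter. -/
abbrev Proc (d : ℕ) (Ω : Type*) := ℝ → Ω → Fin d → ℝ

/-- Right-continuous paths with left limits (no condition on the left at an initial point). -/
def IsCadlagPath {ι : Type*} [TopologicalSpace ι] [Preorder ι] (f : ι → ℝ) : Prop :=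
  ∀ t, ContinuousWithinAt f (Set.Ici t) t ∧ ∃ l, Tendsto f (𝓝[<] t) (𝓝 l)

/-- The optional sigma-algebra: it is generated by the adapted processes all of whose paths are
right-continuous with left limits. -/
@[reducible] def optionalSigma {Ω : Type*} {mΩ : MeasurableSpace Ω} {T : ℝ}
    (ℱ : Filtration (Set.Icc (0 : ℝ) T) mΩ) : MeasurableSpace (Set.Icc (0 : ℝ) T × Ω) :=
  ⨆ (X : Set.Icc (0 : ℝ) T → Ω → ℝ)
    (_ : Adapted ℱ X ∧ ∀ ω, IsCadlagPath (fun t => X t ω)),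
    MeasurableSpace.comap (fun p : Set.Icc (0 : ℝ) T × Ω => X p.1 p.2) inferInstance

/-- The exogenous data of the model with `N` investors and `d` risky assets, driven by a standard
`d`-dimensional Brownian motion `W`. The infinitesimal covariance of the returns is `σ σᵀ`, and the
transaction cost matrix is diagonal with diagonal `cost`. -/
structure Economy (d N : ℕ) {Ω : Type*} [MeasurableSpace Ω] (P : Measure Ω) where
  /-- the time horizon -/
  T : ℝ
  T_pos : 0 < T
  /-- the discount rate -/
  r : ℝ
  r_nonneg : 0 ≤ r
  /-- the components of the Brownian motion -/
  W : Fin d → ℝ≥0 → Ω → ℝ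
  W_measurable : ∀ i t, Measurable (W i t)
  W_brownian : ∀ i, IsBrownianReal (W i) P
  W_indep : iIndepFun (fun (i : Fin d) (ω : Ω) (t : ℝ≥0) => W i t ω) P
  /-- the volatility matrix of the returns -/
  σ : Matrix (Fin d) (Fin d) ℝ
  cov_posDef : (σ * σᵀ).PosDef
  /-- the diagonal of the transaction cost matrix -/
  cost : Fin d → ℝ
  cost_pos : ∀ i, 0 < cost i
  /-- the risk tolerances of the investors -/
  δ : Fin N → ℝ
  δ_pos : ∀ m, 0 < δ m
  /-- the risk exposures of the investors' endowments -/
  ζ : Fin N → Proc d Ω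
  /-- the demand of the noise traders -/
  ψ : Proc d Ω

namespace Economy

variable {d N : ℕ} {Ω : Type*} [mΩ : MeasurableSpace Ω] {P : Measure Ω} (E : Economy d N P)

/-- The covariance matrix `Σ = σ σᵀ`. -/
def cov : Matrix (Fin d) (Fin d) ℝ := E.σ * E.σᵀ

/-- The transaction cost matrix `Λ`. -/
def Λ : Matrix (Fin d) (Fin d) ℝ := Matrix.diagonal E.cost

/-- The filtration on `[0, T]` generated by the Brownian motion, augmented by the null events. -/
def filtration : Filtration (Set.Icc (0 : ℝ) E.T) mΩ where
  seq t := (⨆ (i : Fin d) (s : ℝ≥0) (_ : (s : ℝ) ≤ t),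
      MeasurableSpace.comap (E.W i s) inferInstance) ⊔
    MeasurableSpace.generateFrom {A | MeasurableSet A ∧ P A = 0}
  mono' := by
    intro t u htu
    refine sup_le_sup_right ?_ _
    refine iSup_mono fun i => iSup_mono fun s => iSup_le fun hs => ?_
    exact le_iSup_of_le (le_trans hs htu) le_rfl
  le' := by
    intro t
    refine sup_le ?_ (MeasurableSpace.generateFrom_le fun A hA => hA.1)
    exact iSup_le fun i => iSup_le fun s => iSup_le fun _ => (E.W_measurable i s).comap_le

/-- The process is optional on `[0, T] × Ω`. -/
def IsOptional (X : Proc d Ω) : Prop :=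
  Measurable[optionalSigma E.filtration]
    (fun p : Set.Icc (0 : ℝ) E.T × Ω => X (p.1 : ℝ) p.2)

/-- The class `ℋ²`. -/
def MemH2 (X : Proc d Ω) : Prop :=
  E.IsOptional X ∧
    (∫⁻ ω, (∫⁻ t in Set.Icc (0 : ℝ) E.T, ‖WithLp.toLp 2 (X t ω)‖ₑ ^ 2) ∂P) < ∞

/-- The class `ℋ^∞`. -/
def MemHInf (X : Proc d Ω) : Prop :=
  E.IsOptional X ∧
    ∃ C : ℝ, ∀ᵐ ω ∂P, ∀ᵐ t ∂(volume.restrict (Set.Icc (0 : ℝ) E.T)),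
      ‖WithLp.toLp 2 (X t ω)‖ ≤ C

/-- Equality `dt ⊗ P`-almost everywhere on `[0, T] × Ω`. -/
def AEEqual (X Y : Proc d Ω) : Prop :=
  ∀ᵐ ω ∂P, ∀ᵐ t ∂(volume.restrict (Set.Icc (0 : ℝ) E.T)), X t ω = Y t ω

/-- `X` is a continuous semimartingale `dX = a dt + dM` on `[0, T]` with `X(T) = 0`, with
`a ∈ ℋ^∞` and with `M ∈ ℋ^∞` a continuous martingale. -/
structure IsDecomposition (X a M : Proc d Ω) : Prop where
  optional : E.IsOptional X
  drift_mem : E.MemHInf a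
  mart_mem : E.MemHInf M
  martingale : Martingale (fun (t : Set.Icc (0 : ℝ) E.T) ω => M (t : ℝ) ω) E.filtration P
  continuous : ∀ᵐ ω ∂P, ContinuousOn (fun t => M t ω) (Set.Icc (0 : ℝ) E.T)
  eq : ∀ᵐ ω ∂P, ∀ t ∈ Set.Icc (0 : ℝ) E.T,
    X t ω = X 0 ω + (∫ s in (0 : ℝ)..t, a s ω) + (M t ω - M 0 ω)
  terminal : ∀ᵐ ω ∂P, X E.T ω = 0

/-- `a` is the drift coefficient `a^X` of the element `X` of the class `𝒜`. -/
def IsDrift (X a : Proc d Ω) : Prop := ∃ M, E.IsDecomposition X a M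

/-- The class `𝒜`. -/
def MemA (X : Proc d Ω) : Prop := ∃ a, E.IsDrift X a

/-- `X` belongs to the class `𝒲_𝒜`, with rate `u`: `X(t) = ∫₀ᵗ u(s) ds` with `u ∈ 𝒜`. -/
structure MemWA (X u : Proc d Ω) : Prop where
  optional : E.IsOptional X
  rate_mem : E.MemA u
  eq : ∀ᵐ ω ∂P, ∀ t ∈ Set.Icc (0 : ℝ) E.T, X t ω = ∫ s in (0 : ℝ)..t, u s ω

/-- The position `∫₀ᵗ u(s) ds` obtained from the trading rate `u`. -/
def position (u : Proc d Ω) : Proc d Ω := fun t ω => ∫ s in (0 : ℝ)..t, u s ω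

/-! ### Objectives -/

/-- The frictionless objective of investor `m` for the demand `φ` under the returns `ν`. -/
def objective (m : Fin N) (ν φ : Proc d Ω) : ℝ :=
  ∫ ω, (∫ t in (0 : ℝ)..E.T, Real.exp (-E.r * t) *
    (φ t ω ⬝ᵥ ν t ω
      - 1 / (2 * E.δ m) * ((φ t ω + E.ζ m t ω) ⬝ᵥ E.cov *ᵥ (φ t ω + E.ζ m t ω)))) ∂P

/-- The objective of investor `m` with transaction costs, for the trading rate `u` (and hence the
demand `∫₀ᵗ u(s) ds`) under the returns `ν`. -/
def costObjective (m : Fin N) (ν u : Proc d Ω) : ℝ :=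
  ∫ ω, (∫ t in (0 : ℝ)..E.T, Real.exp (-E.r * t) *
    (position u t ω ⬝ᵥ ν t ω
      - 1 / (2 * E.δ m) *
        ((position u t ω + E.ζ m t ω) ⬝ᵥ E.cov *ᵥ (position u t ω + E.ζ m t ω))
      - u t ω ⬝ᵥ E.Λ *ᵥ u t ω)) ∂P

/-! ### Equilibrium without transaction costs when only investor `n` is strategic -/

/-- `φ` is optimal for the price taker `m` under the returns `ν`, without transaction costs. -/
def IsOptimal (m : Fin N) (ν φ : Proc d Ω) : Prop :=
  E.MemH2 φ ∧ ∀ θ, E.MemH2 θ → E.objective m ν θ ≤ E.objective m ν φ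

/-- Under the returns `ν` the market without transaction costs clears when investor `n` demands `φ`,
all other investors act optimally as price takers, and noise traders demand `ψ`. -/
def Clears (n : Fin N) (φ ν : Proc d Ω) : Prop :=
  E.MemH2 ν ∧ ∃ θ : Fin N → Proc d Ω, (∀ m, m ≠ n → E.IsOptimal m ν (θ m)) ∧
    E.AEEqual (fun t ω => φ t ω + (∑ m ∈ Finset.univ.erase n, θ m t ω) + E.ψ t ω) (fun _ _ => 0)

/-- `ν` is an equilibrium return process without transaction costs when only investor `n` is
strategic: `imp` is her price impact, mapping each demand to returns that clear the market against
it, her demand `φ` maximizes her objective with this impact taken into account, and `ν` are the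
returns at this demand. -/
def IsEquilibrium (n : Fin N) (ν : Proc d Ω) : Prop :=
  ∃ (imp : Proc d Ω → Proc d Ω) (φ : Proc d Ω),
    (∀ θ, E.MemH2 θ → E.Clears n θ (imp θ)) ∧
    E.MemH2 φ ∧
    (∀ θ, E.MemH2 θ → E.objective n (imp θ) θ ≤ E.objective n (imp φ) φ) ∧
    ν = imp φ

/-! ### Equilibrium with transaction costs when only investor `n` is strategic -/

/-- The trading rate `u` is optimal for the price taker `m` under the returns `ν`, with transaction
costs. -/
def IsCostOptimal (m : Fin N) (ν u : Proc d Ω) : Prop :=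
  E.MemH2 u ∧ ∀ v, E.MemH2 v → E.costObjective m ν v ≤ E.costObjective m ν u

/-- Under the returns `ν` the market with transaction costs clears when investor `n` trades at the
rate `u`, all other investors act optimally as price takers, and noise traders demand `ψ`. -/
def CostClears (n : Fin N) (u ν : Proc d Ω) : Prop :=
  E.MemHInf ν ∧ ∃ v : Fin N → Proc d Ω, (∀ m, m ≠ n → E.IsCostOptimal m ν (v m)) ∧
    ∀ᵐ ω ∂P, ∀ t ∈ Set.Icc (0 : ℝ) E.T,
      position u t ω + (∑ m ∈ Finset.univ.erase n, position (v m) t ω) + E.ψ t ω = 0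

/-- `ν` is an equilibrium return process with transaction costs when only investor `n` is
strategic; her admissible demands are those in `𝒲_𝒜`, that is, her trading rates are in `𝒜`. -/
def IsCostEquilibrium (n : Fin N) (ν : Proc d Ω) : Prop :=
  ∃ (imp : Proc d Ω → Proc d Ω) (u : Proc d Ω),
    (∀ v, E.MemA v → E.CostClears n v (imp v)) ∧
    E.MemA u ∧
    (∀ v, E.MemA v → E.costObjective n (imp v) v ≤ E.costObjective n (imp u) u) ∧
    ν = imp u

/-! ### Explicit returns -/

/-- The aggregate risk tolerance. -/
def δtot : ℝ := ∑ m, E.δ m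

/-- The relative risk tolerance `λ_n`. -/
def relTol (n : Fin N) : ℝ := E.δ n / E.δtot

/-- The competitive frictionless returns `μ = Σ (ζ - ψ) / δ`. -/
def μcomp : Proc d Ω := fun t ω =>
  (1 / E.δtot) • (E.cov *ᵥ ((∑ m, E.ζ m t ω) - E.ψ t ω))

/-- The competitive frictionless returns `μ₋ₙ = Σ (ζ₋ₙ - ψ) / δ₋ₙ` in the absence of
investor `n`. -/
def μwithout (n : Fin N) : Proc d Ω := fun t ω =>
  (1 / (∑ m ∈ Finset.univ.erase n, E.δ m)) •
    (E.cov *ᵥ ((∑ m ∈ Finset.univ.erase n, E.ζ m t ω) - E.ψ t ω))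

/-- The frictionless returns when only investor `n` is strategic,
`λₙ / (λₙ + 1) μ₋ₙ + 1 / (λₙ + 1) μ`. -/
def μstrategic (n : Fin N) : Proc d Ω := fun t ω =>
  (E.relTol n / (E.relTol n + 1)) • E.μwithout n t ω + (1 / (E.relTol n + 1)) • E.μcomp t ω

end Economy

end

/-! Both equilibria are linear-quadratic problems, and each is settled by an exact gap formula: the
objective at any competitor equals the objective at the solution of the first order condition minus
a nonnegative quadratic form. This yields optimality and uniqueness at once.

Without costs a price taker demands `δ m • Σ⁻¹ ν - ζ m`, so clearing forces `ν = Σ (residual - φ) /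
δwithout` against a demand `φ` of the strategic investor (`Clears.ae_eq`). Her objective becomes a
concave quadratic in `φ` (`strategic_gap`), and the returns at its maximizer are `μstrategic`.

With costs, let `u` be a trading rate with drift `a`. The first order condition of a price taker is
the forward-backward equation `2 Λ (a - r u) = Σ φ / δ - (ν - Σ ζ / δ)` with `φ` the primitive of
`u`. As all tolerances agree, these equations add up to a single one for the aggregate. Clearing
makes aggregate rate and drift known, hence determines `ν` from the rate and drift of the strategic
investor (`CostClears.ae_eq`); conversely, a homogeneous equation has only the zero solution, so
these returns do clear (`costClears_of_ae_eq`). In her objective the drift term is removed by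
integration by parts: price impact multiplies both her risk term and her trading cost by `1 + 2 / (N
- 1)`. Since both factors are equal, her position cancels from the returns at her optimum, which
leaves the explicit formula (`costReturn_of_foc`).

The analytic core is solving the forward-backward equation with bounded drift and bounded continuous
martingale part (`exists_isDrift`). A congruence diagonalizing `Σ` relative to `Λ` decouples it into
scalar equations. Each is solved by reduction of order from a positive solution of the homogeneous
equation, the inhomogeneity entering through the conditional expectations of a bounded integral.
These need continuous paths, so it is shown that martingales of the Brownian filtration have
continuous versions (`hasContinuousVersion`): explicitly for bounded continuous functions of
countably many Brownian values, then by density in mean and a maximal inequality.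

Drifts are handled by duality (`WeakDrift`): `u` has drift `a` and vanishes at `T` only if `∫ ((∫ h)
a + h u) = 0` for all adapted square-integrable `h`. This is the integration by parts used in every
gap formula, and it also shows that drifts are unique. -/

set_option linter.unusedSectionVars false

noncomputable section

/-! ### Optional processes: measurability, generators and primitives. -/

section OptionalProcesses

variable {Ω : Type*} [mΩ : MeasurableSpace Ω] {T : ℝ} {ℱ : Filtration (Set.Icc (0 : ℝ) T) mΩ}

/-- Measurability of each slice gives joint measurability when the index runs through a countable
set; it is applied to discretized times. -/
theorem measurable_comp_of_nat {Ω S ι : Type*} [MeasurableSpace Ω] [MeasurableSpace S]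
    {X : ι → Ω → ℝ} {e : ℕ → ι} (hX : ∀ k, Measurable (X (e k))) {g : S → ℕ} (hg : Measurable g) :
    Measurable (fun p : S × Ω => X (e (g p.1)) p.2) := by
  have h1 : Measurable (fun q : ℕ × Ω => X (e q.1) q.2) := measurable_from_prod_countable_right hX
  have h2 : Measurable (fun p : S × Ω => (g p.1, p.2)) :=
    (hg.comp measurable_fst).prodMk measurable_snd
  exact h1.comp h2

/-- A right-continuous process with measurable marginals is jointly measurable. -/
theorem measurable_of_rightContinuous {Ω : Type*} [MeasurableSpace Ω] (hT : 0 ≤ T)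
    {X : Set.Icc (0 : ℝ) T → Ω → ℝ} (t : Set.Icc (0 : ℝ) T) (hX : ∀ s ≤ t, Measurable (X s))
    (hc : ∀ ω t, ContinuousWithinAt (fun t => X t ω) (Set.Ici t) t) :
    Measurable (fun p : Set.Iic t × Ω => X p.1 p.2) := by
  -- Times are rounded up to the next point of the grid of mesh `1 / (n + 1)`, so that
  -- right-continuity applies, and capped at `t`, so that only the past of `t` is used.
  obtain ⟨e, he⟩ : ∃ e : ℕ → ℕ → Set.Icc (0 : ℝ) T, ∀ n k, e n k =
      min t (Set.projIcc 0 T hT (((k : ℝ) + 1) / ((n : ℝ) + 1))) := ⟨_, fun _ _ => rfl⟩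
  have hmeas : ∀ n : ℕ, Measurable
      (fun p : Set.Iic t × Ω => X (e n ⌊((n : ℝ) + 1) * (p.1 : ℝ)⌋₊) p.2) := by
    intro n
    have h0 : Measurable (fun s : Set.Iic t => ⌊((n : ℝ) + 1) * (s : ℝ)⌋₊) :=
      Nat.measurable_floor.comp
        ((measurable_subtype_coe.comp measurable_subtype_coe).const_mul _)
    exact measurable_comp_of_nat (X := X) (e := e n)
      (fun k => hX (e n k) (he n k ▸ min_le_left _ _)) h0
  refine measurable_of_tendsto_metrizable hmeas ?_
  rw [tendsto_pi_nhds]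
  rintro ⟨⟨s, hs⟩, ω⟩
  have hst : s ≤ t := hs
  have hval : ∀ n : ℕ, s ≤ e n ⌊((n : ℝ) + 1) * (s : ℝ)⌋₊ ∧
      ((e n ⌊((n : ℝ) + 1) * (s : ℝ)⌋₊ : Set.Icc (0 : ℝ) T) : ℝ) ≤ (s : ℝ) + 1 / ((n : ℝ) + 1) := by
    intro n
    have hn : (0 : ℝ) < (n : ℝ) + 1 := by positivity
    have hlt : (s : ℝ) ≤ ((⌊((n : ℝ) + 1) * (s : ℝ)⌋₊ : ℝ) + 1) / ((n : ℝ) + 1) := by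
      rw [le_div_iff₀ hn, mul_comm]
      exact (Nat.lt_floor_add_one _).le
    have hle : ((⌊((n : ℝ) + 1) * (s : ℝ)⌋₊ : ℝ) + 1) / ((n : ℝ) + 1) ≤
        (s : ℝ) + 1 / ((n : ℝ) + 1) := by
      have h1 : ((s : ℝ) + 1 / ((n : ℝ) + 1)) * ((n : ℝ) + 1) = ((n : ℝ) + 1) * s + 1 := by
        field_simp
      rw [div_le_iff₀ hn, h1]
      have := Nat.floor_le (mul_nonneg hn.le s.2.1)
      linarith
    constructor
    · rw [he]
      refine le_min hst ?_
      rw [← Subtype.coe_le_coe, Set.coe_projIcc]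
      exact le_max_of_le_right (le_min s.2.2 hlt)
    · have h1 : ((e n ⌊((n : ℝ) + 1) * (s : ℝ)⌋₊ : Set.Icc (0 : ℝ) T) : ℝ) ≤
          (Set.projIcc 0 T hT (((⌊((n : ℝ) + 1) * (s : ℝ)⌋₊ : ℝ) + 1) / ((n : ℝ) + 1)) : ℝ) :=
        Subtype.coe_le_coe.2 (he n _ ▸ min_le_right _ _)
      refine h1.trans ?_
      rw [Set.coe_projIcc]
      refine max_le ?_ ((min_le_right _ _).trans hle)
      have := s.2.1
      positivity
  refine (hc ω s).tendsto.comp (tendsto_nhdsWithin_iff.2 ⟨?_, Eventually.of_forall fun n => ?_⟩)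
  · rw [tendsto_subtype_rng]
    refine tendsto_of_tendsto_of_tendsto_of_le_of_le tendsto_const_nhds ?_
      (fun n => Subtype.coe_le_coe.2 (hval n).1) (fun n => (hval n).2)
    simpa using tendsto_const_nhds.add (tendsto_one_div_add_atTop_nhds_zero_nat (𝕜 := ℝ))
  · exact (hval n).1

/-- Replacing `s` by `min t (projIcc s)` extends the integrand measurably to all of `ℝ × Ω` without
changing it on `(0, t]`, and Fubini applies. The sigma-algebra on `Ω` is arbitrary because the
result is meant for `ℱ t`. -/
theorem measurable_integral_of_progressive {Ω : Type*} [MeasurableSpace Ω] (hT : 0 ≤ T)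
    {X : ℝ → Ω → ℝ} (t : Set.Icc (0 : ℝ) T)
    (hp : Measurable (fun p : Set.Iic t × Ω => X (p.1 : Set.Icc (0 : ℝ) T) p.2)) :
    Measurable (fun ω => ∫ s in (0 : ℝ)..t, X s ω) := by
  let g : ℝ × Ω → Set.Iic t × Ω := fun p =>
    (⟨min t (Set.projIcc 0 T hT p.1), Set.mem_Iic.2 (min_le_left _ _)⟩, p.2)
  have hg : Measurable g := by
    refine Measurable.prodMk ?_ measurable_snd
    refine Measurable.subtype_mk ?_
    have : Continuous (fun x : ℝ => min t (Set.projIcc 0 T hT x)) :=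
      continuous_const.min continuous_projIcc
    exact this.measurable.comp measurable_fst
  have h2 : Measurable (fun p : ℝ × Ω => X ((g p).1 : Set.Icc (0 : ℝ) T) p.2) := hp.comp hg
  have h3 : StronglyMeasurable (fun ω => ∫ s in Set.Ioc (0 : ℝ) t,
      X ((g (s, ω)).1 : Set.Icc (0 : ℝ) T) ω) :=
    (h2.stronglyMeasurable).integral_prod_left'
  convert h3.measurable using 2 with ω
  rw [intervalIntegral.integral_of_le t.2.1]
  refine setIntegral_congr_fun measurableSet_Ioc fun s hs => ?_
  have hs' : s ∈ Set.Icc (0 : ℝ) T := ⟨hs.1.le, hs.2.trans t.2.2⟩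
  have : ((g (s, ω)).1 : Set.Icc (0 : ℝ) T) = ⟨s, hs'⟩ := by
    simp only [g, Set.projIcc_of_mem hT hs']
    exact min_eq_right hs.2
  simp [this]

/-- Right-continuous adapted processes are progressively measurable. -/
theorem isProgressive_of_rightContinuous (hT : 0 ≤ T) {X : Set.Icc (0 : ℝ) T → Ω → ℝ}
    (hX : Adapted ℱ X)
    (hc : ∀ ω t, ContinuousWithinAt (fun t => X t ω) (Set.Ici t) t) : IsProgressive ℱ X :=
  fun t => @measurable_of_rightContinuous T Ω (ℱ t) hT X t (fun _ hs => hX.measurable_le hs) hc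

/-- The inclusion of `[0, t] × Ω` into the time-space domain with the optional sigma-algebra. -/
theorem measurable_inclusion_optionalSigma (hT : 0 ≤ T) (t : Set.Icc (0 : ℝ) T) :
    Measurable[Subtype.instMeasurableSpace.prod (ℱ t), optionalSigma ℱ]
      (fun p : Set.Iic t × Ω => ((p.1 : Set.Icc (0 : ℝ) T), p.2)) := by
  rw [measurable_iff_comap_le]
  simp only [MeasurableSpace.comap_iSup, MeasurableSpace.comap_comp]
  refine iSup₂_le fun X hX => ?_
  rw [← measurable_iff_comap_le]
  exact isProgressive_of_rightContinuous hT hX.1 (fun ω t => (hX.2 ω t).1) t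

theorem isProgressive_of_optional (hT : 0 ≤ T) {β : Type*} [MeasurableSpace β]
    {X : Set.Icc (0 : ℝ) T → Ω → β}
    (hX : Measurable[optionalSigma ℱ] (fun p : Set.Icc (0 : ℝ) T × Ω => X p.1 p.2)) :
    IsProgressive ℱ X := fun t => by
  have := @Measurable.comp _ _ _ (_) (_) (_) _ _ hX (measurable_inclusion_optionalSigma hT t)
  exact this

/-- At the terminal time, progressive measurability of the generators is joint measurability. -/
theorem optionalSigma_le (hT : 0 ≤ T) :
    optionalSigma ℱ ≤ (inferInstance : MeasurableSpace (Set.Icc (0 : ℝ) T × Ω)) := by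
  refine iSup₂_le fun X hX => ?_
  rw [← measurable_iff_comap_le]
  have h := isProgressive_of_rightContinuous hT hX.1 (fun ω t => (hX.2 ω t).1)
  have h2 := h ⟨T, Set.right_mem_Icc.2 hT⟩
  have h3 : Measurable[inferInstance, Subtype.instMeasurableSpace.prod (ℱ ⟨T, Set.right_mem_Icc.2 hT⟩)]
      (fun p : Set.Icc (0 : ℝ) T × Ω =>
        ((⟨p.1, p.1.2.2⟩ : Set.Iic (⟨T, Set.right_mem_Icc.2 hT⟩ : Set.Icc (0 : ℝ) T)), p.2)) := by
    refine @Measurable.prodMk _ _ _ (_) (_) (_) _ _ ?_ ?_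
    · exact measurable_fst.subtype_mk
    · exact measurable_snd.mono le_rfl (ℱ.le _)
  exact @Measurable.comp _ _ _ (_) (_) (_) _ _ h2 h3

/-- Optional scalar processes, indexed by all real times. -/
def IsOpt (ℱ : Filtration (Set.Icc (0 : ℝ) T) mΩ) (X : ℝ → Ω → ℝ) : Prop :=
  Measurable[optionalSigma ℱ] (fun p : Set.Icc (0 : ℝ) T × Ω => X (p.1 : ℝ) p.2)

theorem isOpt_of_continuousOn {X : ℝ → Ω → ℝ}
    (hX : ∀ t : Set.Icc (0 : ℝ) T, Measurable[ℱ t] (X t))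
    (hc : ∀ ω, ContinuousOn (fun t => X t ω) (Set.Icc 0 T)) : IsOpt ℱ X := by
  let Y : Set.Icc (0 : ℝ) T → Ω → ℝ := fun t ω => X t ω
  have hY : Adapted ℱ Y ∧ ∀ ω, IsCadlagPath (fun t => Y t ω) := by
    refine ⟨hX, fun ω t => ?_⟩
    have hcY : Continuous (fun t => Y t ω) := continuousOn_iff_continuous_domRestrict.1 (hc ω)
    exact ⟨hcY.continuousWithinAt, Y t ω, (hcY.tendsto t).mono_left nhdsWithin_le_nhds⟩
  refine measurable_iff_comap_le.2 ?_
  exact le_iSup₂_of_le (f := fun (X : Set.Icc (0 : ℝ) T → Ω → ℝ)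
    (_ : Adapted ℱ X ∧ ∀ ω, IsCadlagPath (fun t => X t ω)) =>
    MeasurableSpace.comap (fun p : Set.Icc (0 : ℝ) T × Ω => X p.1 p.2) inferInstance) Y hY le_rfl

theorem isOpt_of_continuous_deterministic {f : ℝ → ℝ} (hf : Continuous f) :
    IsOpt ℱ (fun t _ => f t) :=
  isOpt_of_continuousOn (fun _ => measurable_const) fun _ => hf.continuousOn

/-- The indicator of the deterministic interval `[0, s)` is optional. -/
theorem isOpt_indicator_lt (s : ℝ) : IsOpt ℱ (fun t (_ : Ω) => if t < s then (1 : ℝ) else 0) := by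
  let Y : Set.Icc (0 : ℝ) T → Ω → ℝ := fun t _ => if (t : ℝ) < s then (1 : ℝ) else 0
  have hY : Adapted ℱ Y ∧ ∀ ω, IsCadlagPath (fun t => Y t ω) := by
    refine ⟨fun t => measurable_const, fun ω t => ?_⟩
    have hcv : Tendsto (fun u : Set.Icc (0 : ℝ) T => (u : ℝ)) (𝓝 t) (𝓝 (t : ℝ)) :=
      continuous_subtype_val.tendsto t
    rcases lt_or_ge (t : ℝ) s with h | h
    · have : ∀ᶠ u in 𝓝 t, Y u ω = 1 := by
        filter_upwards [hcv.eventually (gt_mem_nhds h)] with u hu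
        simp [Y, hu]
      have h1 : Y t ω = 1 := by simp [Y, h]
      refine ⟨?_, 1, ?_⟩
      · rw [ContinuousWithinAt, h1]
        exact (tendsto_const_nhds.congr' (this.mono fun _ h => h.symm)).mono_left nhdsWithin_le_nhds
      · exact (tendsto_const_nhds.congr' (this.mono fun _ h => h.symm)).mono_left nhdsWithin_le_nhds
    · have hr : ContinuousWithinAt (fun t => Y t ω) (Set.Ici t) t := by
        have h1 : Y t ω = 0 := by simp [Y, not_lt.2 h]
        rw [ContinuousWithinAt, h1]
        refine tendsto_const_nhds.congr' ?_
        filter_upwards [self_mem_nhdsWithin] with u hu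
        have : s ≤ (u : ℝ) := h.trans hu
        simp [Y, not_lt.2 this]
      -- At the jump time `s` itself the left limit is still `1`; afterwards it is `0`.
      rcases eq_or_lt_of_le h with h' | h'
      · refine ⟨hr, 1, tendsto_const_nhds.congr' ?_⟩
        filter_upwards [self_mem_nhdsWithin] with u hu
        have : (u : ℝ) < s := by rw [h']; exact hu
        simp [Y, this]
      · refine ⟨hr, 0, (tendsto_const_nhds.congr' ?_).mono_left nhdsWithin_le_nhds⟩
        filter_upwards [hcv.eventually (lt_mem_nhds h')] with u hu
        simp [Y, not_lt.2 hu.le]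
  refine measurable_iff_comap_le.2 ?_
  exact le_iSup₂_of_le (f := fun (X : Set.Icc (0 : ℝ) T → Ω → ℝ)
    (_ : Adapted ℱ X ∧ ∀ ω, IsCadlagPath (fun t => X t ω)) =>
    MeasurableSpace.comap (fun p : Set.Icc (0 : ℝ) T × Ω => X p.1 p.2) inferInstance) Y hY le_rfl

namespace IsOpt

variable {X Y : ℝ → Ω → ℝ}

theorem measurable_icc (hT : 0 ≤ T) (hX : IsOpt ℱ X) :
    Measurable (fun p : Set.Icc (0 : ℝ) T × Ω => X p.1 p.2) :=
  Measurable.mono hX (optionalSigma_le hT) le_rfl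

theorem adapted (hT : 0 ≤ T) (hX : IsOpt ℱ X) (t : Set.Icc (0 : ℝ) T) : Measurable[ℱ t] (X t) :=
  (isProgressive_of_optional (X := fun (t : Set.Icc (0 : ℝ) T) ω => X t ω) hT hX).adapted t

theorem add (hX : IsOpt ℱ X) (hY : IsOpt ℱ Y) : IsOpt ℱ (fun t ω => X t ω + Y t ω) :=
  Measurable.add hX hY

theorem sub (hX : IsOpt ℱ X) (hY : IsOpt ℱ Y) : IsOpt ℱ (fun t ω => X t ω - Y t ω) :=
  Measurable.sub hX hY

theorem mul (hX : IsOpt ℱ X) (hY : IsOpt ℱ Y) : IsOpt ℱ (fun t ω => X t ω * Y t ω) :=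
  Measurable.mul hX hY

theorem const_mul (hX : IsOpt ℱ X) (c : ℝ) : IsOpt ℱ (fun t ω => c * X t ω) :=
  Measurable.const_mul hX c

theorem sum {ι : Type*} (s : Finset ι) {X : ι → ℝ → Ω → ℝ} (hX : ∀ i ∈ s, IsOpt ℱ (X i)) :
    IsOpt ℱ (fun t ω => ∑ i ∈ s, X i t ω) :=
  Finset.measurable_sum s hX

theorem clip (hX : IsOpt ℱ X) (C : ℝ) : IsOpt ℱ (fun t ω => max (-C) (min C (X t ω))) :=
  Measurable.max measurable_const (Measurable.min measurable_const hX)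

/-- The integral up to time `t` of an optional process is known at time `t`. -/
theorem measurable_integral (hT : 0 ≤ T) (hX : IsOpt ℱ X) (t : Set.Icc (0 : ℝ) T) :
    Measurable[ℱ t] (fun ω => ∫ s in (0 : ℝ)..t, X s ω) :=
  @measurable_integral_of_progressive T Ω (ℱ t) hT X t
    (isProgressive_of_optional (X := fun (t : Set.Icc (0 : ℝ) T) ω => X t ω) hT hX t)

theorem measurable_path (hT : 0 ≤ T) (hX : IsOpt ℱ X) (ω : Ω) :
    AEStronglyMeasurable (fun t => X t ω) (volume.restrict (Set.Icc 0 T)) := by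
  have h1 : Measurable (fun t : ℝ => X (Set.projIcc 0 T hT t) ω) := by
    have hg : Measurable (fun t : ℝ => (Set.projIcc 0 T hT t, ω)) :=
      continuous_projIcc.measurable.prodMk measurable_const
    exact (hX.measurable_icc hT).comp hg
  refine h1.aestronglyMeasurable.congr ?_
  filter_upwards [ae_restrict_mem measurableSet_Icc] with t ht
  rw [Set.projIcc_of_mem hT ht]

theorem intervalIntegrable_of_bound (hT : 0 ≤ T) (hX : IsOpt ℱ X) {C : ℝ} {ω : Ω}
    (hC : ∀ᵐ t ∂(volume.restrict (Set.Icc 0 T)), |X t ω| ≤ C) {s t : ℝ} (hs : s ∈ Set.Icc 0 T)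
    (ht : t ∈ Set.Icc 0 T) :
    IntervalIntegrable (fun t => X t ω) volume s t := by
  have h : IntegrableOn (fun t => X t ω) (Set.Icc 0 T) :=
    Integrable.of_bound (hX.measurable_path hT ω) C hC
  exact (h.mono_set (Set.uIcc_subset_Icc hs ht)).intervalIntegrable

theorem continuousOn_integral (hT : 0 ≤ T) (hX : IsOpt ℱ X) {C : ℝ} {ω : Ω}
    (hC : ∀ᵐ t ∂(volume.restrict (Set.Icc 0 T)), |X t ω| ≤ C) :
    ContinuousOn (fun t => ∫ s in (0 : ℝ)..t, X s ω) (Set.Icc 0 T) := by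
  have h : IntegrableOn (fun t => X t ω) (Set.uIcc 0 T) := by
    rw [Set.uIcc_of_le hT]
    exact Integrable.of_bound (hX.measurable_path hT ω) C hC
  have := intervalIntegral.continuousOn_primitive_interval h
  rwa [Set.uIcc_of_le hT] at this

/-- The integral of a bounded optional process is optional. -/
theorem integral (hT : 0 ≤ T) (hX : IsOpt ℱ X) {C : ℝ}
    (hC : ∀ ω, ∀ t ∈ Set.Icc (0 : ℝ) T, |X t ω| ≤ C) :
    IsOpt ℱ (fun t ω => ∫ s in (0 : ℝ)..t, X s ω) :=
  isOpt_of_continuousOn (hX.measurable_integral hT)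
    fun ω => hX.continuousOn_integral hT
      ((ae_restrict_mem measurableSet_Icc).mono fun t ht => hC ω t ht)

end IsOpt

end OptionalProcesses

/-! ### Independence of the Brownian past and future. -/

section Independence

variable {Ω : Type*} {mΩ : MeasurableSpace Ω} {P : Measure Ω}

/-- Integration against independent variables: integrate out the second one first. -/
theorem integral_eq_integral_integral_of_indep [IsProbabilityMeasure P] {α β : Type*}
    [MeasurableSpace α] [MeasurableSpace β] {x : Ω → α} {y : Ω → β} (hx : Measurable x)
    (hy : Measurable y) (hxy : IndepFun x y P) {F : α × β → ℝ} (hF : StronglyMeasurable F)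
    (hint : Integrable (fun ω => F (x ω, y ω)) P) :
    ∫ ω, F (x ω, y ω) ∂P = ∫ ω, ∫ ω', F (x ω, y ω') ∂P ∂P := by
  have hmap := hxy.map_prod_eq_prod_map_map hx.aemeasurable hy.aemeasurable
  have := Measure.isProbabilityMeasure_map (μ := P) hx.aemeasurable
  have := Measure.isProbabilityMeasure_map (μ := P) hy.aemeasurable
  have h1 : Integrable F ((P.map x).prod (P.map y)) := by
    rw [← hmap]
    exact (integrable_map_measure hF.aestronglyMeasurable (hx.prodMk hy).aemeasurable).2 hint
  calc ∫ ω, F (x ω, y ω) ∂P = ∫ z, F z ∂(P.map fun ω => (x ω, y ω)) :=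
        (integral_map (hx.prodMk hy).aemeasurable hF.aestronglyMeasurable).symm
    _ = ∫ a, ∫ b, F (a, b) ∂(P.map y) ∂(P.map x) := by rw [hmap, integral_prod _ h1]
    _ = ∫ ω, ∫ b, F (x ω, b) ∂(P.map y) ∂P := by
        refine integral_map hx.aemeasurable ?_
        exact hF.integral_prod_right'.aestronglyMeasurable
    _ = _ := by
        refine integral_congr_ae (ae_of_all _ fun ω => ?_)
        exact integral_map hy.aemeasurable
          (hF.comp_measurable measurable_prodMk_left).aestronglyMeasurable

/-- Turns the independence of past and future of one component into that of a family indexed by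
`Bool`, so that it can be merged with the independence across components. -/
theorem iIndepFun_bool {β : Bool → Type*} [∀ b, MeasurableSpace (β b)] {X : ∀ b, Ω → β b}
    [IsProbabilityMeasure P] (h : IndepFun (X true) (X false) P) : iIndepFun X P := by
  rw [iIndepFun_iff]
  intro s f' hf'
  have key : ∀ s : Finset Bool, s = ∅ ∨ s = {true} ∨ s = {false} ∨ s = {true, false} := by decide
  rcases key s with rfl | rfl | rfl | rfl
  · simp
  · simp
  · simp
  · rw [Finset.set_biInter_insert, Finset.set_biInter_singleton, Finset.prod_pair (by simp)]
    exact (IndepFun_iff _ _ _).1 h _ _ (hf' true (by simp)) (hf' false (by simp))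

/-- For independent processes with independent increments after time `t₀`, the joint past is
independent of the joint future increments. -/
theorem indep_past_future [IsProbabilityMeasure P] {ι : Type*} {W : ι → ℝ≥0 → Ω → ℝ}
    (hm : ∀ i t, Measurable (W i t)) (hW : ∀ i, IsPreBrownianReal (W i) P)
    (hind : iIndepFun (fun (i : ι) (ω : Ω) (t : ℝ≥0) => W i t ω) P) (t₀ : ℝ≥0) :
    Indep (⨆ (i : ι) (s : ℝ≥0) (_ : s ≤ t₀), MeasurableSpace.comap (W i s) inferInstance)
      (⨆ (i : ι) (s : ℝ≥0),
        MeasurableSpace.comap (fun ω => W i (t₀ + s) ω - W i t₀ ω) inferInstance) P := by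
  -- For each component, `true` carries the path stopped at `t₀` and `false` the increments after
  -- `t₀`. Independence across `ι` and across `Bool` combine into independence over `ι × Bool`,
  -- which is then grouped by the second index.
  let X : (i : ι) → Bool → Ω → (ℝ≥0 → ℝ) := fun i b ω s =>
    if b then W i (min s t₀) ω else W i (t₀ + s) ω - W i t₀ ω
  have hXm : ∀ i b, Measurable (X i b) := by
    intro i b
    refine measurable_pi_lambda _ fun s => ?_
    cases b
    · simpa only [X, Bool.false_eq_true, if_false] using! (hm i (t₀ + s)).sub (hm i t₀)
    · simpa [X] using hm i _
  have h1 : iIndepFun (fun i ω b => X i b ω) P := by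
    refine hind.comp (fun _ p (b : Bool) (s : ℝ≥0) => if b then p (min s t₀) else p (t₀ + s) - p t₀)
      fun i => ?_
    refine measurable_pi_lambda _ fun b => measurable_pi_lambda _ fun s => ?_
    cases b
    · simpa only [Bool.false_eq_true, if_false] using!
        (measurable_pi_apply (t₀ + s)).sub (measurable_pi_apply t₀)
    · simpa using measurable_pi_apply _
  have h2 : ∀ i, iIndepFun (X i) P := by
    intro i
    refine iIndepFun_bool ?_
    have := ((hW i).indepFun_shift t₀).symm
    refine this.comp (φ := fun p (s : ℝ≥0) => p ⟨min s t₀, Set.mem_Iic.2 (min_le_right _ _)⟩) (ψ := id) ?_ measurable_id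
    exact measurable_pi_lambda _ fun s => measurable_pi_apply _
  have h3 := (iIndepFun_uncurry' hXm h1 h2).iIndep
  have h4 := indep_iSup_of_disjoint (fun p : ι × Bool => (hXm p.1 p.2).comap_le) h3
    (S := {p : ι × Bool | p.2 = true}) (T := {p : ι × Bool | p.2 = false}) (by
      rw [Set.disjoint_left]
      intro p hp hq
      simp_all)
  refine indep_of_indep_of_le_left (indep_of_indep_of_le_right h4 ?_) ?_
  · refine iSup₂_le fun i s => le_iSup₂_of_le (i, false) rfl ?_
    rw [← measurable_iff_comap_le]
    have : Measurable[MeasurableSpace.comap (X i false) inferInstance] (X i false) :=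
      comap_measurable _
    exact (measurable_pi_apply s).comp this
  · refine iSup₂_le fun i s => iSup_le fun hs => le_iSup₂_of_le (i, true) rfl ?_
    rw [← measurable_iff_comap_le]
    have : Measurable[MeasurableSpace.comap (X i true) inferInstance] (X i true) :=
      comap_measurable _
    have h := (measurable_pi_apply s).comp this
    convert h using 1
    ext ω
    simp [X, min_eq_left hs]

end Independence

/-! ### The augmented filtration modulo null events. -/

namespace Economy

variable {d N : ℕ} {Ω : Type*} [mΩ : MeasurableSpace Ω] {P : Measure Ω} (E : Economy d N P)

/-- The events generated by the Brownian motion up to time `t`, without augmentation. -/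
@[reducible] def past (t : ℝ) : MeasurableSpace Ω :=
  ⨆ (i : Fin d) (s : ℝ≥0) (_ : (s : ℝ) ≤ t), MeasurableSpace.comap (E.W i s) inferInstance

theorem past_le (t : ℝ) : E.past t ≤ mΩ :=
  iSup_le fun i => iSup_le fun s => iSup_le fun _ => (E.W_measurable i s).comap_le

theorem past_le_filtration (t : Set.Icc (0 : ℝ) E.T) : E.past t ≤ E.filtration t := le_sup_left

/-- Allows processes to be redefined on a null event without losing adaptedness, even at time `0`.
-/
theorem measurableSet_filtration_of_null {A : Set Ω} (hA : MeasurableSet A) (h0 : P A = 0)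
    (t : Set.Icc (0 : ℝ) E.T) : MeasurableSet[E.filtration t] A := by
  have h : MeasurableSpace.generateFrom {A | MeasurableSet A ∧ P A = 0} ≤ E.filtration t :=
    le_sup_right
  exact h _ (MeasurableSpace.measurableSet_generateFrom ⟨hA, h0⟩)

/-- Augmentation only adds events equivalent to `∅`. Identities between integrals over events of the
filtration thus need checking on events of the Brownian past only, where independence is available.
-/
theorem filtration_le_eventuallyMeasurable (t : Set.Icc (0 : ℝ) E.T) :
    E.filtration t ≤ eventuallyMeasurableSpace (E.past t) (ae P) := by
  refine sup_le le_eventuallyMeasurableSpace (MeasurableSpace.generateFrom_le fun A hA => ?_)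
  refine ⟨∅, @MeasurableSet.empty _ (E.past t), ?_⟩
  exact ae_eq_empty.2 hA.2

end Economy

/-! ### Continuous conditional expectations for functions of countably many Brownian values. -/

namespace Economy

variable {d N : ℕ} {Ω : Type*} [mΩ : MeasurableSpace Ω] {P : Measure Ω} (E : Economy d N P)

/-- The conditional expectations of `ξ` have a version with continuous paths. -/
def HasContinuousVersion (ξ : Ω → ℝ) : Prop :=
  ∃ Z : Set.Icc (0 : ℝ) E.T → Ω → ℝ, (∀ t, Measurable[E.filtration t] (Z t)) ∧
    (∀ ω, Continuous fun t => Z t ω) ∧ ∀ t, Z t =ᵐ[P] P[ξ | E.filtration t]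

/-- A dense sequence of times in `[0, T]`. -/
def skelTime (k : ℕ) : ℝ≥0 := min (TopologicalSpace.denseSeq ℝ≥0 k) E.T.toNNReal

/-- The Brownian motion along a dense sequence of times. -/
def skel (ω : Ω) : Fin d × ℕ → ℝ := fun p => E.W p.1 (E.skelTime p.2) ω

theorem measurable_skel : Measurable E.skel := measurable_pi_lambda _ fun p => E.W_measurable p.1 _

/-- The skeleton stopped at time `t`. -/
def skelPast (t : ℝ) (ω : Ω) : Fin d × ℕ → ℝ := fun p =>
  E.W p.1 (min (E.skelTime p.2) t.toNNReal) ω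

/-- The increments of the skeleton after time `t`. -/
def skelFuture (t : ℝ) (ω : Ω) : Fin d × ℕ → ℝ := fun p =>
  E.W p.1 (E.skelTime p.2) ω - E.W p.1 (min (E.skelTime p.2) t.toNNReal) ω

theorem skelPast_add_skelFuture (t : ℝ) (ω : Ω) : E.skelPast t ω + E.skelFuture t ω = E.skel ω := by
  ext p
  simp [skelPast, skelFuture, skel]

theorem measurable_skelPast (t : Set.Icc (0 : ℝ) E.T) : Measurable[E.past t] (E.skelPast t) := by
  refine @measurable_pi_lambda _ _ _ (E.past t) _ _ fun p => ?_
  rw [measurable_iff_comap_le]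
  refine le_iSup_of_le p.1 (le_iSup₂_of_le (min (E.skelTime p.2) (t : ℝ).toNNReal) ?_ le_rfl)
  exact (NNReal.coe_le_coe.2 (min_le_right _ _)).trans (Real.coe_toNNReal _ t.2.1).le

theorem measurable_skelFuture_future (t : ℝ) :
    Measurable[⨆ (i : Fin d) (s : ℝ≥0), MeasurableSpace.comap
      (fun ω => E.W i (t.toNNReal + s) ω - E.W i t.toNNReal ω) inferInstance] (E.skelFuture t) := by
  refine @measurable_pi_lambda _ _ _ (_) _ _ fun p => ?_
  rcases le_total (E.skelTime p.2) t.toNNReal with h | h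
  · simp only [skelFuture, min_eq_left h, sub_self]
    exact measurable_const
  · simp only [skelFuture, min_eq_right h]
    rw [measurable_iff_comap_le]
    refine le_iSup₂_of_le p.1 (E.skelTime p.2 - t.toNNReal) ?_
    rw [add_tsub_cancel_of_le h]

theorem measurable_skelFuture (t : ℝ) : Measurable (E.skelFuture t) :=
  measurable_pi_lambda _ fun _ => (E.W_measurable _ _).sub (E.W_measurable _ _)

theorem indep_skel [IsProbabilityMeasure P] (t : Set.Icc (0 : ℝ) E.T) :
    Indep (E.past t) (MeasurableSpace.comap (E.skelFuture t) inferInstance) P := by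
  have h := indep_past_future E.W_measurable (fun i => (E.W_brownian i).toIsPreBrownianReal)
    E.W_indep (t : ℝ).toNNReal
  refine indep_of_indep_of_le_left (indep_of_indep_of_le_right h
    (E.measurable_skelFuture_future t).comap_le) ?_
  refine iSup_le fun i => iSup_le fun s => iSup_le fun hs => ?_
  refine le_iSup_of_le i (le_iSup₂_of_le s ?_ le_rfl)
  rw [← NNReal.coe_le_coe, Real.coe_toNNReal _ t.2.1]
  exact hs

theorem ae_continuous_paths : ∀ᵐ ω ∂P, ∀ i, Continuous fun t => E.W i t ω :=
  ae_all_iff.2 fun i => (E.W_brownian i).cont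

/-- The skeleton is the sum of a part known at `t` and an independent part. Its conditional
expectation is therefore `∫ f (skelPast t ω + skelFuture t ω') dP(ω')`, which is continuous in `t`
by dominated convergence along continuous paths. -/
theorem hasContinuousVersion_skel [IsProbabilityMeasure P]
    (f : BoundedContinuousFunction (Fin d × ℕ → ℝ) ℝ) :
    E.HasContinuousVersion fun ω => f (E.skel ω) := by
  classical
  -- A measurable null event containing all discontinuous paths; the version is set to `0` there to
  -- be continuous for every `ω`.
  let B : Set Ω := toMeasurable P {ω | ¬ ∀ i, Continuous fun t => E.W i t ω}
  have hBm : MeasurableSet B := measurableSet_toMeasurable _ _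
  have hB0 : P B = 0 := by rw [measure_toMeasurable]; exact E.ae_continuous_paths
  have hB : ∀ ω, ω ∉ B → ∀ i, Continuous fun t => E.W i t ω := fun ω hω => by
    by_contra h
    exact hω (subset_toMeasurable _ _ h)
  let g : Set.Icc (0 : ℝ) E.T → (Fin d × ℕ → ℝ) → ℝ := fun t a =>
    ∫ ω', f (a + E.skelFuture t ω') ∂P
  have hgm : ∀ t, Measurable (g t) := by
    intro t
    have h : StronglyMeasurable (fun z : (Fin d × ℕ → ℝ) × Ω => f (z.1 + E.skelFuture t z.2)) :=
      (f.continuous.measurable.comp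
        (measurable_fst.add ((E.measurable_skelFuture t).comp measurable_snd))).stronglyMeasurable
    exact h.integral_prod_right'.measurable
  have hZm : ∀ t : Set.Icc (0 : ℝ) E.T, Measurable[E.past t] fun ω => g t (E.skelPast t ω) := fun t =>
    (hgm t).comp (E.measurable_skelPast t)
  have hcont : ∀ ω, (∀ i, Continuous fun t => E.W i t ω) →
      Continuous (fun t : Set.Icc (0 : ℝ) E.T => E.skelPast t ω) ∧
      Continuous (fun t : Set.Icc (0 : ℝ) E.T => E.skelFuture t ω) := by
    intro ω hω
    have h : ∀ p : Fin d × ℕ, Continuous (fun t : Set.Icc (0 : ℝ) E.T =>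
        E.W p.1 (min (E.skelTime p.2) (t : ℝ).toNNReal) ω) := fun p =>
      (hω p.1).comp (continuous_const.min (continuous_real_toNNReal.comp continuous_subtype_val))
    exact ⟨continuous_pi fun p => h p, continuous_pi fun p => continuous_const.sub (h p)⟩
  refine ⟨fun t ω => if ω ∈ B then 0 else g t (E.skelPast t ω), fun t => ?_, fun ω => ?_,
    fun t => ?_⟩
  · exact Measurable.ite (E.measurableSet_filtration_of_null hBm hB0 t) measurable_const
      ((hZm t).mono (E.past_le_filtration t) le_rfl)
  · by_cases hω : ω ∈ B
    · simpa [hω] using continuous_const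
    · simp only [hω, if_false]
      refine continuous_of_dominated (bound := fun _ => ‖f‖) (fun t => ?_)
        (fun t => ae_of_all _ fun ω' => f.norm_coe_le_norm _) (integrable_const _) ?_
      · exact (f.continuous.measurable.comp
          (measurable_const.add (E.measurable_skelFuture t))).aestronglyMeasurable
      · filter_upwards [E.ae_continuous_paths] with ω' hω'
        exact f.continuous.comp ((hcont ω (hB ω hω)).1.add (hcont ω' hω').2)
  · have hfint : Integrable (fun ω => f (E.skel ω)) P :=
      Integrable.of_bound (f.continuous.measurable.comp E.measurable_skel).aestronglyMeasurable ‖f‖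
        (ae_of_all _ fun ω => f.norm_coe_le_norm _)
    have hae : (fun ω => if ω ∈ B then 0 else g t (E.skelPast t ω)) =ᵐ[P]
        fun ω => g t (E.skelPast t ω) := by
      filter_upwards [measure_eq_zero_iff_ae_notMem.1 hB0] with ω hω
      simp [hω]
    have hgint : Integrable (fun ω => g t (E.skelPast t ω)) P := by
      refine Integrable.of_bound ((hZm t).mono (E.past_le t) le_rfl).aestronglyMeasurable ‖f‖
        (ae_of_all _ fun ω => ?_)
      refine (norm_integral_le_of_norm_le_const (ae_of_all _ fun ω' => f.norm_coe_le_norm _)).trans ?_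
      simp
    refine hae.trans ?_
    refine ae_eq_condExp_of_forall_setIntegral_eq (E.filtration.le t) hfint
      (fun s _ _ => hgint.integrableOn) (fun s hs _ => ?_)
      ((hZm t).mono (E.past_le_filtration t) le_rfl).aestronglyMeasurable
    obtain ⟨A, hA, hsA⟩ := E.filtration_le_eventuallyMeasurable t s hs
    rw [setIntegral_congr_set hsA, setIntegral_congr_set hsA]
    have hAm : MeasurableSet A := E.past_le t _ hA
    rw [← integral_indicator hAm, ← integral_indicator hAm]
    have h1 : Measurable[E.past t] (A.indicator fun _ => (1 : ℝ)) := measurable_const.indicator hA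
    -- The indicator of the event is bundled with the past of the skeleton, so that a single
    -- application of Fubini for independent variables gives the integral over `A`.
    have hx : Measurable[E.past t] (fun ω => (A.indicator (fun _ => (1 : ℝ)) ω, E.skelPast t ω)) :=
      h1.prodMk (E.measurable_skelPast t)
    have hind : IndepFun (fun ω => (A.indicator (fun _ => (1 : ℝ)) ω, E.skelPast t ω))
        (E.skelFuture t) P :=
      indep_of_indep_of_le_left (E.indep_skel t) hx.comap_le
    have hF : StronglyMeasurable (fun z : (ℝ × (Fin d × ℕ → ℝ)) × (Fin d × ℕ → ℝ) =>
        z.1.1 * f (z.1.2 + z.2)) := by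
      refine Measurable.stronglyMeasurable ?_
      refine (measurable_fst.comp measurable_fst).mul (f.continuous.measurable.comp ?_)
      exact (measurable_snd.comp measurable_fst).add measurable_snd
    have hrew : ∀ ω, A.indicator (fun _ => (1 : ℝ)) ω * f (E.skelPast t ω + E.skelFuture t ω) =
        A.indicator (fun ω => f (E.skel ω)) ω := by
      intro ω
      rw [skelPast_add_skelFuture]
      by_cases h : ω ∈ A <;> simp [h]
    have := integral_eq_integral_integral_of_indep (hx.mono (E.past_le t) le_rfl)
      (E.measurable_skelFuture t) hind hF (by
        simp only [hrew]
        exact hfint.indicator hAm)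
    simp only [hrew] at this
    rw [this]
    refine integral_congr_ae (ae_of_all _ fun ω => ?_)
    by_cases h : ω ∈ A <;> simp [h, g]

theorem exists_seq_skelTime (s : ℝ≥0) (hs : (s : ℝ) ≤ E.T) :
    ∃ k : ℕ → ℕ, Tendsto (fun n => E.skelTime (k n)) atTop (𝓝 s) := by
  have h : s ∈ closure (Set.range (TopologicalSpace.denseSeq ℝ≥0)) :=
    TopologicalSpace.denseRange_denseSeq ℝ≥0 s
  obtain ⟨x, hx, hxs⟩ := mem_closure_iff_seq_limit.1 h
  choose k hk using hx
  refine ⟨k, ?_⟩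
  have h2 : min s E.T.toNNReal = s := min_eq_left (NNReal.le_toNNReal_of_coe_le hs)
  have := hxs.min (tendsto_const_nhds (x := E.T.toNNReal))
  rw [h2] at this
  simpa [skelTime, hk] using this

/-- By continuity of paths each Brownian value is almost surely the limit along skeleton times; the
`limsup` is a representative that is measurable everywhere. -/
theorem past_le_eventuallyMeasurable_skel :
    E.past E.T ≤ eventuallyMeasurableSpace (MeasurableSpace.comap E.skel inferInstance) (ae P) := by
  refine iSup_le fun i => iSup_le fun s => iSup_le fun hs => ?_
  rw [← measurable_iff_comap_le]
  obtain ⟨k, hk⟩ := E.exists_seq_skelTime s hs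
  have hg : Measurable[MeasurableSpace.comap E.skel inferInstance]
      (fun ω => limsup (fun n => E.W i (E.skelTime (k n)) ω) atTop) := by
    have h : ∀ n, Measurable[MeasurableSpace.comap E.skel inferInstance]
        (fun ω => E.W i (E.skelTime (k n)) ω) := fun n =>
      (measurable_pi_apply ((i, k n) : Fin d × ℕ)).comp (comap_measurable E.skel)
    exact Measurable.limsup h
  refine hg.eventuallyMeasurable_of_eventuallyEq ?_
  filter_upwards [E.ae_continuous_paths] with ω hω
  exact (((hω i).tendsto s).comp hk).limsup_eq.symm

theorem comap_skel_le_past : MeasurableSpace.comap E.skel inferInstance ≤ E.past E.T := by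
  rw [← measurable_iff_comap_le]
  refine @measurable_pi_lambda _ _ _ (_) _ _ fun p => ?_
  rw [measurable_iff_comap_le]
  refine le_iSup_of_le p.1 (le_iSup₂_of_le (E.skelTime p.2) ?_ le_rfl)
  refine (NNReal.coe_le_coe.2 (min_le_right _ _)).trans (Real.coe_toNNReal _ E.T_pos.le).le

/-- The terminal time, as an element of `[0, T]`. -/
def top : Set.Icc (0 : ℝ) E.T := ⟨E.T, Set.right_mem_Icc.2 E.T_pos.le⟩

/-- The skeleton generates the filtration at time `T` up to null events, so conditioning on either
gives the same result. -/
theorem condExp_top_eq_skel [IsProbabilityMeasure P] {ξ : Ω → ℝ} (hξ : Integrable ξ P) :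
    P[ξ | MeasurableSpace.comap E.skel inferInstance] =ᵐ[P] P[ξ | E.filtration E.top] := by
  have hle := E.measurable_skel.comap_le
  have hle2 : MeasurableSpace.comap E.skel inferInstance ≤ E.filtration E.top :=
    E.comap_skel_le_past.trans (E.past_le_filtration E.top)
  refine ae_eq_condExp_of_forall_setIntegral_eq (E.filtration.le _) hξ
    (fun s _ _ => integrable_condExp.integrableOn) (fun s hs _ => ?_)
    (stronglyMeasurable_condExp.mono hle2).aestronglyMeasurable
  obtain ⟨A, hA, hsA⟩ := E.filtration_le_eventuallyMeasurable E.top s hs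
  obtain ⟨B, hB, hAB⟩ := E.past_le_eventuallyMeasurable_skel A hA
  rw [setIntegral_congr_set (hsA.trans hAB), setIntegral_congr_set (hsA.trans hAB),
    setIntegral_condExp hle hξ hB]

/-- Every integrable variable known at time `T` is approximated in mean by variables whose
conditional expectations have a continuous version. -/
theorem exists_hasContinuousVersion_near [IsProbabilityMeasure P] {ξ : Ω → ℝ}
    (hξ : Integrable ξ P) {ε : ℝ} (hε : 0 < ε) :
    ∃ η : Ω → ℝ, Integrable η P ∧ E.HasContinuousVersion η ∧
      ∫ ω, |(P[ξ | E.filtration E.top]) ω - η ω| ∂P ≤ ε := by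
  -- The conditional expectation is a function of the skeleton, and bounded continuous functions are
  -- dense in mean for the law of the skeleton.
  obtain ⟨g, hg, hgeq⟩ := (stronglyMeasurable_condExp (μ := P) (f := ξ)
    (m := MeasurableSpace.comap E.skel inferInstance)).measurable.exists_eq_measurable_comp
  have hprob := Measure.isProbabilityMeasure_map (μ := P) E.measurable_skel.aemeasurable
  have hgint : Integrable g (P.map E.skel) := by
    rw [integrable_map_measure hg.aestronglyMeasurable E.measurable_skel.aemeasurable, ← hgeq]
    exact integrable_condExp
  obtain ⟨f, hf, hfint⟩ := hgint.exists_boundedContinuous_integral_sub_le hε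
  refine ⟨fun ω => f (E.skel ω), ?_, E.hasContinuousVersion_skel f, ?_⟩
  · exact (integrable_map_measure f.continuous.measurable.aestronglyMeasurable
      E.measurable_skel.aemeasurable).1 hfint
  · have hm : Measurable fun x => ‖g x - f x‖ := (hg.sub f.continuous.measurable).norm
    rw [integral_map E.measurable_skel.aemeasurable hm.aestronglyMeasurable] at hf
    refine le_trans (le_of_eq (integral_congr_ae ?_)) hf
    filter_upwards [E.condExp_top_eq_skel hξ] with ω hω
    rw [← hω, hgeq]
    rfl

end Economy

/-! ### Maximal inequality and continuous versions of all Brownian martingales. -/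

namespace Economy

variable {d N : ℕ} {Ω : Type*} [mΩ : MeasurableSpace Ω] {P : Measure Ω} (E : Economy d N P)

/-- The dyadic grid of mesh `T / 2 ^ j`, stopped at `T`. -/
def grid (j k : ℕ) : Set.Icc (0 : ℝ) E.T := Set.projIcc 0 E.T E.T_pos.le (E.T * (k / 2 ^ j))

theorem grid_mono (j : ℕ) : Monotone (E.grid j) := by
  intro k l hkl
  refine Set.monotone_projIcc E.T_pos.le ?_
  have := E.T_pos.le
  have : (k : ℝ) ≤ l := by exact_mod_cast hkl
  gcongr

theorem grid_succ (j k : ℕ) : E.grid (j + 1) (2 * k) = E.grid j k := by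
  unfold grid
  congr 2
  push_cast
  rw [pow_succ]
  field_simp

theorem tendsto_grid (t : Set.Icc (0 : ℝ) E.T) :
    Tendsto (fun j => E.grid j ⌊(t / E.T : ℝ) * 2 ^ j⌋₊) atTop (𝓝 t) := by
  have hT := E.T_pos
  have h1 : Tendsto (fun j : ℕ => ((⌊(t / E.T : ℝ) * 2 ^ j⌋₊ : ℝ) / 2 ^ j)) atTop
      (𝓝 (t / E.T : ℝ)) :=
    (tendsto_nat_floor_mul_div_atTop (div_nonneg t.2.1 hT.le)).comp
      (tendsto_pow_atTop_atTop_of_one_lt (by norm_num : (1 : ℝ) < 2))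
  have h2 := (continuous_projIcc (h := hT.le)).tendsto _ |>.comp (h1.const_mul E.T)
  have h3 : E.T * (t / E.T : ℝ) = t := by field_simp
  rw [h3, Set.projIcc_of_mem hT.le t.2] at h2
  exact h2

/-- Weak type maximal inequality for continuous versions of conditional expectations. -/
theorem maximal_inequality [IsProbabilityMeasure P] {η : Ω → ℝ}
    {Z : Set.Icc (0 : ℝ) E.T → Ω → ℝ} (hZ : ∀ t, Measurable[E.filtration t] (Z t))
    (hc : ∀ ω, Continuous fun t => Z t ω) (hZη : ∀ t, Z t =ᵐ[P] P[η | E.filtration t])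
    (ε : ℝ≥0) :
    ε * P {ω | ∃ t, (ε : ℝ) < |Z t ω|} ≤ ENNReal.ofReal (∫ ω, |η ω| ∂P) := by
  let S : ℕ → Set Ω := fun j => {ω | ∃ k ≤ 2 ^ j, (ε : ℝ) < |Z (E.grid j k) ω|}
  have hmono : Monotone S := by
    refine monotone_nat_of_le_succ fun j ω => ?_
    rintro ⟨k, hk, h⟩
    refine ⟨2 * k, by rw [pow_succ]; omega, ?_⟩
    rwa [grid_succ]
  -- A strict exceedance by a continuous path is already seen at a dyadic time.
  have hsub : {ω | ∃ t, (ε : ℝ) < |Z t ω|} ⊆ ⋃ j, S j := by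
    rintro ω ⟨t, ht⟩
    have h1 := ((hc ω).abs.tendsto t).comp (E.tendsto_grid t)
    obtain ⟨j, hj⟩ := (h1.eventually (lt_mem_nhds ht)).exists
    refine Set.mem_iUnion.2 ⟨j, _, ?_, hj⟩
    refine Nat.floor_le_of_le ?_
    push_cast
    exact mul_le_of_le_one_left (by positivity) (div_le_one_of_le₀ t.2.2 E.T_pos.le)
  have hS : ∀ j, ε * P (S j) ≤ ENNReal.ofReal (∫ ω, |η ω| ∂P) := by
    intro j
    -- Along a fixed grid the process is a martingale in discrete time, to which Doob's inequality
    -- applies.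
    let 𝒢 : Filtration ℕ mΩ :=
      ⟨fun k => E.filtration (E.grid j k), fun k l h => E.filtration.mono (E.grid_mono j h),
        fun k => E.filtration.le _⟩
    have hM : Martingale (fun k => Z (E.grid j k)) 𝒢 P := by
      refine ⟨fun k => (hZ _).stronglyMeasurable, fun k l hkl => ?_⟩
      refine (condExp_congr_ae (hZη (E.grid j l))).trans ?_
      refine (condExp_condExp_of_le (E.filtration.mono (E.grid_mono j hkl))
        (E.filtration.le _)).trans ?_
      exact (hZη _).symm
    have hsubm : Submartingale (fun k ω => |Z (E.grid j k) ω|) 𝒢 P :=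
      hM.submartingale.sup hM.neg.submartingale
    have hmax := maximal_ineq hsubm (fun k ω => abs_nonneg _) (ε := ε) (2 ^ j)
    have hle : S j ⊆ {ω | (ε : ℝ) ≤ (Finset.range (2 ^ j + 1)).sup' Finset.nonempty_range_add_one
        fun k => |Z (E.grid j k) ω|} := by
      rintro ω ⟨k, hk, h⟩
      exact h.le.trans (Finset.le_sup' (fun k => |Z (E.grid j k) ω|)
        (Finset.mem_range.2 (Nat.lt_succ_of_le hk)))
    refine (mul_le_mul_right (measure_mono hle) _).trans (hmax.trans ?_)
    refine ENNReal.ofReal_le_ofReal ?_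
    refine (setIntegral_le_integral (hsubm.integrable _) (ae_of_all _ fun ω => abs_nonneg _)).trans ?_
    refine le_trans (le_of_eq (integral_congr_ae ?_))
      (integral_abs_condExp_le (m := E.filtration (E.grid j (2 ^ j))) η)
    filter_upwards [hZη (E.grid j (2 ^ j))] with ω hω
    rw [hω]
  calc ε * P {ω | ∃ t, (ε : ℝ) < |Z t ω|} ≤ ε * P (⋃ j, S j) := by gcongr
    _ = ⨆ j, ε * P (S j) := by rw [hmono.measure_iUnion, ENNReal.mul_iSup]
    _ ≤ _ := iSup_le hS

/-- Every integrable variable has continuous conditional expectations along the Brownian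
filtration. -/
theorem hasContinuousVersion [IsProbabilityMeasure P] {ξ : Ω → ℝ} (hξ : Integrable ξ P) :
    E.HasContinuousVersion ξ := by
  classical
  -- Errors of order `4⁻ⁿ` in mean, compared with thresholds `2⁻ⁿ` below, give exceedance
  -- probabilities of order `2⁻ⁿ`, which are summable.
  have hex := fun n : ℕ => E.exists_hasContinuousVersion_near hξ
    (ε := (1 / 4 : ℝ) ^ n) (by positivity)
  choose η hηint hηv hηle using hex
  choose Z hZm hZc hZη using hηv
  set ξ' := P[ξ | E.filtration E.top] with hξ'
  have hξ'int : Integrable ξ' P := integrable_condExp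
  have hdiff : ∀ n, ∫ ω, |η (n + 1) ω - η n ω| ∂P ≤ 2 * (1 / 4 : ℝ) ^ n := by
    intro n
    have h1 : Integrable (fun ω => |ξ' ω - η (n + 1) ω|) P := (hξ'int.sub (hηint _)).abs
    have h2 : Integrable (fun ω => |ξ' ω - η n ω|) P := (hξ'int.sub (hηint _)).abs
    calc ∫ ω, |η (n + 1) ω - η n ω| ∂P
        ≤ ∫ ω, (|ξ' ω - η (n + 1) ω| + |ξ' ω - η n ω|) ∂P := by
          refine integral_mono ((hηint _).sub (hηint _)).abs (h1.add h2) fun ω => ?_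
          have := abs_sub_le (η (n + 1) ω) (ξ' ω) (η n ω)
          rwa [abs_sub_comm (η (n + 1) ω) (ξ' ω)] at this
      _ ≤ (1 / 4 : ℝ) ^ (n + 1) + (1 / 4 : ℝ) ^ n := by
          rw [integral_add h1 h2]
          exact add_le_add (hηle _) (hηle _)
      _ ≤ 2 * (1 / 4 : ℝ) ^ n := by
          rw [pow_succ]
          have : (0 : ℝ) ≤ (1 / 4 : ℝ) ^ n := by positivity
          linarith
  let S : ℕ → Set Ω := fun n => {ω | ∃ t, (1 / 2 : ℝ) ^ n < |Z (n + 1) t ω - Z n t ω|}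
  have hS : ∀ n, P (S n) ≤ 2 * (1 / 2 : ℝ≥0∞) ^ n := by
    intro n
    have h := E.maximal_inequality (η := fun ω => η (n + 1) ω - η n ω)
      (Z := fun t ω => Z (n + 1) t ω - Z n t ω)
      (fun t => (hZm _ t).sub (hZm _ t)) (fun ω => (hZc _ ω).sub (hZc _ ω)) (fun t => by
        refine EventuallyEq.trans ?_ (condExp_sub (hηint (n + 1)) (hηint n) _).symm
        exact (hZη (n + 1) t).sub (hZη n t)) ((1 / 2 : ℝ≥0) ^ n)
    have hcoe : (((1 / 2 : ℝ≥0) ^ n : ℝ≥0) : ℝ) = (1 / 2 : ℝ) ^ n := by push_cast; rfl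
    rw [hcoe] at h
    have h2 := h.trans (ENNReal.ofReal_le_ofReal (hdiff n))
    have h3 : ENNReal.ofReal (2 * (1 / 4 : ℝ) ^ n) =
        (((1 / 2 : ℝ≥0) ^ n : ℝ≥0) : ℝ≥0∞) * (2 * (1 / 2 : ℝ≥0∞) ^ n) := by
      have : (1 / 2 : ℝ≥0∞) = ((1 / 2 : ℝ≥0) : ℝ≥0∞) := by
        rw [ENNReal.coe_div (by norm_num)]; norm_num
      rw [this, ← ENNReal.coe_pow, ← ENNReal.coe_ofNat, ← ENNReal.coe_mul, ← ENNReal.coe_mul]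
      rw [ENNReal.ofReal, ENNReal.coe_inj, Real.toNNReal_eq_iff_eq_coe (by positivity)]
      push_cast
      rw [mul_left_comm, ← mul_pow]
      norm_num
    rw [h3] at h2
    exact (ENNReal.mul_le_mul_iff_right (by simp) (by simp)).1 h2
  have hsum : ∑' n, P (S n) ≠ ∞ := by
    refine ne_top_of_le_ne_top ?_ (ENNReal.tsum_le_tsum hS)
    rw [ENNReal.tsum_mul_left, ENNReal.tsum_geometric, one_div, ENNReal.one_sub_inv_two, inv_inv]
    norm_num
  let c : ℕ → Ω → C(Set.Icc (0 : ℝ) E.T, ℝ) := fun n ω => ⟨fun t => Z n t ω, hZc n ω⟩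
  -- By Borel-Cantelli, almost every path sequence has uniform increments at most `2⁻ⁿ` from some
  -- index on, hence is Cauchy in the space of continuous functions.
  have hconv : ∀ᵐ ω ∂P, ∃ l, Tendsto (fun n => c n ω) atTop (𝓝 l) := by
    filter_upwards [ae_eventually_notMem hsum] with ω hω
    refine cauchySeq_tendsto_of_complete (cauchySeq_of_summable_dist ?_)
    refine Summable.of_norm_bounded_eventually_nat (g := fun n => (1 / 2 : ℝ) ^ n)
      (summable_geometric_of_lt_one (by norm_num) (by norm_num)) ?_
    filter_upwards [hω] with n hn
    rw [Real.norm_of_nonneg dist_nonneg, ContinuousMap.dist_le (by positivity)]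
    intro t
    rw [dist_comm, Real.dist_eq]
    by_contra hlt
    exact hn ⟨t, not_le.1 hlt⟩
  let B : Set Ω := toMeasurable P {ω | ¬ ∃ l, Tendsto (fun n => c n ω) atTop (𝓝 l)}
  have hBm : MeasurableSet B := measurableSet_toMeasurable _ _
  have hB0 : P B = 0 := by rw [measure_toMeasurable]; exact hconv
  have hB : ∀ ω, ∃ l, ω ∉ B → Tendsto (fun n => c n ω) atTop (𝓝 l) := fun ω => by
    by_cases h : ∃ l, Tendsto (fun n => c n ω) atTop (𝓝 l)
    · exact ⟨h.choose, fun _ => h.choose_spec⟩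
    · exact ⟨0, fun h' => absurd (subset_toMeasurable _ _ h) h'⟩
  choose l hl using hB
  have hpt : ∀ ω, ω ∉ B → ∀ t, Tendsto (fun n => Z n t ω) atTop (𝓝 (l ω t)) := fun ω hω t =>
    ((continuous_eval_const t).tendsto _).comp (hl ω hω)
  have hae : ∀ᵐ ω ∂P, ω ∉ B := measure_eq_zero_iff_ae_notMem.1 hB0
  refine ⟨fun t ω => if ω ∈ B then 0 else l ω t, fun t => ?_, fun ω => ?_, fun t => ?_⟩
  · refine @measurable_of_tendsto_metrizable _ _ (E.filtration t) _ _ _ _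
      (fun n ω => if ω ∈ B then 0 else Z n t ω) _ (fun n => ?_) ?_
    · exact Measurable.ite (E.measurableSet_filtration_of_null hBm hB0 t) measurable_const (hZm n t)
    · rw [tendsto_pi_nhds]
      intro ω
      by_cases h : ω ∈ B
      · simp [h]
      · simpa [h] using hpt ω h t
  · by_cases h : ω ∈ B
    · simpa only [h, if_true] using continuous_const
    · simpa [h] using (l ω).continuous
  -- The same sequence of conditional expectations converges in measure to the uniform limit and, by
  -- contraction in mean, to the conditional expectation of `ξ'`; the two limits agree.
  · have hm1 : TendstoInMeasure P (fun n => P[η n | E.filtration t]) atTop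
        (fun ω => if ω ∈ B then 0 else l ω t) := by
      refine tendstoInMeasure_of_tendsto_ae
        (fun n => integrable_condExp.aestronglyMeasurable) ?_
      filter_upwards [hae, ae_all_iff.2 fun n => hZη n t] with ω hω hω2
      simp only [← hω2, hω, if_false]
      exact hpt ω hω t
    have hm2 : TendstoInMeasure P (fun n => P[η n | E.filtration t]) atTop
        (P[ξ' | E.filtration t]) := by
      refine tendstoInMeasure_of_tendsto_eLpNorm (p := 1) one_ne_zero
        (fun n => integrable_condExp.aestronglyMeasurable)
        integrable_condExp.aestronglyMeasurable ?_
      have hb : ∀ n, eLpNorm (P[η n | E.filtration t] - P[ξ' | E.filtration t]) 1 P ≤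
          ENNReal.ofReal ((1 / 4 : ℝ) ^ n) := by
        intro n
        calc eLpNorm (P[η n | E.filtration t] - P[ξ' | E.filtration t]) 1 P
            = eLpNorm (P[η n - ξ' | E.filtration t]) 1 P :=
              eLpNorm_congr_ae (condExp_sub (hηint n) hξ'int _).symm
          _ ≤ eLpNorm (η n - ξ') 1 P := eLpNorm_condExp_le_eLpNorm _ le_rfl
          _ = ENNReal.ofReal (∫ ω, |ξ' ω - η n ω| ∂P) := by
              rw [eLpNorm_one_eq_lintegral_enorm,
                ofReal_integral_eq_lintegral_ofReal (f := fun ω => |ξ' ω - η n ω|)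
                  (hξ'int.sub (hηint n)).abs
                  (ae_of_all _ fun ω => abs_nonneg _)]
              refine lintegral_congr fun ω => ?_
              rw [← Real.enorm_eq_ofReal_abs, Pi.sub_apply, ← enorm_neg, neg_sub]
          _ ≤ _ := ENNReal.ofReal_le_ofReal (hηle n)
      refine tendsto_of_tendsto_of_tendsto_of_le_of_le tendsto_const_nhds ?_
        (fun _ => zero_le) hb
      have := ENNReal.tendsto_ofReal (tendsto_pow_atTop_nhds_zero_of_lt_one
        (by norm_num : (0 : ℝ) ≤ 1 / 4) (by norm_num))
      simpa using this
    refine (tendstoInMeasure_ae_unique hm1 hm2).trans ?_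
    exact condExp_condExp_of_le (E.filtration.mono t.2.2) (E.filtration.le _)

/-- Bounded martingales of the Brownian filtration have a bounded version with continuous paths. -/
theorem exists_continuous_bounded_martingale [IsProbabilityMeasure P] {ξ : Ω → ℝ}
    (hξ : Measurable ξ) {C : ℝ} (hC : ∀ ω, |ξ ω| ≤ C) :
    ∃ Z : ℝ → Ω → ℝ, (∀ t : Set.Icc (0 : ℝ) E.T, Measurable[E.filtration t] (Z t)) ∧
      (∀ ω, Continuous fun t => Z t ω) ∧ (∀ t ω, |Z t ω| ≤ C) ∧
      ∀ t : Set.Icc (0 : ℝ) E.T, Z t =ᵐ[P] P[ξ | E.filtration t] := by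
  have hint : Integrable ξ P := Integrable.of_bound hξ.aestronglyMeasurable C (ae_of_all _ hC)
  obtain ⟨Z, hm, hc, hZ⟩ := E.hasContinuousVersion hint
  have hne : Nonempty Ω := by
    by_contra h
    rw [not_nonempty_iff] at h
    have := measure_univ (μ := P)
    simp [Set.univ_eq_empty_iff.2 h] at this
  have hC0 : 0 ≤ C := (abs_nonneg _).trans (hC hne.some)
  -- Clipping does not alter the version almost surely, as conditional expectations inherit the
  -- bound `C`; it makes the bound hold everywhere.
  refine ⟨fun t ω => max (-C) (min C (Z (Set.projIcc 0 E.T E.T_pos.le t) ω)), fun t => ?_,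
    fun ω => ?_, fun t ω => ?_, fun t => ?_⟩
  · simp only [Set.projIcc_val]
    exact Measurable.max measurable_const (Measurable.min measurable_const (hm t))
  · exact continuous_const.max (continuous_const.min ((hc ω).comp continuous_projIcc))
  · exact abs_le.2 ⟨le_max_left _ _, max_le (by linarith) (min_le_left _ _)⟩
  · have hb : ∀ᵐ ω ∂P, |P[ξ | E.filtration t] ω| ≤ C :=
      ae_bdd_abs_condExp_of_ae_bdd_abs (ae_of_all _ hC)
    filter_upwards [hZ t, hb] with ω h1 h2
    simp only [Set.projIcc_val, h1]
    rw [min_eq_right (abs_le.1 h2).2, max_eq_right (abs_le.1 h2).1]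

end Economy

/-! ### Product rule for primitives and the homogeneous linear equation. -/

section Calculus

/-- Product rule for primitives of integrable functions. -/
theorem integral_mul_primitive_add {p q : ℝ → ℝ} {a b : ℝ} (α β : ℝ)
    (hp : IntervalIntegrable p volume a b) (hq : IntervalIntegrable q volume a b) :
    ∫ s in a..b, (p s * (β + ∫ x in a..s, q x) + (α + ∫ x in a..s, p x) * q s) =
      (α + ∫ x in a..b, p x) * (β + ∫ x in a..b, q x) - α * β := by
  have hc : ∀ (γ : ℝ) {g : ℝ → ℝ}, IntervalIntegrable g volume a b →
      AbsolutelyContinuousOnInterval (fun s => γ + ∫ x in a..s, g x) a b := by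
    intro γ g hg
    have h1 := hg.absolutelyContinuousOnInterval_intervalIntegral (c := a) (by simp)
    have h2 : AbsolutelyContinuousOnInterval (fun _ : ℝ => γ) a b :=
      (LipschitzWith.const γ).lipschitzOnWith.absolutelyContinuousOnInterval
    exact h2.add h1
  have hd : ∀ (γ : ℝ) {g : ℝ → ℝ}, IntervalIntegrable g volume a b →
      ∀ᵐ x, x ∈ Set.uIcc a b → deriv (fun s => γ + ∫ x in a..s, g x) x = g x := by
    intro γ g hg
    filter_upwards [hg.ae_hasDerivAt_integral] with x hx hxm
    exact ((hx hxm a (by simp)).const_add γ).deriv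
  have := (hc α hp).integral_deriv_mul_eq_sub (hc β hq)
  simp only [intervalIntegral.integral_same, add_zero] at this
  rw [← this]
  refine intervalIntegral.integral_congr_ae ?_
  filter_upwards [hd α hp, hd β hq] with x h1 h2 hx
  rw [h1 (Set.uIoc_subset_uIcc hx), h2 (Set.uIoc_subset_uIcc hx)]

/-- A positive solution of `f'' = r f' + b f` with `f'(T) = 0`. -/
theorem exists_positive_homogeneous_solution (r T : ℝ) {b : ℝ} (hb : 0 < b) :
    ∃ f f1 : ℝ → ℝ, (∀ t, HasDerivAt f (f1 t) t) ∧ (∀ t, HasDerivAt f1 (r * f1 t + b * f t) t) ∧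
      f1 T = 0 ∧ ∀ t, 0 < f t := by
  let D := √(r ^ 2 + 4 * b)
  have hD : D ^ 2 = r ^ 2 + 4 * b := Real.sq_sqrt (by positivity)
  have hDr : |r| < D := by
    refine Real.lt_sqrt_of_sq_lt ?_
    rw [sq_abs]
    linarith
  obtain ⟨x, hx⟩ : ∃ x, x = (r + D) / 2 := ⟨_, rfl⟩
  obtain ⟨y, hy⟩ : ∃ y, y = (r - D) / 2 := ⟨_, rfl⟩
  have hx0 : 0 < x := by rw [hx]; linarith [neg_abs_le r]
  have hy0 : y < 0 := by rw [hy]; linarith [le_abs_self r]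
  have hxx : x ^ 2 = r * x + b := by rw [hx]; linear_combination hD / 4
  have hyy : y ^ 2 = r * y + b := by rw [hy]; linear_combination hD / 4
  have hexp : ∀ c t : ℝ, HasDerivAt (fun t => Real.exp (c * (t - T))) (c * Real.exp (c * (t - T))) t := by
    intro c t
    have h : HasDerivAt (fun t => c * (t - T)) (c * 1) t :=
      ((hasDerivAt_id t).sub_const T).const_mul c
    simpa [mul_comm] using h.exp
  -- Here `y < 0 < x` are the roots of `z² = r z + b`. The weights `x` and `-y` are both positive,
  -- and they are the ones for which the derivative vanishes at `T`.
  refine ⟨fun t => x * Real.exp (y * (t - T)) - y * Real.exp (x * (t - T)),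
    fun t => x * y * (Real.exp (y * (t - T)) - Real.exp (x * (t - T))), fun t => ?_, fun t => ?_,
    by simp, fun t => ?_⟩
  · refine (((hexp y t).const_mul x).sub ((hexp x t).const_mul y)).congr_deriv ?_
    ring
  · refine (((hexp y t).sub (hexp x t)).const_mul (x * y)).congr_deriv ?_
    linear_combination x * Real.exp (y * (t - T)) * hyy - y * Real.exp (x * (t - T)) * hxx
  · have h1 : 0 < x * Real.exp (y * (t - T)) := by positivity
    have h2 : 0 < -y * Real.exp (x * (t - T)) := mul_pos (by linarith) (Real.exp_pos _)
    linarith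

end Calculus

/-! ### Deterministic integrands against bounded continuous martingales. -/

section Martingales

variable {Ω : Type*} [mΩ : MeasurableSpace Ω] {P : Measure Ω} [IsProbabilityMeasure P] {T : ℝ}
  {ℱ : Filtration (Set.Icc (0 : ℝ) T) mΩ}

/-- The stochastic integral of a smooth deterministic function against a bounded continuous
martingale, defined by partial integration, is a martingale. -/
theorem martingale_partial_integration (hT : 0 ≤ T) {Z : ℝ → Ω → ℝ} {k k1 : ℝ → ℝ} {C : ℝ}
    (hZ : Martingale (fun (t : Set.Icc (0 : ℝ) T) ω => Z t ω) ℱ P)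
    (hc : ∀ ω, Continuous fun t => Z t ω) (hC : ∀ t ω, |Z t ω| ≤ C)
    (hk : ∀ t, HasDerivAt k (k1 t) t) (hk1 : Continuous k1) :
    Martingale (fun (t : Set.Icc (0 : ℝ) T) ω => k t * Z t ω - ∫ s in (0 : ℝ)..t, k1 s * Z s ω)
      ℱ P := by
  have hZm : ∀ t : Set.Icc (0 : ℝ) T, Measurable[ℱ t] (Z t) := fun t => (hZ.1 t).measurable
  have hZo : IsOpt ℱ Z := isOpt_of_continuousOn hZm fun ω => (hc ω).continuousOn
  have hYo : IsOpt ℱ (fun t ω => k1 t * Z t ω) := (isOpt_of_continuous_deterministic hk1).mul hZo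
  obtain ⟨D, hD⟩ := (isCompact_Icc (a := (0 : ℝ)) (b := T)).exists_bound_of_continuousOn
    hk1.continuousOn
  have hIm : ∀ t : Set.Icc (0 : ℝ) T, Measurable[ℱ t] fun ω => ∫ s in (0 : ℝ)..t, k1 s * Z s ω :=
    hYo.measurable_integral hT
  have hZint : ∀ t : Set.Icc (0 : ℝ) T, Integrable (Z t) P := fun t => hZ.integrable t
  have hYint : ∀ {s t : ℝ} (ω), IntervalIntegrable (fun s => k1 s * Z s ω) volume s t :=
    fun ω => (hk1.mul (hc ω)).intervalIntegrable _ _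
  have hIint : ∀ t : Set.Icc (0 : ℝ) T, Integrable (fun ω => ∫ s in (0 : ℝ)..t, k1 s * Z s ω) P := by
    intro t
    refine Integrable.of_bound ((hIm t).mono (ℱ.le t) le_rfl).aestronglyMeasurable
      (D * C * |(t : ℝ) - 0|) (ae_of_all _ fun ω => ?_)
    refine intervalIntegral.norm_integral_le_of_norm_le_const fun s hs => ?_
    rw [Set.uIoc_of_le t.2.1] at hs
    rw [norm_mul]
    have h1 := hD s ⟨hs.1.le, hs.2.trans t.2.2⟩
    exact mul_le_mul h1 (hC s ω) (norm_nonneg _) ((norm_nonneg _).trans h1)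
  refine ⟨fun t => (((hZm t).const_mul _).sub (hIm t)).stronglyMeasurable, fun s t hst => ?_⟩
  have hst' : (s : ℝ) ≤ t := hst
  symm
  refine ae_eq_condExp_of_forall_setIntegral_eq (ℱ.le s) (((hZint t).const_mul _).sub (hIint t))
    (fun A _ _ => (((hZint s).const_mul _).sub (hIint s)).integrableOn) (fun A hA _ => ?_)
    (((hZm s).const_mul _).sub (hIm s)).aestronglyMeasurable
  have hz : ∀ w ∈ Set.Icc (s : ℝ) t, ∫ ω in A, Z w ω ∂P = ∫ ω in A, Z s ω ∂P := by
    intro w hw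
    have hw' : w ∈ Set.Icc (0 : ℝ) T := ⟨s.2.1.trans hw.1, hw.2.trans t.2.2⟩
    exact (hZ.setIntegral_eq (i := s) (j := ⟨w, hw'⟩) hw.1 hA).symm
  have hsplit : ∀ ω, ∫ w in (0 : ℝ)..t, k1 w * Z w ω =
      (∫ w in (0 : ℝ)..s, k1 w * Z w ω) + ∫ w in (s : ℝ)..t, k1 w * Z w ω := fun ω =>
    (intervalIntegral.integral_add_adjacent_intervals (hYint ω) (hYint ω)).symm
  have hdiff : Integrable (fun ω => ∫ w in (s : ℝ)..t, k1 w * Z w ω) P := by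
    refine ((hIint t).sub (hIint s)).congr (ae_of_all _ fun ω => ?_)
    simp [hsplit ω]
  have hjm : Measurable (fun p : ℝ × Ω => k1 p.1 * Z (Set.projIcc 0 T hT p.1) p.2) := by
    have : Measurable (fun p : ℝ × Ω => (Set.projIcc 0 T hT p.1, p.2)) :=
      (continuous_projIcc.measurable.comp measurable_fst).prodMk measurable_snd
    exact (hk1.measurable.comp measurable_fst).mul ((hZo.measurable_icc hT).comp this)
  -- The integral of `Z w` over `A` does not depend on `w ≥ s`, so Fubini leaves only the integral
  -- of `k1`. This is what balances the change of the factor `k` between `s` and `t`.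
  have hfub : ∫ ω in A, (∫ w in (s : ℝ)..t, k1 w * Z w ω) ∂P = (k t - k s) * ∫ ω in A, Z s ω ∂P := by
    have h1 : ∀ ω, ∫ w in (s : ℝ)..t, k1 w * Z w ω =
        ∫ w in (s : ℝ)..t, k1 w * Z (Set.projIcc 0 T hT w) ω := by
      intro ω
      refine intervalIntegral.integral_congr fun w hw => ?_
      rw [Set.uIcc_of_le hst'] at hw
      rw [Set.projIcc_of_mem hT ⟨s.2.1.trans hw.1, hw.2.trans t.2.2⟩]
    simp only [h1]
    rw [← intervalIntegral_integral_swap]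
    · rw [← intervalIntegral.integral_eq_sub_of_hasDerivAt (fun w _ => hk w)
        (hk1.intervalIntegrable _ _), ← intervalIntegral.integral_mul_const]
      refine intervalIntegral.integral_congr fun w hw => ?_
      rw [Set.uIcc_of_le hst'] at hw
      rw [integral_const_mul, Set.projIcc_of_mem hT ⟨s.2.1.trans hw.1, hw.2.trans t.2.2⟩, hz w hw]
    · rw [Set.uIoc_of_le hst']
      refine Integrable.of_bound hjm.aestronglyMeasurable (D * C) ?_
      have : ∀ᵐ p ∂((volume.restrict (Set.Ioc (s : ℝ) t)).prod (P.restrict A)),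
          p.1 ∈ Set.Ioc (s : ℝ) t := by
        refine Measure.quasiMeasurePreserving_fst.ae ?_
        exact ae_restrict_mem measurableSet_Ioc
      filter_upwards [this] with p hp
      rw [Function.uncurry_def, norm_mul]
      have h1 := hD p.1 ⟨s.2.1.trans hp.1.le, hp.2.trans t.2.2⟩
      exact mul_le_mul h1 (hC _ _) (norm_nonneg _) ((norm_nonneg _).trans h1)
  simp only [hsplit]
  have e1 : ∫ ω in A, (k t * Z t ω - ((∫ w in (0 : ℝ)..s, k1 w * Z w ω) +
      ∫ w in (s : ℝ)..t, k1 w * Z w ω)) ∂P = k t * (∫ ω in A, Z t ω ∂P) -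
      ((∫ ω in A, (∫ w in (0 : ℝ)..s, k1 w * Z w ω) ∂P) +
        ∫ ω in A, (∫ w in (s : ℝ)..t, k1 w * Z w ω) ∂P) := by
    have hsum : Integrable (fun ω => (∫ w in (0 : ℝ)..s, k1 w * Z w ω) +
        ∫ w in (s : ℝ)..t, k1 w * Z w ω) (P.restrict A) :=
      (hIint s).integrableOn.add hdiff.integrableOn
    rw [integral_sub ((hZint t).const_mul _).integrableOn hsum,
      integral_add (hIint s).integrableOn hdiff.integrableOn, integral_const_mul]
  rw [e1, integral_sub ((hZint s).const_mul _).integrableOn (hIint s).integrableOn,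
    integral_const_mul, hfub, hz t (Set.right_mem_Icc.2 hst')]
  ring

end Martingales

/-! ### The scalar forward-backward equation. -/

namespace Economy

variable {d N : ℕ} {Ω : Type*} [mΩ : MeasurableSpace Ω] {P : Measure Ω} (E : Economy d N P)

/-- Solution of the scalar linear forward-backward system `φ' = u`,
`du = (r u + b φ - h) dt + dM`, `φ(0) = 0`, `u(T) = 0`. -/
theorem exists_scalar_solution [IsProbabilityMeasure P] {b : ℝ} (hb : 0 < b) {h : ℝ → Ω → ℝ}
    (hh : IsOpt E.filtration h) {C : ℝ} (hC : ∀ t ω, |h t ω| ≤ C) :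
    ∃ (u M : ℝ → Ω → ℝ) (K : ℝ),
      (∀ t : Set.Icc (0 : ℝ) E.T, Measurable[E.filtration t] (u t)) ∧
      (∀ t : Set.Icc (0 : ℝ) E.T, Measurable[E.filtration t] (M t)) ∧
      (∀ ω, ContinuousOn (fun t => u t ω) (Set.Icc 0 E.T)) ∧
      (∀ ω, ContinuousOn (fun t => M t ω) (Set.Icc 0 E.T)) ∧
      (∀ ω, ∀ t ∈ Set.Icc 0 E.T, |u t ω| ≤ K) ∧ (∀ ω, ∀ t ∈ Set.Icc 0 E.T, |M t ω| ≤ K) ∧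
      Martingale (fun (t : Set.Icc (0 : ℝ) E.T) ω => M t ω) E.filtration P ∧
      (∀ ω, ∀ t ∈ Set.Icc 0 E.T, u t ω = u 0 ω +
        (∫ s in (0 : ℝ)..t, (E.r * u s ω + b * (∫ x in (0 : ℝ)..s, u x ω) - h s ω)) +
        (M t ω - M 0 ω)) ∧
      ∀ᵐ ω ∂P, u E.T ω = 0 := by
  have hT := E.T_pos.le
  -- Reduction of order: `φ = f I` with `I' = (k / f) G`, hence `u = f1 I + k G`. With `k = exp (r
  -- t) / f` the equation for `u` reduces to `k dG = -h dt + dM`, that is `dG = -p h dt + dZ` with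
  -- `p = 1 / k` and `dM = k dZ`. The terminal condition follows from `f1 T = 0` and `G T = 0`.
  obtain ⟨f, f1, hf, hf1, hfT, hfpos⟩ := exists_positive_homogeneous_solution E.r E.T hb
  have hfc : Continuous f := continuous_iff_continuousAt.2 fun t => (hf t).continuousAt
  have hf1c : Continuous f1 := continuous_iff_continuousAt.2 fun t => (hf1 t).continuousAt
  have hf0 : ∀ t, f t ≠ 0 := fun t => (hfpos t).ne'
  obtain ⟨p, hp⟩ : ∃ p : ℝ → ℝ, p = fun t => Real.exp (-E.r * t) * f t := ⟨_, rfl⟩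
  obtain ⟨k, hk⟩ : ∃ k : ℝ → ℝ, k = fun t => Real.exp (E.r * t) / f t := ⟨_, rfl⟩
  have hpc : Continuous p := by rw [hp]; fun_prop
  have hkc : Continuous k := by
    rw [hk]
    exact (by fun_prop : Continuous fun t => Real.exp (E.r * t)).div hfc hf0
  have hkp : ∀ t, k t * p t = 1 := by
    intro t
    rw [hk, hp]
    have : Real.exp (E.r * t) * Real.exp (-E.r * t) = 1 := by
      rw [← Real.exp_add]; simp
    have h0 := hf0 t
    calc Real.exp (E.r * t) / f t * (Real.exp (-E.r * t) * f t)
        = Real.exp (E.r * t) * Real.exp (-E.r * t) := by field_simp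
      _ = 1 := this
  obtain ⟨k1, hk1⟩ : ∃ k1 : ℝ → ℝ, k1 = fun t => E.r * k t - k t / f t * f1 t := ⟨_, rfl⟩
  have hkf : Continuous fun t => k t / f t := hkc.div hfc hf0
  have hk1c : Continuous k1 := by
    rw [hk1]
    exact (hkc.const_mul _).sub (hkf.mul hf1c)
  have hkd : ∀ t, HasDerivAt k (k1 t) t := by
    intro t
    have he : HasDerivAt (fun t => Real.exp (E.r * t)) (Real.exp (E.r * t) * (E.r * 1)) t :=
      ((hasDerivAt_id t).const_mul E.r).exp
    rw [hk1, hk]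
    refine (he.div (hf t) (hf0 t)).congr_deriv ?_
    have := hf0 t
    field_simp
  have hpho : IsOpt E.filtration (fun t ω => p t * h t ω) :=
    (isOpt_of_continuous_deterministic hpc).mul hh
  obtain ⟨D, hD⟩ := (isCompact_Icc (a := (0 : ℝ)) (b := E.T)).exists_bound_of_continuousOn
    hpc.continuousOn
  have hphb : ∀ ω, ∀ t ∈ Set.Icc 0 E.T, |p t * h t ω| ≤ D * C := by
    intro ω t ht
    rw [abs_mul]
    have h1 := hD t ht
    exact mul_le_mul h1 (hC t ω) (abs_nonneg _) ((norm_nonneg _).trans h1)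
  have hphi : ∀ {t} (ω), t ∈ Set.Icc 0 E.T →
      IntervalIntegrable (fun s => p s * h s ω) volume 0 t := fun ω ht =>
    hpho.intervalIntegrable_of_bound hT
      ((ae_restrict_mem measurableSet_Icc).mono fun t ht => hphb ω t ht) ⟨le_rfl, hT⟩ ht
  have hhi : ∀ {t} (ω), t ∈ Set.Icc 0 E.T →
      IntervalIntegrable (fun s => h s ω) volume 0 t := fun ω ht =>
    hh.intervalIntegrable_of_bound hT (ae_of_all _ fun t => hC t ω) ⟨le_rfl, hT⟩ ht
  obtain ⟨L, hL⟩ : ∃ L : ℝ → Ω → ℝ, L = fun t ω => ∫ s in (0 : ℝ)..t, p s * h s ω := ⟨_, rfl⟩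
  have hLm : ∀ t : Set.Icc (0 : ℝ) E.T, Measurable[E.filtration t] (L t) := by
    rw [hL]
    exact hpho.measurable_integral hT
  have hLc : ∀ ω, ContinuousOn (fun t => L t ω) (Set.Icc 0 E.T) := fun ω => by
    rw [hL]
    exact hpho.continuousOn_integral hT
      ((ae_restrict_mem measurableSet_Icc).mono fun t ht => hphb ω t ht)
  have hLb : ∀ ω, ∀ t ∈ Set.Icc 0 E.T, |L t ω| ≤ D * C * E.T := by
    intro ω t ht
    rw [hL]
    have h1 : ‖∫ s in (0 : ℝ)..t, p s * h s ω‖ ≤ D * C * |t - 0| := by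
      refine intervalIntegral.norm_integral_le_of_norm_le_const fun s hs => ?_
      rw [Set.uIoc_of_le ht.1] at hs
      exact hphb ω s ⟨hs.1.le, hs.2.trans ht.2⟩
    refine h1.trans ?_
    rw [sub_zero, abs_of_nonneg ht.1]
    exact mul_le_mul_of_nonneg_left ht.2 ((abs_nonneg _).trans (hphb ω t ht))
  -- `Z` is the continuous martingale closed by `L T`, so `G = Z - L` is the conditional expectation
  -- of the integral of `p h` over `[t, T]`.
  obtain ⟨Z, hZm, hZc, hZb, hZ⟩ := E.exists_continuous_bounded_martingale
    ((hLm E.top).mono (E.filtration.le _) le_rfl) (fun ω => hLb ω E.T (Set.right_mem_Icc.2 hT))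
  have hZmart : Martingale (fun (t : Set.Icc (0 : ℝ) E.T) ω => Z t ω) E.filtration P := by
    refine ⟨fun t => (hZm t).stronglyMeasurable, fun s t hst => ?_⟩
    refine (condExp_congr_ae (hZ t)).trans ?_
    exact (condExp_condExp_of_le (E.filtration.mono hst) (E.filtration.le _)).trans (hZ s).symm
  obtain ⟨G, hG⟩ : ∃ G : ℝ → Ω → ℝ, G = fun t ω => Z t ω - L t ω := ⟨_, rfl⟩
  have hGm : ∀ t : Set.Icc (0 : ℝ) E.T, Measurable[E.filtration t] (G t) := fun t => by
    rw [hG]; exact (hZm t).sub (hLm t)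
  have hGc : ∀ ω, ContinuousOn (fun t => G t ω) (Set.Icc 0 E.T) := fun ω => by
    rw [hG]; exact (hZc ω).continuousOn.sub (hLc ω)
  have hGT : ∀ᵐ ω ∂P, G E.T ω = 0 := by
    have h1 : P[L E.T | E.filtration E.top] = L E.T :=
      condExp_of_stronglyMeasurable (E.filtration.le _) (hLm E.top).stronglyMeasurable
        (Integrable.of_bound ((hLm E.top).mono (E.filtration.le _) le_rfl).aestronglyMeasurable
          (D * C * E.T) (ae_of_all _ fun ω => hLb ω E.T (Set.right_mem_Icc.2 hT)))
    have h2 : Z E.T =ᵐ[P] P[L E.T | E.filtration E.top] := hZ E.top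
    rw [h1] at h2
    filter_upwards [h2] with ω hω
    rw [hG]
    exact sub_eq_zero.2 hω
  have hkGo : IsOpt E.filtration (fun t ω => k t / f t * G t ω) :=
    (isOpt_of_continuous_deterministic hkf).mul (isOpt_of_continuousOn hGm hGc)
  have hkGc : ∀ ω, ContinuousOn (fun t => k t / f t * G t ω) (Set.Icc 0 E.T) := fun ω =>
    hkf.continuousOn.mul (hGc ω)
  have hint : ∀ {g : ℝ → ℝ} {t}, t ∈ Set.Icc 0 E.T → ContinuousOn g (Set.Icc 0 E.T) →
      IntervalIntegrable g volume 0 t := by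
    intro g t ht hg
    refine (hg.mono ?_).intervalIntegrable
    rw [Set.uIcc_of_le ht.1]
    exact Set.Icc_subset_Icc le_rfl ht.2
  have hprim : ∀ {g : ℝ → ℝ}, ContinuousOn g (Set.Icc 0 E.T) →
      ContinuousOn (fun t => ∫ s in (0 : ℝ)..t, g s) (Set.Icc 0 E.T) := by
    intro g hg
    have h1 := intervalIntegral.continuousOn_primitive_interval (μ := volume) (f := g) (a := 0)
      (b := E.T) (by rw [Set.uIcc_of_le hT]; exact hg.integrableOn_Icc)
    rwa [Set.uIcc_of_le hT] at h1
  obtain ⟨I, hI⟩ : ∃ I : ℝ → Ω → ℝ, I = fun t ω => ∫ s in (0 : ℝ)..t, k s / f s * G s ω := ⟨_, rfl⟩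
  have hIm : ∀ t : Set.Icc (0 : ℝ) E.T, Measurable[E.filtration t] (I t) := by
    rw [hI]; exact hkGo.measurable_integral hT
  have hIc : ∀ ω, ContinuousOn (fun t => I t ω) (Set.Icc 0 E.T) := fun ω => by
    rw [hI]; exact hprim (hkGc ω)
  obtain ⟨u, hu⟩ : ∃ u : ℝ → Ω → ℝ, u = fun t ω => f1 t * I t ω + k t * G t ω := ⟨_, rfl⟩
  have huc : ∀ ω, ContinuousOn (fun t => u t ω) (Set.Icc 0 E.T) := fun ω => by
    rw [hu]
    exact (hf1c.continuousOn.mul (hIc ω)).add (hkc.continuousOn.mul (hGc ω))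
  -- The integral of `k` against `Z`, written by partial integration to avoid stochastic integrals.
  obtain ⟨M, hM⟩ : ∃ M : ℝ → Ω → ℝ,
      M = fun t ω => k t * Z t ω - ∫ s in (0 : ℝ)..t, k1 s * Z s ω := ⟨_, rfl⟩
  have hMmart : Martingale (fun (t : Set.Icc (0 : ℝ) E.T) ω => M t ω) E.filtration P := by
    rw [hM]
    exact martingale_partial_integration hT hZmart hZc hZb hkd hk1c
  have hMc : ∀ ω, ContinuousOn (fun t => M t ω) (Set.Icc 0 E.T) := fun ω => by
    rw [hM]
    exact (hkc.continuousOn.mul (hZc ω).continuousOn).sub (hprim (hk1c.mul (hZc ω)).continuousOn)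
  have hbound : ∀ {g : ℝ → ℝ}, Continuous g → ∃ D, 0 ≤ D ∧ ∀ t ∈ Set.Icc 0 E.T, |g t| ≤ D := by
    intro g hg
    obtain ⟨D, hD⟩ := (isCompact_Icc (a := (0 : ℝ)) (b := E.T)).exists_bound_of_continuousOn
      hg.continuousOn
    exact ⟨D, (norm_nonneg _).trans (hD 0 ⟨le_rfl, hT⟩), hD⟩
  have hprimb : ∀ {g : ℝ → ℝ} {D : ℝ}, (∀ t ∈ Set.Icc 0 E.T, |g t| ≤ D) →
      ∀ t ∈ Set.Icc 0 E.T, |∫ s in (0 : ℝ)..t, g s| ≤ D * E.T := by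
    intro g D hg t ht
    have h1 : ‖∫ s in (0 : ℝ)..t, g s‖ ≤ D * |t - 0| := by
      refine intervalIntegral.norm_integral_le_of_norm_le_const fun s hs => ?_
      rw [Set.uIoc_of_le ht.1] at hs
      exact hg s ⟨hs.1.le, hs.2.trans ht.2⟩
    refine h1.trans ?_
    rw [sub_zero, abs_of_nonneg ht.1]
    exact mul_le_mul_of_nonneg_left ht.2 ((abs_nonneg _).trans (hg t ht))
  have hmulb : ∀ {g g' : ℝ → ℝ} {D D' : ℝ}, (∀ t ∈ Set.Icc 0 E.T, |g t| ≤ D) →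
      (∀ t ∈ Set.Icc 0 E.T, |g' t| ≤ D') → ∀ t ∈ Set.Icc 0 E.T, |g t * g' t| ≤ D * D' := by
    intro g g' D D' hg hg' t ht
    rw [abs_mul]
    exact mul_le_mul (hg t ht) (hg' t ht) (abs_nonneg _) ((abs_nonneg _).trans (hg t ht))
  obtain ⟨Bk, hBk0, hBk⟩ := hbound hkc
  obtain ⟨Bk1, hBk10, hBk1⟩ := hbound hk1c
  obtain ⟨Bkf, hBkf0, hBkf⟩ := hbound hkf
  obtain ⟨Bf1, hBf10, hBf1⟩ := hbound hf1c
  have hGb : ∀ ω, ∀ t ∈ Set.Icc 0 E.T, |G t ω| ≤ 2 * (D * C * E.T) := by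
    intro ω t ht
    rw [hG]
    refine (abs_sub _ _).trans ?_
    linarith [hZb t ω, hLb ω t ht]
  have hub : ∀ ω, ∀ t ∈ Set.Icc 0 E.T, |u t ω| ≤
      Bf1 * (Bkf * (2 * (D * C * E.T)) * E.T) + Bk * (2 * (D * C * E.T)) := by
    intro ω t ht
    rw [hu]
    refine (abs_add_le _ _).trans (add_le_add ?_ ?_)
    · rw [hI]
      exact hmulb hBf1 (hprimb (hmulb hBkf (hGb ω))) t ht
    · exact hmulb hBk (hGb ω) t ht
  have hMb : ∀ ω, ∀ t ∈ Set.Icc 0 E.T, |M t ω| ≤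
      Bk * (D * C * E.T) + Bk1 * (D * C * E.T) * E.T := by
    intro ω t ht
    rw [hM]
    refine (abs_sub _ _).trans (add_le_add ?_ ?_)
    · exact hmulb hBk (fun t _ => hZb t ω) t ht
    · exact hprimb (hmulb hBk1 (fun t _ => hZb t ω)) t ht
  have hftc : ∀ t, f t = f 0 + ∫ s in (0 : ℝ)..t, f1 s := fun t => by
    rw [intervalIntegral.integral_eq_sub_of_hasDerivAt (fun s _ => hf s)
      (hf1c.intervalIntegrable _ _)]
    ring
  have hf2c : Continuous fun t => E.r * f1 t + b * f t := by fun_prop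
  have hftc1 : ∀ t, f1 t = f1 0 + ∫ s in (0 : ℝ)..t, (E.r * f1 s + b * f s) := fun t => by
    rw [intervalIntegral.integral_eq_sub_of_hasDerivAt (fun s _ => hf1 s)
      (hf2c.intervalIntegrable _ _)]
    ring
  have hftck : ∀ t, k t = k 0 + ∫ s in (0 : ℝ)..t, k1 s := fun t => by
    rw [intervalIntegral.integral_eq_sub_of_hasDerivAt (fun s _ => hkd s)
      (hk1c.intervalIntegrable _ _)]
    ring
  have hφ : ∀ ω, ∀ t ∈ Set.Icc 0 E.T, ∫ s in (0 : ℝ)..t, u s ω = f t * I t ω := by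
    intro ω t ht
    have h1 := integral_mul_primitive_add (f 0) 0 (hint ht hf1c.continuousOn) (hint ht (hkGc ω))
    simp only [← hftc, zero_add, mul_zero, sub_zero] at h1
    rw [hI, ← h1]
    refine intervalIntegral.integral_congr fun s _ => ?_
    simp only [hu, hI]
    have := hf0 s
    field_simp
  have hI0 : ∀ ω, I 0 ω = 0 := fun ω => by simp [hI]
  have hL0 : ∀ ω, L 0 ω = 0 := fun ω => by simp [hL]
  refine ⟨u, M, max (Bf1 * (Bkf * (2 * (D * C * E.T)) * E.T) + Bk * (2 * (D * C * E.T)))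
    (Bk * (D * C * E.T) + Bk1 * (D * C * E.T) * E.T), fun t => ?_,
    fun t => (hMmart.1 t).measurable, huc, hMc,
    fun ω t ht => (hub ω t ht).trans (le_max_left _ _),
    fun ω t ht => (hMb ω t ht).trans (le_max_right _ _), hMmart, fun ω t ht => ?_, ?_⟩
  · rw [hu]
    exact ((hIm t).const_mul _).add ((hGm t).const_mul _)
  · have e1 := integral_mul_primitive_add (f1 0) 0 (hint ht hf2c.continuousOn) (hint ht (hkGc ω))
    have e2 := integral_mul_primitive_add (k 0) 0 (hint ht hk1c.continuousOn) (hphi ω ht)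
    simp only [← hftc1, ← hftck, zero_add, mul_zero, sub_zero] at e1 e2
    have eI : ∀ s, ∫ x in (0 : ℝ)..s, k x / f x * G x ω = I s ω := fun s => by rw [hI]
    have eL : ∀ s, ∫ x in (0 : ℝ)..s, p x * h x ω = L s ω := fun s => by rw [hL]
    simp only [eI, eL] at e1 e2
    have hi1 : IntervalIntegrable (fun s => (E.r * f1 s + b * f s) * I s ω +
        f1 s * (k s / f s * G s ω)) volume 0 t :=
      hint ht ((hf2c.continuousOn.mul (hIc ω)).add (hf1c.continuousOn.mul (hkGc ω)))
    have hi2 : IntervalIntegrable (fun s => k1 s * L s ω + k s * (p s * h s ω)) volume 0 t := by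
      refine (hint ht (hk1c.continuousOn.mul (hLc ω))).add ((hhi ω ht).congr ?_)
      exact fun s _ => by simp only [← mul_assoc, hkp, one_mul]
    have hi3 : IntervalIntegrable (fun s => k1 s * Z s ω) volume 0 t :=
      hint ht (hk1c.mul (hZc ω)).continuousOn
    have e3 : ∫ s in (0 : ℝ)..t, (E.r * u s ω + b * (∫ x in (0 : ℝ)..s, u x ω) - h s ω) =
        f1 t * I t ω - k t * L t ω + ∫ s in (0 : ℝ)..t, k1 s * Z s ω := by
      rw [← e1, ← e2, ← intervalIntegral.integral_sub hi1 hi2,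
        ← intervalIntegral.integral_add (hi1.sub hi2) hi3]
      refine intervalIntegral.integral_congr fun s hs => ?_
      rw [Set.uIcc_of_le ht.1] at hs
      have hkps := hkp s
      simp only [hφ ω s ⟨hs.1, hs.2.trans ht.2⟩]
      have e4 : Z s ω = G s ω + L s ω := by rw [hG]; ring
      rw [hu, e4, hk1]
      have := hf0 s
      linear_combination (h s ω) * hkps
    rw [e3]
    have e4 : Z t ω = G t ω + L t ω := by rw [hG]; ring
    have e5 : Z 0 ω = G 0 ω := by simp [hG, hL0]
    simp only [hu, hM, hI0, e4, e5, intervalIntegral.integral_same]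
    ring
  · filter_upwards [hGT] with ω hω
    simp [hu, hfT, hω]

end Economy

/-! ### Properties of single paths and a Cauchy-Schwarz bound. -/

section Paths

theorem le_of_ae_le_of_continuousOn {T C : ℝ} (hT : 0 < T) {g : ℝ → ℝ}
    (hg : ContinuousOn g (Set.Icc 0 T)) (h : ∀ᵐ t ∂(volume.restrict (Set.Icc 0 T)), g t ≤ C) :
    ∀ t ∈ Set.Icc 0 T, g t ≤ C := by
  have h1 : (fun t => max (g t) C) =ᵐ[volume.restrict (Set.Icc 0 T)] fun _ => C :=
    h.mono fun t ht => max_eq_right ht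
  have h2 := Measure.eqOn_Icc_of_ae_eq volume hT.ne h1 (hg.sup continuousOn_const) continuousOn_const
  exact fun t ht => max_eq_right_iff.1 (h2 ht)

/-- A function with vanishing primitive vanishes almost everywhere. -/
theorem ae_eq_zero_of_primitive_eq_zero {T : ℝ} (hT : 0 ≤ T) {g : ℝ → ℝ}
    (hg : IntervalIntegrable g volume 0 T) (h : ∀ t ∈ Set.Icc 0 T, ∫ s in (0 : ℝ)..t, g s = 0) :
    ∀ᵐ t ∂(volume.restrict (Set.Icc 0 T)), g t = 0 := by
  rw [restrict_Ioo_eq_restrict_Icc.symm]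
  refine (ae_restrict_iff' measurableSet_Ioo).2 ?_
  filter_upwards [hg.ae_hasDerivAt_integral] with t ht htm
  have htm' : t ∈ Set.uIcc 0 T := by rw [Set.uIcc_of_le hT]; exact Set.Ioo_subset_Icc_self htm
  have h1 := ht htm' 0 (by simp)
  have h2 : (fun x => ∫ s in (0 : ℝ)..x, g s) =ᶠ[𝓝 t] fun _ => 0 := by
    filter_upwards [isOpen_Ioo.mem_nhds htm] with x hx
    exact h x (Set.Ioo_subset_Icc_self hx)
  exact (h1.congr_of_eventuallyEq h2.symm).unique (hasDerivAt_const t 0)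

theorem lintegral_sq_le {α : Type*} [MeasurableSpace α] (μ : Measure α) {f : α → ℝ≥0∞}
    (hf : AEMeasurable f μ) : (∫⁻ x, f x ∂μ) ^ 2 ≤ μ Set.univ * ∫⁻ x, f x ^ 2 ∂μ := by
  have h := ENNReal.lintegral_mul_le_Lp_mul_Lq μ Real.HolderConjugate.two_two hf
    (aemeasurable_const (b := (1 : ℝ≥0∞)))
  simp only [Pi.mul_apply, mul_one, ENNReal.one_rpow, lintegral_const, one_mul] at h
  have h2 : ∀ x : ℝ≥0∞, (x ^ (1 / 2 : ℝ)) ^ 2 = x := fun x => by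
    rw [← ENNReal.rpow_natCast, ← ENNReal.rpow_mul]; norm_num
  calc (∫⁻ x, f x ∂μ) ^ 2 ≤ ((∫⁻ x, f x ^ (2 : ℝ) ∂μ) ^ (1 / 2 : ℝ) *
        (μ Set.univ) ^ (1 / 2 : ℝ)) ^ 2 := by gcongr
    _ = μ Set.univ * ∫⁻ x, f x ^ 2 ∂μ := by
        rw [mul_pow, h2, h2, mul_comm]
        simp

end Paths

/-! ### Square-integrable processes on the product space and an orthogonality criterion. -/

namespace Economy

variable {d N : ℕ} {Ω : Type*} [mΩ : MeasurableSpace Ω] {P : Measure Ω} (E : Economy d N P)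

/-- The measure `P ⊗ dt` on `Ω × [0, T]`. -/
def Q : Measure (Ω × ℝ) := P.prod (volume.restrict (Set.Icc 0 E.T))

instance [IsProbabilityMeasure P] : IsFiniteMeasure E.Q := by unfold Q; infer_instance

/-- Joint measurability on `[0, T] × Ω`. -/
def JointlyMeasurable {β : Type*} [MeasurableSpace β] (X : ℝ → Ω → β) : Prop :=
  Measurable fun p : Set.Icc (0 : ℝ) E.T × Ω => X p.1 p.2

theorem jointlyMeasurable_of_isOpt {X : ℝ → Ω → ℝ} (hX : IsOpt E.filtration X) :
    E.JointlyMeasurable X := hX.measurable_icc E.T_pos.le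

/-- The extension of a process that is constant outside `[0, T]`. -/
def extend {β : Type*} (X : ℝ → Ω → β) (p : Ω × ℝ) : β := X (Set.projIcc 0 E.T E.T_pos.le p.2) p.1

theorem extend_eq {β : Type*} (X : ℝ → Ω → β) {t : ℝ} (ht : t ∈ Set.Icc 0 E.T) (ω : Ω) :
    E.extend X (ω, t) = X t ω := by
  simp [extend, Set.projIcc_of_mem E.T_pos.le ht]

variable {E}

theorem ae_mem_Icc [IsProbabilityMeasure P] : ∀ᵐ p ∂E.Q, p.2 ∈ Set.Icc 0 E.T :=
  Measure.quasiMeasurePreserving_snd.ae (ae_restrict_mem measurableSet_Icc)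

namespace JointlyMeasurable

variable {β : Type*} [MeasurableSpace β]

theorem measurable_extend {X : ℝ → Ω → β} (hX : E.JointlyMeasurable X) :
    Measurable (E.extend X) := by
  have : Measurable fun p : Ω × ℝ => (Set.projIcc 0 E.T E.T_pos.le p.2, p.1) :=
    (continuous_projIcc.measurable.comp measurable_snd).prodMk measurable_fst
  exact hX.comp this

theorem aestronglyMeasurable [IsProbabilityMeasure P] {X : ℝ → Ω → ℝ}
    (hX : E.JointlyMeasurable X) : AEStronglyMeasurable (fun p : Ω × ℝ => X p.2 p.1) E.Q := by
  refine hX.measurable_extend.aestronglyMeasurable.congr ?_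
  filter_upwards [ae_mem_Icc] with p hp
  exact extend_eq E X hp p.1

/-- Almost everywhere statements, either iterated or on the product. -/
theorem ae_iff [IsProbabilityMeasure P] {X : ℝ → Ω → β} (hX : E.JointlyMeasurable X) {S : Set β}
    (hS : MeasurableSet S) :
    (∀ᵐ p ∂E.Q, X p.2 p.1 ∈ S) ↔
      ∀ᵐ ω ∂P, ∀ᵐ t ∂(volume.restrict (Set.Icc 0 E.T)), X t ω ∈ S := by
  constructor
  · exact fun h => Measure.ae_ae_of_ae_prod h
  · intro h
    have h1 : ∀ᵐ p ∂E.Q, E.extend X p ∈ S := by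
      refine (Measure.ae_prod_iff_ae_ae (p := fun p => E.extend X p ∈ S)
        (hX.measurable_extend hS)).2 ?_
      filter_upwards [h] with ω hω
      filter_upwards [hω, ae_restrict_mem measurableSet_Icc] with t ht htm
      rwa [extend_eq E X htm]
    filter_upwards [h1, ae_mem_Icc] with p hp hpm
    rwa [show p = (p.1, p.2) from rfl, extend_eq E X hpm] at hp

theorem measurable_slice {X : ℝ → Ω → β} (hX : E.JointlyMeasurable X) {t : ℝ}
    (ht : t ∈ Set.Icc 0 E.T) : Measurable (X t) := by
  have h : Measurable fun ω : Ω => (((⟨t, ht⟩ : Set.Icc (0 : ℝ) E.T), ω) :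
      Set.Icc (0 : ℝ) E.T × Ω) := measurable_prodMk_left
  exact hX.comp h

theorem integral {X : ℝ → Ω → ℝ} (hX : E.JointlyMeasurable X) :
    E.JointlyMeasurable fun t ω => ∫ s in (0 : ℝ)..t, X s ω := by
  have h1 : StronglyMeasurable fun q : (Set.Icc (0 : ℝ) E.T × Ω) × ℝ =>
      (Set.Ioc 0 (q.1.1 : ℝ)).indicator (fun s => E.extend X (q.1.2, s)) q.2 := by
    have hm : Measurable fun q : (Set.Icc (0 : ℝ) E.T × Ω) × ℝ => E.extend X (q.1.2, q.2) :=
      hX.measurable_extend.comp ((measurable_snd.comp measurable_fst).prodMk measurable_snd)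
    have hs : MeasurableSet {q : (Set.Icc (0 : ℝ) E.T × Ω) × ℝ | q.2 ∈ Set.Ioc 0 (q.1.1 : ℝ)} :=
      (measurableSet_lt measurable_const measurable_snd).inter
        (measurableSet_le measurable_snd
          (measurable_subtype_coe.comp (measurable_fst.comp measurable_fst)))
    exact (hm.indicator hs).stronglyMeasurable
  have h2 := h1.integral_prod_right' (ν := volume)
  unfold JointlyMeasurable
  convert h2.measurable using 2 with p
  simp only
  rw [integral_indicator measurableSet_Ioc, intervalIntegral.integral_of_le p.1.2.1]
  refine setIntegral_congr_fun measurableSet_Ioc fun s hs => ?_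
  exact (extend_eq E X ⟨hs.1.le, hs.2.trans p.1.2.2⟩ p.2).symm

theorem add {X Y : ℝ → Ω → ℝ} (hX : E.JointlyMeasurable X) (hY : E.JointlyMeasurable Y) :
    E.JointlyMeasurable fun t ω => X t ω + Y t ω := Measurable.add hX hY

theorem mul {X Y : ℝ → Ω → ℝ} (hX : E.JointlyMeasurable X) (hY : E.JointlyMeasurable Y) :
    E.JointlyMeasurable fun t ω => X t ω * Y t ω := Measurable.mul hX hY

theorem const_mul {X : ℝ → Ω → ℝ} (hX : E.JointlyMeasurable X) (c : ℝ) :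
    E.JointlyMeasurable fun t ω => c * X t ω := Measurable.const_mul hX c

end JointlyMeasurable

theorem integral_Q [IsProbabilityMeasure P] {F : ℝ → Ω → ℝ}
    (hF : Integrable (fun p : Ω × ℝ => F p.2 p.1) E.Q) :
    ∫ p, F p.2 p.1 ∂E.Q = ∫ ω, (∫ t in (0 : ℝ)..E.T, F t ω) ∂P := by
  unfold Q at hF ⊢
  rw [integral_prod _ hF]
  refine integral_congr_ae (ae_of_all _ fun ω => ?_)
  simp only
  rw [intervalIntegral.integral_of_le E.T_pos.le, integral_Icc_eq_integral_Ioc]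

theorem integral_Q_symm [IsProbabilityMeasure P] {F : ℝ → Ω → ℝ}
    (hF : Integrable (fun p : Ω × ℝ => F p.2 p.1) E.Q) :
    ∫ p, F p.2 p.1 ∂E.Q = ∫ t in Set.Icc 0 E.T, ∫ ω, F t ω ∂P := by
  unfold Q at hF ⊢
  rw [integral_prod_symm _ hF]

variable (E) in
/-- Square-integrable adapted processes. -/
structure Adm (h : ℝ → Ω → ℝ) : Prop where
  jm : E.JointlyMeasurable h
  adapted : ∀ t : Set.Icc (0 : ℝ) E.T, Measurable[E.filtration t] (h t)
  memLp : MemLp (fun p : Ω × ℝ => h p.2 p.1) 2 E.Q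

theorem adm_of_isOpt {h : ℝ → Ω → ℝ} (hh : IsOpt E.filtration h)
    (h2 : MemLp (fun p : Ω × ℝ => h p.2 p.1) 2 E.Q) : E.Adm h :=
  ⟨E.jointlyMeasurable_of_isOpt hh, hh.adapted E.T_pos.le, h2⟩

/-- The primitive of a square-integrable process is square-integrable. -/
theorem memLp_integral [IsProbabilityMeasure P] {h : ℝ → Ω → ℝ} (hh : E.JointlyMeasurable h)
    (h2 : MemLp (fun p : Ω × ℝ => h p.2 p.1) 2 E.Q) :
    MemLp (fun p : Ω × ℝ => ∫ s in (0 : ℝ)..p.2, h s p.1) 2 E.Q := by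
  have hjm := hh.integral
  refine ⟨hjm.aestronglyMeasurable, ?_⟩
  have hsq : ∀ {f : Ω × ℝ → ℝ}, eLpNorm f 2 E.Q < ∞ ↔ ∫⁻ p, ‖f p‖ₑ ^ 2 ∂E.Q < ∞ := by
    intro f
    rw [eLpNorm_lt_top_iff_lintegral_rpow_enorm_lt_top two_ne_zero ENNReal.ofNat_ne_top]
    simp
  have h2' := hsq.1 h2.2
  rw [hsq]
  have hpath : ∀ ω, AEMeasurable (fun t => ‖h t ω‖ₑ) (volume.restrict (Set.Icc 0 E.T)) := by
    intro ω
    have hm : Measurable fun t => ‖E.extend h (ω, t)‖ₑ :=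
      (hh.measurable_extend.comp measurable_prodMk_left).enorm
    refine hm.aemeasurable.congr ?_
    filter_upwards [ae_restrict_mem measurableSet_Icc] with t ht
    rw [extend_eq E h ht]
  have hb : ∀ ω, ∀ t ∈ Set.Icc 0 E.T, ‖∫ s in (0 : ℝ)..t, h s ω‖ₑ ^ 2 ≤
      ENNReal.ofReal E.T * ∫⁻ s in Set.Icc 0 E.T, ‖h s ω‖ₑ ^ 2 := by
    intro ω t ht
    have h3 : ‖∫ s in (0 : ℝ)..t, h s ω‖ₑ ≤ ∫⁻ s in Set.Icc 0 E.T, ‖h s ω‖ₑ := by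
      rw [intervalIntegral.integral_of_le ht.1]
      refine (enorm_integral_le_lintegral_enorm _).trans ?_
      exact lintegral_mono_set fun s hs => ⟨hs.1.le, hs.2.trans ht.2⟩
    refine (pow_le_pow_left' h3 2).trans ((lintegral_sq_le _ (hpath ω)).trans ?_)
    simp
  calc ∫⁻ p, ‖∫ s in (0 : ℝ)..p.2, h s p.1‖ₑ ^ 2 ∂E.Q
      ≤ ∫⁻ p, ENNReal.ofReal E.T * (∫⁻ s in Set.Icc 0 E.T, ‖h s p.1‖ₑ ^ 2) ∂E.Q := by
        refine lintegral_mono_ae ?_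
        filter_upwards [ae_mem_Icc] with p hp
        exact hb p.1 p.2 hp
    _ ≤ ∫⁻ ω, (∫⁻ _ in Set.Icc 0 E.T,
          ENNReal.ofReal E.T * (∫⁻ s in Set.Icc 0 E.T, ‖h s ω‖ₑ ^ 2)) ∂P :=
        lintegral_prod_le _
    _ = ENNReal.ofReal E.T * ENNReal.ofReal E.T *
          ∫⁻ ω, (∫⁻ s in Set.Icc 0 E.T, ‖h s ω‖ₑ ^ 2) ∂P := by
        rw [← lintegral_const_mul' _ _ (by finiteness)]
        refine lintegral_congr fun ω => ?_
        simp [mul_comm, mul_assoc]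
    _ = ENNReal.ofReal E.T * ENNReal.ofReal E.T * ∫⁻ p, ‖h p.2 p.1‖ₑ ^ 2 ∂E.Q := by
        congr 1
        exact (lintegral_prod _ (hh.aestronglyMeasurable.enorm.pow_const 2)).symm
    _ < ∞ := ENNReal.mul_lt_top (by finiteness) h2'

/-- Without a pointwise bound, exceptional paths of the primitive may be discontinuous, so
optionality is not claimed; adaptedness and joint measurability suffice for a test process. -/
theorem adm_integral [IsProbabilityMeasure P] {h : ℝ → Ω → ℝ} (hh : IsOpt E.filtration h)
    (h2 : MemLp (fun p : Ω × ℝ => h p.2 p.1) 2 E.Q) :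
    E.Adm fun t ω => ∫ s in (0 : ℝ)..t, h s ω :=
  ⟨(E.jointlyMeasurable_of_isOpt hh).integral, hh.measurable_integral E.T_pos.le,
    memLp_integral (E.jointlyMeasurable_of_isOpt hh) h2⟩

/-- Almost all paths of a square-integrable process are integrable. -/
theorem ae_intervalIntegrable [IsProbabilityMeasure P] {h : ℝ → Ω → ℝ}
    (h2 : MemLp (fun p : Ω × ℝ => h p.2 p.1) 2 E.Q) :
    ∀ᵐ ω ∂P, ∀ t ∈ Set.Icc 0 E.T, IntervalIntegrable (fun s => h s ω) volume 0 t := by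
  have h1 : Integrable (fun p : Ω × ℝ => h p.2 p.1) (P.prod (volume.restrict (Set.Icc 0 E.T))) :=
    h2.integrable one_le_two
  filter_upwards [h1.prod_right_ae] with ω hω t ht
  have : IntegrableOn (fun s => h s ω) (Set.Icc 0 E.T) := hω
  refine (this.mono_set ?_).intervalIntegrable
  rw [Set.uIcc_of_le ht.1]
  exact Set.Icc_subset_Icc le_rfl ht.2

theorem memLp_of_bound [IsProbabilityMeasure P] {h : ℝ → Ω → ℝ} (hh : E.JointlyMeasurable h) {C : ℝ}
    (hC : ∀ᵐ p ∂E.Q, |h p.2 p.1| ≤ C) : MemLp (fun p : Ω × ℝ => h p.2 p.1) 2 E.Q :=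
  MemLp.of_bound hh.aestronglyMeasurable C hC

/-- An optional bounded process orthogonal to all primitives of bounded optional processes
vanishes. -/
theorem ae_eq_zero_of_orthogonal [IsProbabilityMeasure P] {G : ℝ → Ω → ℝ}
    (hG : IsOpt E.filtration G) {C : ℝ} (hC : ∀ᵐ p ∂E.Q, |G p.2 p.1| ≤ C)
    (h : ∀ h : ℝ → Ω → ℝ, IsOpt E.filtration h → (∃ D, ∀ t ω, |h t ω| ≤ D) →
      ∫ p, (∫ s in (0 : ℝ)..p.2, h s p.1) * G p.2 p.1 ∂E.Q = 0) :
    ∀ᵐ p ∂E.Q, G p.2 p.1 = 0 := by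
  have hT := E.T_pos.le
  -- A version bounded everywhere, so that all its paths are integrable and it can itself serve in a
  -- test process.
  obtain ⟨g, hg⟩ : ∃ g : ℝ → Ω → ℝ, g = fun t ω => max (-|C|) (min |C| (G t ω)) := ⟨_, rfl⟩
  have hgo : IsOpt E.filtration g := by rw [hg]; exact hG.clip _
  have hgb : ∀ t ω, |g t ω| ≤ |C| := fun t ω => by
    rw [hg]
    exact abs_le.2 ⟨le_max_left _ _, max_le (by linarith [abs_nonneg C]) (min_le_left _ _)⟩
  have hgG : ∀ᵐ p ∂E.Q, g p.2 p.1 = G p.2 p.1 := by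
    filter_upwards [hC] with p hp
    have := abs_le.1 (hp.trans (le_abs_self C))
    rw [hg]
    simp only
    rw [min_eq_right this.2, max_eq_right this.1]
  have hgi : ∀ (ω) {s t : ℝ}, s ∈ Set.Icc 0 E.T → t ∈ Set.Icc 0 E.T →
      IntervalIntegrable (fun s => g s ω) volume s t := fun ω s t hs ht =>
    hgo.intervalIntegrable_of_bound hT (ae_of_all _ fun t => hgb t ω) hs ht
  have hgj := E.jointlyMeasurable_of_isOpt hgo
  obtain ⟨K, hK⟩ : ∃ K : ℝ → Ω → ℝ, K = fun t ω => ∫ s in (0 : ℝ)..t, g s ω := ⟨_, rfl⟩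
  have h0T : (0 : ℝ) ∈ Set.Icc 0 E.T := ⟨le_rfl, hT⟩
  have hTT : E.T ∈ Set.Icc 0 E.T := ⟨hT, le_rfl⟩
  have hKc : ∀ ω, ContinuousOn (fun t => K t ω) (Set.Icc 0 E.T) := fun ω => by
    rw [hK]; exact hgo.continuousOn_integral hT (ae_of_all _ fun t => hgb t ω)
  have hKm : ∀ t ∈ Set.Icc 0 E.T, Measurable (K t) := fun t ht => by
    rw [hK]; exact hgj.integral.measurable_slice ht
  have hKb : ∀ ω, ∀ t ∈ Set.Icc 0 E.T, |K t ω| ≤ |C| * E.T := by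
    intro ω t ht
    have h1 : ‖∫ s in (0 : ℝ)..t, g s ω‖ ≤ |C| * |t - 0| :=
      intervalIntegral.norm_integral_le_of_norm_le_const fun s _ => hgb s ω
    rw [hK]
    refine h1.trans ?_
    rw [sub_zero, abs_of_nonneg ht.1]
    exact mul_le_mul_of_nonneg_left ht.2 (abs_nonneg C)
  -- The test process is `g` switched off at time `s`, whose primitive is `K (min t s)`. Splitting
  -- the integral against `g` at `s` gives the two terms. The case `s = T` forces `K T = 0`; then
  -- general `s` leaves `-K s ^ 2 / 2`, so `K s = 0`.
  have key : ∀ s ∈ Set.Icc 0 E.T,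
      ∫ ω, (K s ω ^ 2 / 2 + K s ω * (K E.T ω - K s ω)) ∂P = 0 := by
    intro s hs
    obtain ⟨k, hk⟩ : ∃ k : ℝ → Ω → ℝ, k = fun t ω => (if t < s then 1 else 0) * g t ω := ⟨_, rfl⟩
    have hko : IsOpt E.filtration k := by rw [hk]; exact (isOpt_indicator_lt s).mul hgo
    have hkb : ∀ t ω, |k t ω| ≤ |C| := fun t ω => by
      rw [hk]
      by_cases hts : t < s
      · simpa [hts] using hgb t ω
      · simp [hts]
    have hkint : ∀ ω, ∀ t ∈ Set.Icc 0 E.T, ∫ x in (0 : ℝ)..t, k x ω = K (min t s) ω := by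
      intro ω t ht
      have hki : ∀ {a b : ℝ}, a ∈ Set.Icc 0 E.T → b ∈ Set.Icc 0 E.T →
          IntervalIntegrable (fun s => k s ω) volume a b := fun ha hb =>
        hko.intervalIntegrable_of_bound hT (ae_of_all _ fun t => hkb t ω) ha hb
      have hlow : ∀ t' ∈ Set.Icc 0 s, ∫ x in (0 : ℝ)..t', k x ω = K t' ω := by
        intro t' ht'
        rw [hK]
        refine intervalIntegral.integral_congr_ae ?_
        have : ∀ᵐ x : ℝ, x ≠ s := by simp [ae_iff, measure_singleton]
        filter_upwards [this] with x hx hxm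
        rw [Set.uIoc_of_le ht'.1] at hxm
        have : x < s := lt_of_le_of_ne (hxm.2.trans ht'.2) hx
        simp [hk, this]
      rcases le_total t s with hts | hts
      · rw [min_eq_left hts, hlow t ⟨ht.1, hts⟩]
      · rw [min_eq_right hts, ← intervalIntegral.integral_add_adjacent_intervals (hki h0T hs)
          (hki hs ht), hlow s ⟨hs.1, le_rfl⟩]
        have : ∫ x in s..t, k x ω = 0 := by
          rw [intervalIntegral.integral_congr (g := fun _ => (0 : ℝ))]
          · simp
          · intro x hx
            rw [Set.uIcc_of_le hts] at hx
            simp [hk, not_lt.2 hx.1]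
        rw [this, add_zero]
    have h1 := h k hko ⟨_, hkb⟩
    have hki2 : MemLp (fun p : Ω × ℝ => k p.2 p.1) 2 E.Q :=
      memLp_of_bound (E.jointlyMeasurable_of_isOpt hko) (ae_of_all _ fun p => hkb p.2 p.1)
    have hint : Integrable (fun p : Ω × ℝ => (∫ s in (0 : ℝ)..p.2, k s p.1) * g p.2 p.1) E.Q :=
      MemLp.integrable_mul (memLp_integral (E.jointlyMeasurable_of_isOpt hko) hki2)
        (memLp_of_bound hgj (ae_of_all _ fun p => hgb p.2 p.1))
    have h2 : ∫ p, (∫ s in (0 : ℝ)..p.2, k s p.1) * g p.2 p.1 ∂E.Q = 0 := by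
      refine Eq.trans ?_ h1
      refine integral_congr_ae ?_
      filter_upwards [hgG] with p hp
      rw [hp]
    rw [integral_Q (F := fun t ω => (∫ s in (0 : ℝ)..t, k s ω) * g t ω) hint] at h2
    refine Eq.trans ?_ h2
    refine integral_congr_ae (ae_of_all _ fun ω => ?_)
    simp only
    have hgc : ∀ {a b : ℝ}, a ∈ Set.Icc 0 E.T → b ∈ Set.Icc 0 E.T →
        IntervalIntegrable (fun t => K (min t s) ω * g t ω) volume a b := by
      intro a b ha hb
      refine (hgi ω ha hb).continuousOn_mul ?_
      refine ((hKc ω).comp (continuous_id.min continuous_const).continuousOn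
        (fun t ht => ⟨le_min ht.1 hs.1, (min_le_left _ _).trans ht.2⟩)).mono
        (Set.uIcc_subset_Icc ha hb)
    have e1 : ∫ t in (0 : ℝ)..E.T, (∫ s in (0 : ℝ)..t, k s ω) * g t ω =
        ∫ t in (0 : ℝ)..E.T, K (min t s) ω * g t ω := by
      refine intervalIntegral.integral_congr fun t ht => ?_
      rw [Set.uIcc_of_le hT] at ht
      simp only [hkint ω t ht]
    have e2 : ∫ t in (0 : ℝ)..s, K (min t s) ω * g t ω = K s ω ^ 2 / 2 := by
      have e3 := integral_mul_primitive_add 0 0 (hgi ω h0T hs) (hgi ω h0T hs)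
      simp only [zero_add, mul_zero, sub_zero] at e3
      have e4 : ∫ t in (0 : ℝ)..s, K (min t s) ω * g t ω = ∫ t in (0 : ℝ)..s,
          (g t ω * (∫ x in (0 : ℝ)..t, g x ω) + (∫ x in (0 : ℝ)..t, g x ω) * g t ω) * (1 / 2) := by
        refine intervalIntegral.integral_congr fun t ht => ?_
        rw [Set.uIcc_of_le hs.1] at ht
        simp only [min_eq_left ht.2, hK]
        ring
      rw [e4, intervalIntegral.integral_mul_const, e3]
      simp only [hK]
      ring
    have e5 : ∫ t in s..E.T, K (min t s) ω * g t ω = K s ω * (K E.T ω - K s ω) := by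
      have e6 : ∫ t in s..E.T, K (min t s) ω * g t ω = ∫ t in s..E.T, K s ω * g t ω := by
        refine intervalIntegral.integral_congr fun t ht => ?_
        rw [Set.uIcc_of_le hs.2] at ht
        simp only [min_eq_right ht.1]
      rw [e6, intervalIntegral.integral_const_mul]
      congr 1
      simp only [hK]
      rw [intervalIntegral.integral_interval_sub_left (hgi ω h0T hTT) (hgi ω h0T hs)]
    rw [e1, ← intervalIntegral.integral_add_adjacent_intervals (hgc h0T hs) (hgc hs hTT), e2, e5]
  have hzero : ∀ {Y : Ω → ℝ}, Measurable Y → (∀ ω, |Y ω| ≤ |C| * E.T) → ∫ ω, Y ω ^ 2 ∂P = 0 →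
      ∀ᵐ ω ∂P, Y ω = 0 := by
    intro Y hY hYb h0
    have hYi : Integrable (fun ω => Y ω ^ 2) P := by
      refine Integrable.of_bound (hY.pow_const 2).aestronglyMeasurable ((|C| * E.T) ^ 2)
        (ae_of_all _ fun ω => ?_)
      rw [norm_pow]
      exact pow_le_pow_left₀ (norm_nonneg _) (hYb ω) 2
    have := (integral_eq_zero_iff_of_nonneg (fun ω => sq_nonneg (Y ω)) hYi).1 h0
    filter_upwards [this] with ω hω
    exact pow_eq_zero_iff (two_ne_zero) |>.1 hω
  have hKT : ∀ᵐ ω ∂P, K E.T ω = 0 := by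
    refine hzero (hKm _ hTT) (fun ω => hKb ω _ hTT) ?_
    have := key E.T hTT
    simp only [sub_self, mul_zero, add_zero] at this
    rw [integral_div] at this
    linarith
  have hKs : ∀ s ∈ Set.Icc 0 E.T, ∀ᵐ ω ∂P, K s ω = 0 := by
    intro s hs
    refine hzero (hKm _ hs) (fun ω => hKb ω _ hs) ?_
    have h1 := key s hs
    have h2 : ∫ ω, (K s ω ^ 2 / 2 + K s ω * (K E.T ω - K s ω)) ∂P =
        ∫ ω, K s ω ^ 2 * (-1 / 2) ∂P := by
      refine integral_congr_ae ?_
      filter_upwards [hKT] with ω hω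
      rw [hω]; ring
    rw [h2, integral_mul_const] at h1
    linarith
  -- Vanishing almost surely at each fixed time becomes, by Fubini, vanishing at almost every time
  -- on almost every path, and continuity extends it to all times.
  have hall : ∀ᵐ ω ∂P, ∀ t ∈ Set.Icc 0 E.T, K t ω = 0 := by
    have h1 : ∀ᵐ p ∂(P.prod (volume.restrict (Set.Icc 0 E.T))), E.extend K p = 0 := by
      have hm : Measurable (E.extend K) := by
        rw [hK]; exact hgj.integral.measurable_extend
      have hms : MeasurableSet {p | E.extend K p = 0} := hm (measurableSet_singleton 0)
      have h2 : ∀ᵐ q ∂((volume.restrict (Set.Icc 0 E.T)).prod P), E.extend K q.swap = 0 := by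
        refine (Measure.ae_prod_iff_ae_ae (p := fun q : ℝ × Ω => E.extend K q.swap = 0)
          (measurable_swap hms)).2 ?_
        filter_upwards [ae_restrict_mem measurableSet_Icc] with t ht
        filter_upwards [hKs t ht] with ω hω
        rw [Prod.swap_prod_mk, extend_eq E K ht, hω]
      exact (Measure.measurePreserving_swap (μ := P)
        (ν := volume.restrict (Set.Icc 0 E.T))).quasiMeasurePreserving.ae h2
    filter_upwards [Measure.ae_ae_of_ae_prod h1] with ω hω
    have h3 : (fun t => K t ω) =ᵐ[volume.restrict (Set.Icc 0 E.T)] fun _ => 0 := by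
      filter_upwards [hω, ae_restrict_mem measurableSet_Icc] with t ht htm
      rwa [extend_eq E K htm] at ht
    exact fun t ht =>
      Measure.eqOn_Icc_of_ae_eq volume E.T_pos.ne h3 (hKc ω) continuousOn_const ht
  have hg0 : ∀ᵐ p ∂E.Q, g p.2 p.1 ∈ ({0} : Set ℝ) := by
    refine (hgj.ae_iff (measurableSet_singleton 0)).2 ?_
    filter_upwards [hall] with ω hω
    refine ae_eq_zero_of_primitive_eq_zero hT (hgi ω h0T hTT) fun t ht => ?_
    refine Eq.trans ?_ (hω t ht)
    rw [hK]
  filter_upwards [hg0, hgG] with p h1 h2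
  rw [← h2]
  exact h1

end Economy

/-! ### Drifts characterized by duality. -/

namespace Economy

variable {d N : ℕ} {Ω : Type*} [mΩ : MeasurableSpace Ω] {P : Measure Ω} [IsProbabilityMeasure P]
  {E : Economy d N P}

/-- The increments of a bounded martingale are orthogonal to the past. -/
theorem integral_mul_increment_eq_zero {M : ℝ → Ω → ℝ} {K : ℝ}
    (hM : Martingale (fun (t : Set.Icc (0 : ℝ) E.T) ω => M t ω) E.filtration P)
    (hK : ∀ᵐ ω ∂P, ∀ t ∈ Set.Icc 0 E.T, |M t ω| ≤ K) (t : Set.Icc (0 : ℝ) E.T) {Y : Ω → ℝ}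
    (hY : Measurable[E.filtration t] Y) (hYi : Integrable Y P) :
    Integrable (fun ω => Y ω * (M E.T ω - M t ω)) P ∧
      ∫ ω, Y ω * (M E.T ω - M t ω) ∂P = 0 := by
  have hTT : E.T ∈ Set.Icc 0 E.T := ⟨E.T_pos.le, le_rfl⟩
  have hMi := (hM.integrable ⟨E.T, hTT⟩).sub (hM.integrable t)
  have hi : Integrable (Y * ((fun ω => M E.T ω) - fun ω => M t ω)) P := by
    refine hYi.mul_bdd (c := K + K) hMi.aestronglyMeasurable ?_
    filter_upwards [hK] with ω hω
    exact (norm_sub_le _ _).trans (add_le_add (hω _ hTT) (hω _ t.2))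
  refine ⟨hi, ?_⟩
  have h1 := condExp_mul_of_stronglyMeasurable_left (m := E.filtration t)
    (Measurable.stronglyMeasurable hY) hi hMi
  have h2 : P[((fun ω => M E.T ω) - fun ω => M t ω) | E.filtration t] =ᵐ[P] 0 := by
    have h3 := condExp_sub (hM.integrable ⟨E.T, hTT⟩) (hM.integrable t) (E.filtration t)
    have h4 := hM.condExp_ae_eq (show t ≤ ⟨E.T, hTT⟩ from t.2.2)
    have h5 := hM.condExp_ae_eq (le_refl t)
    filter_upwards [h3, h4, h5] with ω a b c
    refine a.trans ?_
    simp only [Pi.sub_apply, Pi.zero_apply, b, c, sub_self]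
  have h6 : ∫ ω, (Y * ((fun ω => M E.T ω) - fun ω => M t ω)) ω ∂P = 0 := by
    rw [← integral_condExp (E.filtration.le t)]
    rw [integral_congr_ae h1]
    refine integral_eq_zero_of_ae ?_
    filter_upwards [h2] with ω hω
    simp [hω]
  exact h6

variable (E) in
/-- A bounded process `u` with vanishing terminal value and bounded drift `a`, described by
integration by parts. -/
structure WeakDrift (u a : ℝ → Ω → ℝ) : Prop where
  opt : IsOpt E.filtration u
  opt_drift : IsOpt E.filtration a
  bdd : ∃ C, ∀ᵐ p ∂E.Q, |u p.2 p.1| ≤ C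
  bdd_drift : ∃ C, ∀ᵐ p ∂E.Q, |a p.2 p.1| ≤ C
  ibp : ∀ h, E.Adm h → ∫ p, ((∫ s in (0 : ℝ)..p.2, h s p.1) * a p.2 p.1 + h p.2 p.1 * u p.2 p.1) ∂E.Q = 0

theorem ae_Q_of_ae_path {X : ℝ → Ω → ℝ} (hX : E.JointlyMeasurable X) {C : ℝ}
    (h : ∀ᵐ ω ∂P, ∀ᵐ t ∂(volume.restrict (Set.Icc 0 E.T)), |X t ω| ≤ C) :
    ∀ᵐ p ∂E.Q, |X p.2 p.1| ≤ C :=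
  (hX.ae_iff (S := {x | |x| ≤ C}) (measurableSet_le continuous_abs.measurable
    measurable_const)).2 h

/-- The terminal condition gives `u t = -∫ₜᵀ a - (M T - M t)`. The martingale increment is
orthogonal to everything known at `t`, and the remaining term is handled by the product rule path by
path. -/
theorem weakDrift_of_decomposition {u a M : ℝ → Ω → ℝ} {C K : ℝ} (hu : IsOpt E.filtration u)
    (ha : IsOpt E.filtration a)
    (hC : ∀ᵐ ω ∂P, ∀ᵐ t ∂(volume.restrict (Set.Icc 0 E.T)), |a t ω| ≤ C)
    (hM : Martingale (fun (t : Set.Icc (0 : ℝ) E.T) ω => M t ω) E.filtration P)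
    (hMc : ∀ᵐ ω ∂P, ContinuousOn (fun t => M t ω) (Set.Icc 0 E.T))
    (hK : ∀ᵐ ω ∂P, ∀ᵐ t ∂(volume.restrict (Set.Icc 0 E.T)), |M t ω| ≤ K)
    (heq : ∀ᵐ ω ∂P, ∀ t ∈ Set.Icc 0 E.T,
      u t ω = u 0 ω + (∫ s in (0 : ℝ)..t, a s ω) + (M t ω - M 0 ω))
    (hterm : ∀ᵐ ω ∂P, u E.T ω = 0) : E.WeakDrift u a := by
  have hT := E.T_pos.le
  have h0T : (0 : ℝ) ∈ Set.Icc 0 E.T := ⟨le_rfl, hT⟩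
  have hTT : E.T ∈ Set.Icc 0 E.T := ⟨hT, le_rfl⟩
  have huj := E.jointlyMeasurable_of_isOpt hu
  have haj := E.jointlyMeasurable_of_isOpt ha
  have hMb : ∀ᵐ ω ∂P, ∀ t ∈ Set.Icc 0 E.T, |M t ω| ≤ K := by
    filter_upwards [hMc, hK] with ω h1 h2
    exact le_of_ae_le_of_continuousOn E.T_pos h1.abs h2
  obtain ⟨B, hB⟩ : ∃ B : ℝ → Ω → ℝ, B = fun t ω => (∫ s in (0 : ℝ)..E.T, a s ω) -
      ∫ s in (0 : ℝ)..t, a s ω := ⟨_, rfl⟩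
  have hBj : E.JointlyMeasurable B := by
    rw [hB]
    exact Measurable.sub ((haj.integral.measurable_slice hTT).comp measurable_snd) haj.integral
  have hai : ∀ᵐ ω ∂P, ∀ {s t : ℝ}, s ∈ Set.Icc 0 E.T → t ∈ Set.Icc 0 E.T →
      IntervalIntegrable (fun t => a t ω) volume s t := by
    filter_upwards [hC] with ω hω s t hs ht
    exact ha.intervalIntegrable_of_bound hT hω hs ht
  have hBb : ∀ᵐ ω ∂P, ∀ t ∈ Set.Icc 0 E.T, |B t ω| ≤ |C| * E.T := by
    filter_upwards [hC, hai] with ω hω hωi t ht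
    have h1 : B t ω = ∫ s in t..E.T, a s ω := by
      rw [hB]
      exact intervalIntegral.integral_interval_sub_left (hωi h0T hTT) (hωi h0T ht)
    rw [h1]
    have h2 : ‖∫ s in t..E.T, a s ω‖ ≤ |C| * |E.T - t| := by
      refine intervalIntegral.norm_integral_le_of_norm_le_const_ae ?_
      have := (ae_restrict_iff' measurableSet_Icc).1 hω
      filter_upwards [this] with s hs hst
      rw [Set.uIoc_of_le ht.2] at hst
      exact (hs ⟨ht.1.trans hst.1.le, hst.2⟩).trans (le_abs_self C)
    refine h2.trans (mul_le_mul_of_nonneg_left ?_ (abs_nonneg C))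
    rw [abs_of_nonneg (sub_nonneg.2 ht.2)]
    linarith [ht.1]
  have hrep : ∀ᵐ ω ∂P, ∀ t ∈ Set.Icc 0 E.T, u t ω = -B t ω - (M E.T ω - M t ω) := by
    filter_upwards [heq, hterm] with ω h1 h2 t ht
    have h3 := h1 t ht
    have h4 := h1 E.T hTT
    rw [h2] at h4
    rw [hB]
    simp only
    linarith
  have hub : ∀ᵐ ω ∂P, ∀ t ∈ Set.Icc 0 E.T, |u t ω| ≤ |C| * E.T + (K + K) := by
    filter_upwards [hrep, hBb, hMb] with ω h1 h2 h3 t ht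
    rw [h1 t ht]
    have := abs_le.1 (h2 t ht)
    have := abs_le.1 (h3 t ht)
    have := abs_le.1 (h3 E.T hTT)
    exact abs_le.2 ⟨by linarith, by linarith⟩
  have hbu : ∀ᵐ p ∂E.Q, |u p.2 p.1| ≤ |C| * E.T + (K + K) := by
    refine ae_Q_of_ae_path huj ?_
    filter_upwards [hub] with ω hω
    exact (ae_restrict_mem measurableSet_Icc).mono fun t ht => hω t ht
  have hba : ∀ᵐ p ∂E.Q, |a p.2 p.1| ≤ C := ae_Q_of_ae_path haj hC
  refine ⟨hu, ha, ⟨_, hbu⟩, ⟨_, hba⟩, fun h hh => ?_⟩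
  have hu2 := memLp_of_bound huj hbu
  have ha2 := memLp_of_bound haj hba
  have hB2 : MemLp (fun p : Ω × ℝ => B p.2 p.1) 2 E.Q := by
    refine memLp_of_bound (C := |C| * E.T) hBj (ae_Q_of_ae_path hBj ?_)
    filter_upwards [hBb] with ω hω
    exact (ae_restrict_mem measurableSet_Icc).mono fun t ht => hω t ht
  have hH2 := memLp_integral hh.jm hh.memLp
  have i1 : Integrable (fun p : Ω × ℝ => (∫ s in (0 : ℝ)..p.2, h s p.1) * a p.2 p.1) E.Q :=
    hH2.integrable_mul ha2
  have i2 : Integrable (fun p : Ω × ℝ => h p.2 p.1 * u p.2 p.1) E.Q := hh.memLp.integrable_mul hu2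
  have i3 : Integrable (fun p : Ω × ℝ => h p.2 p.1 * B p.2 p.1) E.Q := hh.memLp.integrable_mul hB2
  -- Integrating over `ω` first, for almost every fixed time, removes the martingale increment.
  have e1 : ∫ p, h p.2 p.1 * u p.2 p.1 ∂E.Q = ∫ p, -(h p.2 p.1 * B p.2 p.1) ∂E.Q := by
    rw [integral_Q_symm (F := fun t ω => h t ω * u t ω) i2,
      integral_Q_symm (F := fun t ω => -(h t ω * B t ω)) i3.neg]
    have hint : Integrable (fun p : Ω × ℝ => h p.2 p.1) (P.prod (volume.restrict (Set.Icc 0 E.T))) :=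
      hh.memLp.integrable one_le_two
    have hintB : Integrable (fun p : Ω × ℝ => h p.2 p.1 * B p.2 p.1)
      (P.prod (volume.restrict (Set.Icc 0 E.T))) := i3
    refine integral_congr_ae ?_
    filter_upwards [hint.prod_left_ae, hintB.prod_left_ae, ae_restrict_mem measurableSet_Icc]
      with t ht htB htm
    obtain ⟨h1, h2⟩ := integral_mul_increment_eq_zero hM hMb ⟨t, htm⟩ (hh.adapted ⟨t, htm⟩) ht
    have h3 : ∫ ω, h t ω * u t ω ∂P =
        ∫ ω, (-(h t ω * B t ω) - h t ω * (M E.T ω - M t ω)) ∂P := by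
      refine integral_congr_ae ?_
      filter_upwards [hrep] with ω hω
      rw [hω t htm]
      ring
    have h4 : Integrable (fun ω => -(h t ω * B t ω)) P := htB.neg
    have h5 := integral_sub h4 h1
    rw [h2, sub_zero] at h5
    rw [h3]
    exact h5
  have e2 : ∫ p, ((∫ s in (0 : ℝ)..p.2, h s p.1) * a p.2 p.1 + -(h p.2 p.1 * B p.2 p.1)) ∂E.Q
      = 0 := by
    rw [integral_Q (F := fun t ω => (∫ s in (0 : ℝ)..t, h s ω) * a t ω + -(h t ω * B t ω))
      (i1.add i3.neg)]
    refine integral_eq_zero_of_ae ?_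
    filter_upwards [hai, ae_intervalIntegrable hh.memLp] with ω h1 h2
    -- The initial values are chosen so that both boundary terms vanish: one factor is zero at `0`,
    -- the other at `T`.
    have h3 := integral_mul_primitive_add 0 (-∫ s in (0 : ℝ)..E.T, a s ω) (h2 E.T hTT)
      (h1 h0T hTT)
    simp only [neg_add_cancel, mul_zero, zero_mul, sub_zero, zero_add] at h3
    refine Eq.trans ?_ h3
    refine intervalIntegral.integral_congr fun t _ => ?_
    simp only [hB]
    ring
  have i4 : Integrable (fun p : Ω × ℝ => -(h p.2 p.1 * B p.2 p.1)) E.Q := i3.neg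
  rw [integral_add i1 i2, e1, ← integral_add i1 i4]
  exact e2

namespace WeakDrift

variable {u a u' a' : ℝ → Ω → ℝ}

theorem memLp (h : E.WeakDrift u a) : MemLp (fun p : Ω × ℝ => u p.2 p.1) 2 E.Q :=
  memLp_of_bound (E.jointlyMeasurable_of_isOpt h.opt) h.bdd.choose_spec

theorem memLp_drift (h : E.WeakDrift u a) : MemLp (fun p : Ω × ℝ => a p.2 p.1) 2 E.Q :=
  memLp_of_bound (E.jointlyMeasurable_of_isOpt h.opt_drift) h.bdd_drift.choose_spec

theorem integrable_left (h : E.WeakDrift u a) {k : ℝ → Ω → ℝ} (hk : E.Adm k) :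
    Integrable (fun p : Ω × ℝ => (∫ s in (0 : ℝ)..p.2, k s p.1) * a p.2 p.1) E.Q :=
  (memLp_integral hk.jm hk.memLp).integrable_mul h.memLp_drift

theorem integrable_right (h : E.WeakDrift u a) {k : ℝ → Ω → ℝ} (hk : E.Adm k) :
    Integrable (fun p : Ω × ℝ => k p.2 p.1 * u p.2 p.1) E.Q :=
  hk.memLp.integrable_mul h.memLp

theorem add (h : E.WeakDrift u a) (h' : E.WeakDrift u' a') :
    E.WeakDrift (fun t ω => u t ω + u' t ω) (fun t ω => a t ω + a' t ω) := by
  refine ⟨h.opt.add h'.opt, h.opt_drift.add h'.opt_drift, ?_, ?_, fun k hk => ?_⟩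
  · obtain ⟨⟨C, hC⟩, ⟨D, hD⟩⟩ := h.bdd, h'.bdd
    exact ⟨C + D, by filter_upwards [hC, hD] with p h1 h2 using (abs_add_le _ _).trans (add_le_add h1 h2)⟩
  · obtain ⟨⟨C, hC⟩, ⟨D, hD⟩⟩ := h.bdd_drift, h'.bdd_drift
    exact ⟨C + D, by filter_upwards [hC, hD] with p h1 h2 using (abs_add_le _ _).trans (add_le_add h1 h2)⟩
  · have h1 := h.ibp k hk
    have h2 := h'.ibp k hk
    have h3 := integral_add ((h.integrable_left hk).add (h.integrable_right hk))
      ((h'.integrable_left hk).add (h'.integrable_right hk))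
    simp only [Pi.add_apply] at h3
    rw [h1, h2, add_zero] at h3
    refine Eq.trans ?_ h3
    refine integral_congr_ae (ae_of_all _ fun p => ?_)
    simp only
    ring

theorem const_mul (h : E.WeakDrift u a) (c : ℝ) :
    E.WeakDrift (fun t ω => c * u t ω) (fun t ω => c * a t ω) := by
  refine ⟨h.opt.const_mul c, h.opt_drift.const_mul c, ?_, ?_, fun k hk => ?_⟩
  · obtain ⟨C, hC⟩ := h.bdd
    refine ⟨|c| * C, ?_⟩
    filter_upwards [hC] with p h1
    rw [abs_mul]
    exact mul_le_mul_of_nonneg_left h1 (abs_nonneg c)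
  · obtain ⟨C, hC⟩ := h.bdd_drift
    refine ⟨|c| * C, ?_⟩
    filter_upwards [hC] with p h1
    rw [abs_mul]
    exact mul_le_mul_of_nonneg_left h1 (abs_nonneg c)
  · have h1 : ∀ p : Ω × ℝ, (∫ s in (0 : ℝ)..p.2, k s p.1) * (c * a p.2 p.1) +
        k p.2 p.1 * (c * u p.2 p.1) =
        c * ((∫ s in (0 : ℝ)..p.2, k s p.1) * a p.2 p.1 + k p.2 p.1 * u p.2 p.1) := fun p => by ring
    simp only [h1]
    rw [integral_const_mul, h.ibp k hk, mul_zero]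

theorem zero : E.WeakDrift (fun _ _ => 0) (fun _ _ => 0) :=
  ⟨measurable_const, measurable_const, ⟨0, by simp⟩, ⟨0, by simp⟩, by simp⟩

theorem sum {ι : Type*} (s : Finset ι) {u a : ι → ℝ → Ω → ℝ}
    (h : ∀ i ∈ s, E.WeakDrift (u i) (a i)) :
    E.WeakDrift (fun t ω => ∑ i ∈ s, u i t ω) (fun t ω => ∑ i ∈ s, a i t ω) := by
  classical
  induction s using Finset.induction_on with
  | empty => simpa using zero
  | insert i s hi ih =>
    simp only [Finset.sum_insert hi]
    exact (h i (Finset.mem_insert_self i s)).add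
      (ih fun j hj => h j (Finset.mem_insert_of_mem hj))

/-- The drift of a process is unique. -/
theorem drift_unique (h : E.WeakDrift u a) (h' : E.WeakDrift u' a')
    (huu : ∀ᵐ p ∂E.Q, u p.2 p.1 = u' p.2 p.1) : ∀ᵐ p ∂E.Q, a p.2 p.1 = a' p.2 p.1 := by
  have hd := h.add (h'.const_mul (-1))
  obtain ⟨C, hC⟩ := hd.bdd_drift
  have := ae_eq_zero_of_orthogonal hd.opt_drift hC fun k hk hkb => by
    have hkA : E.Adm k := adm_of_isOpt hk
      (memLp_of_bound (E.jointlyMeasurable_of_isOpt hk) (ae_of_all _ fun p =>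
        hkb.choose_spec p.2 p.1))
    refine Eq.trans (integral_congr_ae ?_) (hd.ibp k hkA)
    filter_upwards [huu] with p hp
    rw [hp]
    ring
  filter_upwards [this] with p hp
  linarith

end WeakDrift

variable (E) in
/-- The discount factor. -/
def disc (t : ℝ) : ℝ := Real.exp (-E.r * t)

theorem disc_pos (t : ℝ) : 0 < E.disc t := Real.exp_pos _

theorem continuous_disc : Continuous E.disc := by unfold disc; fun_prop

theorem disc_eq (t : ℝ) : E.disc t = 1 + ∫ s in (0 : ℝ)..t, -E.r * E.disc s := by
  have : ∀ s, HasDerivAt E.disc (-E.r * E.disc s) s := fun s => by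
    have h := ((hasDerivAt_id s).const_mul (-E.r)).exp
    refine h.congr_deriv ?_
    simp only [disc, id]
    ring
  rw [intervalIntegral.integral_eq_sub_of_hasDerivAt (fun s _ => this s)
    (Continuous.intervalIntegrable (continuous_const.mul continuous_disc) _ _)]
  simp [disc]

theorem disc_le (t : ℝ) (ht : 0 ≤ t) : E.disc t ≤ 1 := by
  refine Real.exp_le_one_iff.2 ?_
  have := mul_nonneg E.r_nonneg ht
  linarith

variable (E) in
theorem isOpt_disc : IsOpt E.filtration (fun t (_ : Ω) => E.disc t) :=
  isOpt_of_continuous_deterministic continuous_disc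

theorem ae_abs_disc_le : ∀ᵐ p ∂E.Q, |E.disc p.2| ≤ 1 := by
  filter_upwards [ae_mem_Icc] with p hp
  rw [abs_of_pos (disc_pos _)]
  exact disc_le _ hp.1

theorem memLp_disc_mul {X : ℝ → Ω → ℝ} (hX : MemLp (fun p : Ω × ℝ => X p.2 p.1) 2 E.Q) :
    MemLp (fun p : Ω × ℝ => E.disc p.2 * X p.2 p.1) 2 E.Q := by
  refine MemLp.of_le hX
    ((continuous_disc.measurable.comp measurable_snd).aestronglyMeasurable.mul hX.1) ?_
  filter_upwards [ae_abs_disc_le] with p hp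
  rw [norm_mul]
  exact mul_le_of_le_one_left (norm_nonneg _) hp

/-- Integration by parts with discounting. -/
theorem WeakDrift.ibp_disc {u a : ℝ → Ω → ℝ} (h : E.WeakDrift u a) {v : ℝ → Ω → ℝ}
    (hv : IsOpt E.filtration v) (hv2 : MemLp (fun p : Ω × ℝ => v p.2 p.1) 2 E.Q) :
    ∫ p, E.disc p.2 * ((∫ s in (0 : ℝ)..p.2, v s p.1) * (a p.2 p.1 - E.r * u p.2 p.1) +
      v p.2 p.1 * u p.2 p.1) ∂E.Q = 0 := by
  have hT := E.T_pos.le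
  -- The test process is the derivative of the discounted primitive of `v`, so that its own
  -- primitive is that discounted primitive.
  obtain ⟨k, hk⟩ : ∃ k : ℝ → Ω → ℝ, k = fun t ω =>
    -E.r * E.disc t * (∫ s in (0 : ℝ)..t, v s ω) + E.disc t * v t ω := ⟨_, rfl⟩
  have hV := adm_integral hv hv2
  have hw := E.jointlyMeasurable_of_isOpt E.isOpt_disc
  have hkA : E.Adm k := by
    rw [hk]
    refine ⟨((hw.const_mul _).mul hV.jm).add (hw.mul (E.jointlyMeasurable_of_isOpt hv)),
      fun t => ?_, ?_⟩
    · exact ((hV.adapted t).const_mul _).add ((hv.adapted hT t).const_mul _)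
    · have h1 := (memLp_disc_mul (X := fun t ω => ∫ s in (0 : ℝ)..t, v s ω) hV.memLp).const_mul (-E.r)
      have h2 := h1.add (memLp_disc_mul hv2)
      refine h2.congr_norm ?_ ?_
      · exact (((hw.const_mul _).mul hV.jm).add
          (hw.mul (E.jointlyMeasurable_of_isOpt hv))).aestronglyMeasurable
      · exact ae_of_all _ fun p => by simp [mul_assoc]
  have hprim : ∀ᵐ p ∂E.Q, ∫ s in (0 : ℝ)..p.2, k s p.1 =
      E.disc p.2 * ∫ s in (0 : ℝ)..p.2, v s p.1 := by
    have h1 := ae_intervalIntegrable hv2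
    have h2 : ∀ᵐ p ∂E.Q, ∀ t ∈ Set.Icc 0 E.T,
      IntervalIntegrable (fun s => v s p.1) volume 0 t :=
      Measure.quasiMeasurePreserving_fst.ae h1
    filter_upwards [h2, ae_mem_Icc] with p hp hpm
    have h3 := integral_mul_primitive_add 1 0
      (Continuous.intervalIntegrable (continuous_const.mul continuous_disc) 0 p.2)
      (p := fun s => -E.r * E.disc s) (hp p.2 hpm)
    simp only [← disc_eq, zero_add, mul_zero, sub_zero] at h3
    rw [← h3, hk]
  refine Eq.trans (integral_congr_ae ?_) (h.ibp k hkA)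
  filter_upwards [hprim] with p hp
  rw [hp, hk]
  ring

end Economy

/-! ### Vector-valued processes: integrability classes, positions and decompositions. -/

namespace Economy

variable {d N : ℕ} {Ω : Type*} [mΩ : MeasurableSpace Ω] {P : Measure Ω} [IsProbabilityMeasure P]
  {E : Economy d N P}

theorem isOptional_iff {X : Proc d Ω} :
    E.IsOptional X ↔ ∀ i, IsOpt E.filtration fun t ω => X t ω i :=
  @measurable_pi_iff _ _ _ (optionalSigma E.filtration) _ _

theorem IsOptional.jointlyMeasurable {X : Proc d Ω} (hX : E.IsOptional X) :
    E.JointlyMeasurable X :=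
  Measurable.mono hX (optionalSigma_le E.T_pos.le) le_rfl

theorem JointlyMeasurable.aestronglyMeasurable_vec {X : Proc d Ω}
    (hX : E.JointlyMeasurable X) : AEStronglyMeasurable (fun p : Ω × ℝ => X p.2 p.1) E.Q := by
  refine hX.measurable_extend.aestronglyMeasurable.congr ?_
  filter_upwards [ae_mem_Icc] with p hp
  exact extend_eq E X hp p.1

/-- `MemH2` is stated with the Euclidean norm and an iterated integral. Norms on a
finite-dimensional space being equivalent, Tonelli allows working with the supremum norm and the
product measure instead; `memHInf_iff` serves the same purpose. -/
theorem memH2_iff {X : Proc d Ω} :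
    E.MemH2 X ↔ E.IsOptional X ∧ MemLp (fun p : Ω × ℝ => X p.2 p.1) 2 E.Q := by
  refine and_congr_right fun hX => ?_
  have hj := hX.jointlyMeasurable.aestronglyMeasurable_vec
  have hj2 : AEStronglyMeasurable (fun p : Ω × ℝ => WithLp.toLp 2 (X p.2 p.1)) E.Q :=
    (PiLp.continuous_toLp 2 _).comp_aestronglyMeasurable hj
  have h1 : MemLp (fun p : Ω × ℝ => X p.2 p.1) 2 E.Q ↔
      MemLp (fun p : Ω × ℝ => WithLp.toLp 2 (X p.2 p.1)) 2 E.Q := by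
    rw [memLp_pi_iff, memLp_piLp_iff]
  have h2 : MemLp (fun p : Ω × ℝ => WithLp.toLp 2 (X p.2 p.1)) 2 E.Q ↔
      ∫⁻ p, ‖WithLp.toLp 2 (X p.2 p.1)‖ₑ ^ 2 ∂E.Q < ∞ := by
    refine (and_iff_right hj2).trans ?_
    rw [eLpNorm_lt_top_iff_lintegral_rpow_enorm_lt_top two_ne_zero ENNReal.ofNat_ne_top]
    simp
  have h3 : ∫⁻ p, ‖WithLp.toLp 2 (X p.2 p.1)‖ₑ ^ 2 ∂E.Q =
      ∫⁻ ω, (∫⁻ t in Set.Icc (0 : ℝ) E.T, ‖WithLp.toLp 2 (X t ω)‖ₑ ^ 2) ∂P :=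
    lintegral_prod _ (hj2.enorm.pow_const 2)
  rw [h1, h2, h3]

theorem memHInf_iff {X : Proc d Ω} :
    E.MemHInf X ↔ E.IsOptional X ∧ ∃ C, ∀ᵐ p ∂E.Q, ‖X p.2 p.1‖ ≤ C := by
  refine and_congr_right fun hX => ?_
  have hS : ∀ C, (∀ᵐ p ∂E.Q, ‖X p.2 p.1‖ ≤ C) ↔
      ∀ᵐ ω ∂P, ∀ᵐ t ∂(volume.restrict (Set.Icc 0 E.T)), ‖X t ω‖ ≤ C := fun C =>
    hX.jointlyMeasurable.ae_iff (S := {x | ‖x‖ ≤ C})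
      (measurableSet_le continuous_norm.measurable measurable_const)
  simp only [hS]
  let L := PiLp.continuousLinearEquiv 2 ℝ (fun _ : Fin d => ℝ)
  constructor
  · rintro ⟨C, hC⟩
    refine ⟨‖L.toContinuousLinearMap‖ * C, ?_⟩
    filter_upwards [hC] with ω hω
    filter_upwards [hω] with t ht
    exact (L.toContinuousLinearMap.le_opNorm (WithLp.toLp 2 (X t ω))).trans
      (mul_le_mul_of_nonneg_left ht (norm_nonneg _))
  · rintro ⟨C, hC⟩
    refine ⟨‖L.symm.toContinuousLinearMap‖ * C, ?_⟩
    filter_upwards [hC] with ω hω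
    filter_upwards [hω] with t ht
    exact (L.symm.toContinuousLinearMap.le_opNorm (X t ω)).trans
      (mul_le_mul_of_nonneg_left ht (norm_nonneg _))

theorem aeEqual_iff {X Y : Proc d Ω} (hX : E.IsOptional X) (hY : E.IsOptional Y) :
    E.AEEqual X Y ↔ ∀ᵐ p ∂E.Q, X p.2 p.1 = Y p.2 p.1 := by
  have h := JointlyMeasurable.ae_iff (E := E) (X := fun t ω => X t ω - Y t ω)
    (Measurable.sub hX.jointlyMeasurable hY.jointlyMeasurable) (measurableSet_singleton 0)
  simp only [Set.mem_singleton_iff, sub_eq_zero] at h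
  exact h.symm

theorem MemHInf.memLp {X : Proc d Ω} (hX : E.MemHInf X) :
    MemLp (fun p : Ω × ℝ => X p.2 p.1) 2 E.Q := by
  obtain ⟨h1, C, hC⟩ := memHInf_iff.1 hX
  exact MemLp.of_bound h1.jointlyMeasurable.aestronglyMeasurable_vec C hC

theorem MemHInf.memH2 {X : Proc d Ω} (hX : E.MemHInf X) : E.MemH2 X :=
  memH2_iff.2 ⟨hX.1, hX.memLp⟩

theorem MemH2.memLp {X : Proc d Ω} (hX : E.MemH2 X) :
    MemLp (fun p : Ω × ℝ => X p.2 p.1) 2 E.Q := (memH2_iff.1 hX).2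

section Linear

variable {X Y : Proc d Ω}

theorem IsOptional.add (hX : E.IsOptional X) (hY : E.IsOptional Y) :
    E.IsOptional fun t ω => X t ω + Y t ω := Measurable.add hX hY

theorem IsOptional.sub (hX : E.IsOptional X) (hY : E.IsOptional Y) :
    E.IsOptional fun t ω => X t ω - Y t ω := Measurable.sub hX hY

theorem IsOptional.smul (hX : E.IsOptional X) (c : ℝ) :
    E.IsOptional fun t ω => c • X t ω := Measurable.const_smul hX c

theorem IsOptional.mulVec (hX : E.IsOptional X) (A : Matrix (Fin d) (Fin d) ℝ) :
    E.IsOptional fun t ω => A *ᵥ X t ω :=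
  (Continuous.matrix_mulVec continuous_const continuous_id).measurable.comp hX

theorem MemHInf.add (hX : E.MemHInf X) (hY : E.MemHInf Y) :
    E.MemHInf fun t ω => X t ω + Y t ω := by
  obtain ⟨h1, C, hC⟩ := memHInf_iff.1 hX
  obtain ⟨h2, D, hD⟩ := memHInf_iff.1 hY
  refine memHInf_iff.2 ⟨h1.add h2, C + D, ?_⟩
  filter_upwards [hC, hD] with p a b using (norm_add_le _ _).trans (add_le_add a b)

theorem MemHInf.mulVec (hX : E.MemHInf X) (A : Matrix (Fin d) (Fin d) ℝ) :
    E.MemHInf fun t ω => A *ᵥ X t ω := by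
  obtain ⟨h1, C, hC⟩ := memHInf_iff.1 hX
  let L : (Fin d → ℝ) →L[ℝ] (Fin d → ℝ) := LinearMap.toContinuousLinearMap A.mulVecLin
  refine memHInf_iff.2 ⟨h1.mulVec A, ‖L‖ * C, ?_⟩
  filter_upwards [hC] with p a
  exact (L.le_opNorm _).trans (mul_le_mul_of_nonneg_left a (norm_nonneg _))

theorem MemHInf.smul (hX : E.MemHInf X) (c : ℝ) : E.MemHInf fun t ω => c • X t ω := by
  have h := hX.mulVec (c • (1 : Matrix (Fin d) (Fin d) ℝ))
  simpa only [Matrix.smul_mulVec, Matrix.one_mulVec] using h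

theorem MemHInf.sub (hX : E.MemHInf X) (hY : E.MemHInf Y) :
    E.MemHInf fun t ω => X t ω - Y t ω := by
  have := hX.add (hY.smul (-1))
  simpa only [neg_smul, one_smul, ← sub_eq_add_neg] using this

theorem MemHInf.sum {ι : Type*} {s : Finset ι} {X : ι → Proc d Ω} (h : ∀ i ∈ s, E.MemHInf (X i)) :
    E.MemHInf fun t ω => ∑ i ∈ s, X i t ω := by
  classical
  induction s using Finset.induction_on with
  | empty =>
    simp only [Finset.sum_empty]
    exact memHInf_iff.2 ⟨measurable_const, 0, by simp⟩
  | insert i s hi ih =>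
    simp only [Finset.sum_insert hi]
    exact (h i (Finset.mem_insert_self i s)).add
      (ih fun j hj => h j (Finset.mem_insert_of_mem hj))

theorem MemH2.add (hX : E.MemH2 X) (hY : E.MemH2 Y) : E.MemH2 fun t ω => X t ω + Y t ω :=
  memH2_iff.2 ⟨hX.1.add hY.1, hX.memLp.add hY.memLp⟩

theorem MemH2.sub (hX : E.MemH2 X) (hY : E.MemH2 Y) : E.MemH2 fun t ω => X t ω - Y t ω :=
  memH2_iff.2 ⟨hX.1.sub hY.1, hX.memLp.sub hY.memLp⟩

theorem MemH2.mulVec (hX : E.MemH2 X) (A : Matrix (Fin d) (Fin d) ℝ) :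
    E.MemH2 fun t ω => A *ᵥ X t ω :=
  memH2_iff.2 ⟨hX.1.mulVec A,
    (LinearMap.toContinuousLinearMap A.mulVecLin).comp_memLp' hX.memLp⟩

theorem MemH2.smul (hX : E.MemH2 X) (c : ℝ) : E.MemH2 fun t ω => c • X t ω :=
  memH2_iff.2 ⟨hX.1.smul c, hX.memLp.const_smul c⟩

theorem MemH2.sum {ι : Type*} {s : Finset ι} {X : ι → Proc d Ω} (h : ∀ i ∈ s, E.MemH2 (X i)) :
    E.MemH2 fun t ω => ∑ i ∈ s, X i t ω := by
  classical
  induction s using Finset.induction_on with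
  | empty =>
    simp only [Finset.sum_empty]
    exact memH2_iff.2 ⟨measurable_const, MemLp.zero⟩
  | insert i s hi ih =>
    simp only [Finset.sum_insert hi]
    exact (h i (Finset.mem_insert_self i s)).add
      (ih fun j hj => h j (Finset.mem_insert_of_mem hj))

end Linear

/-- The discounted inner product of square-integrable processes is integrable. -/
theorem integrable_disc_dot {F G : Ω × ℝ → Fin d → ℝ} (hF : MemLp F 2 E.Q) (hG : MemLp G 2 E.Q) :
    Integrable (fun p => E.disc p.2 * (F p ⬝ᵥ G p)) E.Q := by
  have h : Integrable (fun p => F p ⬝ᵥ G p) E.Q := by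
    unfold dotProduct
    exact integrable_finsetSum _ fun i _ => (hF.eval i).integrable_mul (hG.eval i)
  exact h.bdd_mul (continuous_disc.measurable.comp measurable_snd).aestronglyMeasurable
    (ae_abs_disc_le (E := E))

theorem memLp_mulVec {F : Ω × ℝ → Fin d → ℝ} (hF : MemLp F 2 E.Q) (A : Matrix (Fin d) (Fin d) ℝ) :
    MemLp (fun p => A *ᵥ F p) 2 E.Q :=
  (LinearMap.toContinuousLinearMap A.mulVecLin).comp_memLp' hF

/-! ### Positions -/

/-- The position computed coordinate by coordinate. -/
def coordPosition (u : Proc d Ω) : Proc d Ω := fun t ω i => ∫ s in (0 : ℝ)..t, u s ω i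

/-- The Bochner integral of a vector path is `0` by convention as soon as one coordinate is not
integrable, so the two positions are only compared on the almost sure event where all coordinates
are. -/
theorem ae_position_eq {u : Proc d Ω} (hu : MemLp (fun p : Ω × ℝ => u p.2 p.1) 2 E.Q) :
    ∀ᵐ ω ∂P, ∀ t ∈ Set.Icc 0 E.T, position u t ω = coordPosition u t ω := by
  have h : ∀ᵐ ω ∂P, ∀ i, ∀ t ∈ Set.Icc 0 E.T,
      IntervalIntegrable (fun s => u s ω i) volume 0 t :=
    ae_all_iff.2 fun i => ae_intervalIntegrable (h := fun t ω => u t ω i) (hu.eval i)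
  filter_upwards [h] with ω hω t ht
  ext i
  simp only [position, coordPosition, intervalIntegral.integral_of_le ht.1]
  exact eval_integral (fun i => (hω i t ht).1) i

theorem memLp_coordPosition {u : Proc d Ω} (hu : E.MemH2 u) :
    MemLp (fun p : Ω × ℝ => coordPosition u p.2 p.1) 2 E.Q :=
  MemLp.of_eval fun i => memLp_integral
    (E.jointlyMeasurable_of_isOpt (isOptional_iff.1 hu.1 i)) (hu.memLp.eval i)

/-- A bounded rate leads to a bounded position. -/
theorem ae_norm_coordPosition_le {u : Proc d Ω} (hu : E.MemHInf u) :
    ∃ C, ∀ᵐ p ∂E.Q, ‖coordPosition u p.2 p.1‖ ≤ C := by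
  obtain ⟨h1, C, hC⟩ := memHInf_iff.1 hu
  have h2 : ∀ᵐ ω ∂P, ∀ᵐ t ∂(volume.restrict (Set.Icc 0 E.T)), ‖u t ω‖ ≤ C :=
    Measure.ae_ae_of_ae_prod hC
  have h3 : ∀ᵐ p ∂E.Q, ∀ᵐ t ∂(volume.restrict (Set.Icc 0 E.T)), ‖u t p.1‖ ≤ C :=
    Measure.quasiMeasurePreserving_fst.ae h2
  refine ⟨|C| * E.T, ?_⟩
  filter_upwards [h3, ae_mem_Icc] with p hp hm
  refine (pi_norm_le_iff_of_nonneg (mul_nonneg (abs_nonneg C) E.T_pos.le)).2 fun i => ?_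
  have h4 : ‖∫ s in (0 : ℝ)..p.2, u s p.1 i‖ ≤ |C| * |p.2 - 0| := by
    refine intervalIntegral.norm_integral_le_of_norm_le_const_ae ?_
    have := (ae_restrict_iff' measurableSet_Icc).1 hp
    filter_upwards [this] with s hs hst
    rw [Set.uIoc_of_le hm.1] at hst
    exact ((norm_le_pi_norm _ i).trans (hs ⟨hst.1.le, hst.2.trans hm.2⟩)).trans (le_abs_self C)
  refine h4.trans (mul_le_mul_of_nonneg_left ?_ (abs_nonneg C))
  rw [sub_zero, abs_of_nonneg hm.1]
  exact hm.2

/-! ### Semimartingale decompositions -/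

variable (E) in
/-- Coordinatewise version of `Economy.WeakDrift`. -/
def VecDrift (u a : Proc d Ω) : Prop :=
  ∀ i, E.WeakDrift (fun t ω => u t ω i) (fun t ω => a t ω i)

theorem vecDrift_of_isDrift {u a : Proc d Ω} (h : E.IsDrift u a) : E.VecDrift u a := by
  obtain ⟨M, hM⟩ := h
  intro i
  obtain ⟨ha, C, hC⟩ := memHInf_iff.1 hM.drift_mem
  obtain ⟨hMo, K, hK⟩ := memHInf_iff.1 hM.mart_mem
  have hC' : ∀ᵐ ω ∂P, ∀ᵐ t ∂(volume.restrict (Set.Icc 0 E.T)), ‖a t ω‖ ≤ C :=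
    Measure.ae_ae_of_ae_prod hC
  have hK' : ∀ᵐ ω ∂P, ∀ᵐ t ∂(volume.restrict (Set.Icc 0 E.T)), ‖M t ω‖ ≤ K :=
    Measure.ae_ae_of_ae_prod hK
  have hCi : ∀ j, ∀ᵐ ω ∂P, ∀ᵐ t ∂(volume.restrict (Set.Icc 0 E.T)), |a t ω j| ≤ C := fun j => by
    filter_upwards [hC'] with ω hω
    filter_upwards [hω] with t ht using (norm_le_pi_norm _ j).trans ht
  have hKi : ∀ᵐ ω ∂P, ∀ᵐ t ∂(volume.restrict (Set.Icc 0 E.T)), |M t ω i| ≤ K := by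
    filter_upwards [hK'] with ω hω
    filter_upwards [hω] with t ht using (norm_le_pi_norm _ i).trans ht
  refine weakDrift_of_decomposition (M := fun t ω => M t ω i) (isOptional_iff.1 hM.optional i)
    (isOptional_iff.1 ha i) (hCi i) ?_ ?_ hKi ?_ ?_
  · refine ⟨fun t => ?_, fun s t hst => ?_⟩
    · exact (continuous_apply i).comp_stronglyMeasurable (hM.martingale.1 t)
    · have h1 := hM.martingale.2 s t hst
      have h2 := (ContinuousLinearMap.proj (R := ℝ) (φ := fun _ : Fin d => ℝ) i).comp_condExp_comm
        (m := E.filtration s) (hM.martingale.integrable t)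
      filter_upwards [h1, h2] with ω a b
      refine Eq.trans b.symm ?_
      simp only [Function.comp_apply, ContinuousLinearMap.proj_apply, a]
  · filter_upwards [hM.continuous] with ω hω
    exact (continuous_apply i).comp_continuousOn hω
  · filter_upwards [hM.eq, ae_all_iff.2 hCi] with ω hω hai t ht
    have hint : ∀ j, IntervalIntegrable (fun s => a s ω j) volume 0 t := fun j =>
      (isOptional_iff.1 ha j).intervalIntegrable_of_bound E.T_pos.le (hai j)
        ⟨le_rfl, E.T_pos.le⟩ ht
    have h1 : (∫ s in (0 : ℝ)..t, a s ω) i = ∫ s in (0 : ℝ)..t, a s ω i := by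
      simp only [intervalIntegral.integral_of_le ht.1]
      exact eval_integral (fun j => (hint j).1) i
    rw [hω t ht]
    simp only [Pi.add_apply, Pi.sub_apply, h1]
  · filter_upwards [hM.terminal] with ω hω
    rw [hω, Pi.zero_apply]

/-- Semimartingale decompositions with bounded parts can be built coordinate by coordinate. -/
theorem isDrift_of_coordinates {u a : Proc d Ω}
    (h : ∀ i, ∃ (M : ℝ → Ω → ℝ) (C K : ℝ), IsOpt E.filtration (fun t ω => u t ω i) ∧
      IsOpt E.filtration (fun t ω => a t ω i) ∧
      (∀ t ∈ Set.Icc 0 E.T, ∀ ω, |a t ω i| ≤ C) ∧ (∀ t ∈ Set.Icc 0 E.T, ∀ ω, |M t ω| ≤ K) ∧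
      Martingale (fun (t : Set.Icc (0 : ℝ) E.T) ω => M t ω) E.filtration P ∧
      (∀ ω, ContinuousOn (fun t => M t ω) (Set.Icc 0 E.T)) ∧
      (∀ ω, ∀ t ∈ Set.Icc 0 E.T,
        u t ω i = u 0 ω i + (∫ s in (0 : ℝ)..t, a s ω i) + (M t ω - M 0 ω)) ∧
      ∀ᵐ ω ∂P, u E.T ω i = 0) : E.IsDrift u a := by
  choose M C K hu ha hC hK hM hMc heq hterm using h
  have hbd : ∀ {X : Proc d Ω} {D : Fin d → ℝ}, (∀ i, ∀ t ∈ Set.Icc 0 E.T, ∀ ω, |X t ω i| ≤ D i) →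
      ∃ D, ∀ᵐ p ∂E.Q, ‖X p.2 p.1‖ ≤ D := fun {X D} h => by
    refine ⟨∑ i, |D i|, ?_⟩
    filter_upwards [ae_mem_Icc] with p hp
    refine (pi_norm_le_iff_of_nonneg (Finset.sum_nonneg fun i _ => abs_nonneg _)).2 fun i => ?_
    exact ((h i p.2 hp p.1).trans (le_abs_self _)).trans
      (Finset.single_le_sum (f := fun i => |D i|) (fun i _ => abs_nonneg _) (Finset.mem_univ i))
  have hmeas : ∀ i (t : Set.Icc (0 : ℝ) E.T), Measurable[E.filtration t] (M i t) :=
    fun i t => ((hM i).1 t).measurable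
  refine ⟨fun t ω i => M i t ω, ⟨isOptional_iff.2 hu, memHInf_iff.2 ⟨isOptional_iff.2 ha, hbd hC⟩,
    memHInf_iff.2 ⟨isOptional_iff.2 fun i => isOpt_of_continuousOn (hmeas i) (hMc i), hbd hK⟩,
    ⟨fun t => ?_, fun s t hst => ?_⟩, ae_of_all _ fun ω => continuousOn_pi.2 fun i => hMc i ω,
    ae_of_all _ fun ω t ht => ?_, ?_⟩⟩
  · exact (@measurable_pi_lambda _ _ _ (E.filtration t) _ _ fun i => hmeas i t).stronglyMeasurable
  · have hint : Integrable (fun ω i => M i t ω) P := Integrable.of_eval fun i => (hM i).integrable t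
    have h1 : ∀ᵐ ω ∂P, ∀ i, (P[fun ω i => M i t ω | E.filtration s]) ω i = M i s ω := by
      refine ae_all_iff.2 fun i => ?_
      have h2 := (ContinuousLinearMap.proj (R := ℝ) (φ := fun _ : Fin d => ℝ) i).comp_condExp_comm
        (m := E.filtration s) hint
      filter_upwards [h2, (hM i).2 s t hst] with ω a b
      refine Eq.trans ?_ b
      exact a
    filter_upwards [h1] with ω hω
    exact funext hω
  · ext i
    have hint : ∀ j, IntervalIntegrable (fun s => a s ω j) volume 0 t := fun j =>
      (ha j).intervalIntegrable_of_bound E.T_pos.le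
        ((ae_restrict_mem measurableSet_Icc).mono fun t ht => hC j t ht ω)
        ⟨le_rfl, E.T_pos.le⟩ ht
    have h1 : (∫ s in (0 : ℝ)..t, a s ω) i = ∫ s in (0 : ℝ)..t, a s ω i := by
      simp only [intervalIntegral.integral_of_le ht.1]
      exact eval_integral (fun j => (hint j).1) i
    simp only [Pi.add_apply, Pi.sub_apply, h1]
    exact heq i ω t ht
  · filter_upwards [ae_all_iff.2 hterm] with ω hω
    exact funext hω

namespace VecDrift

variable {u a : Proc d Ω}

theorem isOptional (h : E.VecDrift u a) : E.IsOptional u := isOptional_iff.2 fun i => (h i).opt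

theorem memLp (h : E.VecDrift u a) : MemLp (fun p : Ω × ℝ => u p.2 p.1) 2 E.Q :=
  MemLp.of_eval fun i => (h i).memLp

theorem memH2 (h : E.VecDrift u a) : E.MemH2 u := memH2_iff.2 ⟨h.isOptional, h.memLp⟩

theorem memHInf (h : E.VecDrift u a) : E.MemHInf u := by
  refine memHInf_iff.2 ⟨h.isOptional, ?_⟩
  choose C hC using fun i => (h i).bdd
  refine ⟨∑ i, |C i|, ?_⟩
  filter_upwards [ae_all_iff.2 hC] with p hp
  refine (pi_norm_le_iff_of_nonneg (Finset.sum_nonneg fun i _ => abs_nonneg _)).2 fun i => ?_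
  exact ((hp i).trans (le_abs_self _)).trans
    (Finset.single_le_sum (f := fun i => |C i|) (fun i _ => abs_nonneg _) (Finset.mem_univ i))

end VecDrift

theorem isDrift_memHInf {u a : Proc d Ω} (h : E.IsDrift u a) : E.MemHInf a :=
  h.choose_spec.drift_mem

end Economy

/-! ### Completing the square for frictionless objectives. -/

section Algebra

variable {ι : Type*} [Fintype ι] {A : Matrix ι ι ℝ}

theorem dotProduct_mulVec_symm (hA : Aᵀ = A) (x y : ι → ℝ) : x ⬝ᵥ A *ᵥ y = y ⬝ᵥ A *ᵥ x := by
  rw [dotProduct_mulVec, ← mulVec_transpose, hA, dotProduct_comm]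

/-- The returns are written so that `y` is the critical point; the terms linear in `x - y` then
cancel. -/
theorem quad_priceTaker (hA : Aᵀ = A) (k : ℝ) (x y z : ι → ℝ) :
    x ⬝ᵥ ((2 * k) • A *ᵥ (y + z)) - k * ((x + z) ⬝ᵥ A *ᵥ (x + z)) =
      (y ⬝ᵥ ((2 * k) • A *ᵥ (y + z)) - k * ((y + z) ⬝ᵥ A *ᵥ (y + z))) -
        k * ((x - y) ⬝ᵥ A *ᵥ (x - y)) := by
  simp only [mulVec_add, mulVec_sub, dotProduct_add, dotProduct_sub, add_dotProduct,
    sub_dotProduct, dotProduct_smul, smul_eq_mul]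
  linear_combination k * dotProduct_mulVec_symm hA x y + k * dotProduct_mulVec_symm hA x z
    - k * dotProduct_mulVec_symm hA y z

/-- Here the returns `k A (b - x)` react to the demand `x`, which raises the curvature from `c` to
`k + c`. Condition `hy` is the first order condition at `y`, with `A` removed. -/
theorem quad_strategic (hA : Aᵀ = A) {k c : ℝ} {x y z b : ι → ℝ}
    (hy : k • b = (2 * k + 2 * c) • y + (2 * c) • z) :
    x ⬝ᵥ (k • A *ᵥ (b - x)) - c * ((x + z) ⬝ᵥ A *ᵥ (x + z)) =
      (y ⬝ᵥ (k • A *ᵥ (b - y)) - c * ((y + z) ⬝ᵥ A *ᵥ (y + z))) -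
        (k + c) * ((x - y) ⬝ᵥ A *ᵥ (x - y)) := by
  have h : ∀ x : ι → ℝ, k * (x ⬝ᵥ A *ᵥ b) =
      (2 * k + 2 * c) * (x ⬝ᵥ A *ᵥ y) + 2 * c * (x ⬝ᵥ A *ᵥ z) := fun x => by
    have h1 := congrArg (fun v => x ⬝ᵥ A *ᵥ v) hy
    simpa only [mulVec_smul, mulVec_add, dotProduct_add, dotProduct_smul, smul_eq_mul] using h1
  simp only [mulVec_add, mulVec_sub, dotProduct_add, dotProduct_sub, add_dotProduct,
    sub_dotProduct, dotProduct_smul, smul_eq_mul]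
  linear_combination h x - h y + (k + c) * dotProduct_mulVec_symm hA x y
    + c * dotProduct_mulVec_symm hA x z - c * dotProduct_mulVec_symm hA y z

end Algebra

/-! ### Equilibrium without transaction costs. -/

namespace Economy

variable {d N : ℕ} {Ω : Type*} [mΩ : MeasurableSpace Ω] {P : Measure Ω} [IsProbabilityMeasure P]
  {E : Economy d N P}

theorem cov_transpose : E.covᵀ = E.cov := by simp [cov, transpose_mul]

theorem cov_isUnit_det : IsUnit E.cov.det := E.cov_posDef.det_pos.ne'.isUnit

theorem cov_pos {x : Fin d → ℝ} (hx : x ≠ 0) : 0 < x ⬝ᵥ E.cov *ᵥ x := by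
  simpa [cov] using E.cov_posDef.dotProduct_mulVec_pos hx

theorem cov_nonneg (x : Fin d → ℝ) : 0 ≤ x ⬝ᵥ E.cov *ᵥ x := by
  by_cases hx : x = 0
  · simp [hx]
  · exact (cov_pos hx).le

theorem cov_mulVec_inv (x : Fin d → ℝ) : E.cov *ᵥ E.cov⁻¹ *ᵥ x = x := by
  rw [mulVec_mulVec, Matrix.mul_nonsing_inv _ cov_isUnit_det, one_mulVec]

theorem cov_inv_mulVec (x : Fin d → ℝ) : E.cov⁻¹ *ᵥ E.cov *ᵥ x = x := by
  rw [mulVec_mulVec, Matrix.nonsing_inv_mul _ cov_isUnit_det, one_mulVec]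

/-- The discounted covariance of a process is nonnegative. -/
theorem integral_disc_cov_nonneg {c : ℝ} (hc : 0 ≤ c) (F : Ω × ℝ → Fin d → ℝ) :
    0 ≤ ∫ p, E.disc p.2 * (c * (F p ⬝ᵥ E.cov *ᵥ F p)) ∂E.Q :=
  integral_nonneg fun _ => mul_nonneg (disc_pos _).le (mul_nonneg hc (cov_nonneg _))

theorem integrable_disc_quad {F : Ω × ℝ → Fin d → ℝ} (hF : MemLp F 2 E.Q)
    (A : Matrix (Fin d) (Fin d) ℝ) (c : ℝ) :
    Integrable (fun p => E.disc p.2 * (c * (F p ⬝ᵥ A *ᵥ F p))) E.Q := by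
  have := (integrable_disc_dot hF (memLp_mulVec hF A)).const_mul c
  refine this.congr (ae_of_all _ fun p => ?_)
  simp only
  ring

theorem integrable_disc_cov {F : Ω × ℝ → Fin d → ℝ} (hF : MemLp F 2 E.Q) (c : ℝ) :
    Integrable (fun p => E.disc p.2 * (c * (F p ⬝ᵥ E.cov *ᵥ F p))) E.Q :=
  integrable_disc_quad hF E.cov c

theorem ae_eq_zero_of_integral_disc_cov {c : ℝ} (hc : 0 < c) {F : Ω × ℝ → Fin d → ℝ}
    (hF : MemLp F 2 E.Q) (h : ∫ p, E.disc p.2 * (c * (F p ⬝ᵥ E.cov *ᵥ F p)) ∂E.Q ≤ 0) :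
    ∀ᵐ p ∂E.Q, F p = 0 := by
  have h0 := le_antisymm h (integral_disc_cov_nonneg hc.le F)
  rw [integral_eq_zero_iff_of_nonneg
    (fun _ => mul_nonneg (disc_pos _).le (mul_nonneg hc.le (cov_nonneg _)))
    (integrable_disc_cov hF c)] at h0
  filter_upwards [h0] with p hp
  by_contra hne
  exact (mul_pos (disc_pos (E := E) p.2) (mul_pos hc (cov_pos (E := E) hne))).ne' hp

/-- The integrand of the objective of investor `m` without transaction costs. -/
def payoff (E : Economy d N P) (m : Fin N) (x ν z : Fin d → ℝ) : ℝ :=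
  x ⬝ᵥ ν - 1 / (2 * E.δ m) * ((x + z) ⬝ᵥ E.cov *ᵥ (x + z))

theorem integrable_payoff {m : Fin N} {F G Z : Ω × ℝ → Fin d → ℝ} (hF : MemLp F 2 E.Q)
    (hG : MemLp G 2 E.Q) (hZ : MemLp Z 2 E.Q) :
    Integrable (fun p => E.disc p.2 * E.payoff m (F p) (G p) (Z p)) E.Q := by
  have h1 := integrable_disc_dot hF hG
  have h2 := integrable_disc_cov (hF.add hZ) (1 / (2 * E.δ m))
  refine (h1.sub h2).congr (ae_of_all _ fun p => ?_)
  simp only [payoff, Pi.add_apply, Pi.sub_apply]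
  ring

theorem objective_eq {m : Fin N} {ν φ : Proc d Ω} (hζ : E.MemH2 (E.ζ m)) (hν : E.MemH2 ν)
    (hφ : E.MemH2 φ) : E.objective m ν φ =
      ∫ p, E.disc p.2 * E.payoff m (φ p.2 p.1) (ν p.2 p.1) (E.ζ m p.2 p.1) ∂E.Q :=
  (integral_Q (F := fun t ω => E.disc t * E.payoff m (φ t ω) (ν t ω) (E.ζ m t ω))
    (integrable_payoff hφ.memLp hν.memLp hζ.memLp)).symm

/-- The optimal demand of a price taker. -/
def takerDemand (E : Economy d N P) (m : Fin N) (ν : Proc d Ω) : Proc d Ω := fun t ω =>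
  E.δ m • (E.cov⁻¹ *ᵥ ν t ω) - E.ζ m t ω

theorem memH2_takerDemand {m : Fin N} {ν : Proc d Ω} (hζ : E.MemH2 (E.ζ m)) (hν : E.MemH2 ν) :
    E.MemH2 (E.takerDemand m ν) := ((hν.mulVec _).smul _).sub hζ

/-- An exact gap rather than an inequality: it gives optimality of `takerDemand` and, by
definiteness of the covariance, uniqueness. -/
theorem objective_gap {m : Fin N} {ν φ : Proc d Ω} (hζ : E.MemH2 (E.ζ m)) (hν : E.MemH2 ν)
    (hφ : E.MemH2 φ) : E.objective m ν φ = E.objective m ν (E.takerDemand m ν) -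
      ∫ p, E.disc p.2 * (1 / (2 * E.δ m) * ((φ p.2 p.1 - E.takerDemand m ν p.2 p.1) ⬝ᵥ
        E.cov *ᵥ (φ p.2 p.1 - E.takerDemand m ν p.2 p.1))) ∂E.Q := by
  have hd := memH2_takerDemand hζ hν
  rw [objective_eq hζ hν hφ, objective_eq hζ hν hd, ← integral_sub
    (integrable_payoff hd.memLp hν.memLp hζ.memLp) (integrable_disc_cov
      (F := fun p => φ p.2 p.1 - E.takerDemand m ν p.2 p.1) (hφ.memLp.sub hd.memLp) _)]
  refine integral_congr_ae (ae_of_all _ fun p => ?_)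
  have hδ := (E.δ_pos m).ne'
  have hν' : ν p.2 p.1 =
      (2 * (1 / (2 * E.δ m))) • E.cov *ᵥ (E.takerDemand m ν p.2 p.1 + E.ζ m p.2 p.1) := by
    rw [takerDemand, sub_add_cancel, mulVec_smul, cov_mulVec_inv, smul_smul]
    rw [show 2 * (1 / (2 * E.δ m)) * E.δ m = 1 by field_simp, one_smul]
  have := quad_priceTaker (cov_transpose (E := E)) (1 / (2 * E.δ m)) (φ p.2 p.1)
    (E.takerDemand m ν p.2 p.1) (E.ζ m p.2 p.1)
  rw [← hν'] at this
  simp only [payoff, this]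
  ring

theorem isOptimal_takerDemand {m : Fin N} {ν : Proc d Ω} (hζ : E.MemH2 (E.ζ m))
    (hν : E.MemH2 ν) : E.IsOptimal m ν (E.takerDemand m ν) := by
  refine ⟨memH2_takerDemand hζ hν, fun θ hθ => ?_⟩
  rw [objective_gap hζ hν hθ]
  have hδ := E.δ_pos m
  have := integral_disc_cov_nonneg (E := E) (c := 1 / (2 * E.δ m)) (by positivity)
    fun p => θ p.2 p.1 - E.takerDemand m ν p.2 p.1
  linarith

theorem IsOptimal.ae_eq {m : Fin N} {ν φ : Proc d Ω} (h : E.IsOptimal m ν φ)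
    (hζ : E.MemH2 (E.ζ m)) (hν : E.MemH2 ν) :
    ∀ᵐ p ∂E.Q, φ p.2 p.1 = E.takerDemand m ν p.2 p.1 := by
  have hd := memH2_takerDemand hζ hν
  have h1 := h.2 _ hd
  rw [objective_gap hζ hν h.1] at h1
  have hδ := E.δ_pos m
  have h2 := ae_eq_zero_of_integral_disc_cov (c := 1 / (2 * E.δ m)) (by positivity)
    (F := fun p => φ p.2 p.1 - E.takerDemand m ν p.2 p.1) (h.1.memLp.sub hd.memLp) (by linarith)
  filter_upwards [h2] with p hp using sub_eq_zero.1 hp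

/-- The aggregate risk tolerance of the investors other than `n`. -/
def δwithout (E : Economy d N P) (n : Fin N) : ℝ := ∑ m ∈ Finset.univ.erase n, E.δ m

/-- The residual exposure faced by investor `n`. -/
def residual (E : Economy d N P) (n : Fin N) : Proc d Ω := fun t ω =>
  (∑ m ∈ Finset.univ.erase n, E.ζ m t ω) - E.ψ t ω

/-- The returns that clear the market against the demand `φ` of investor `n`. -/
def clearingReturn (E : Economy d N P) (n : Fin N) (φ : Proc d Ω) : Proc d Ω := fun t ω =>
  (1 / E.δwithout n) • E.cov *ᵥ (E.residual n t ω - φ t ω)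

theorem δwithout_pos (hN : 2 ≤ N) (n : Fin N) : 0 < E.δwithout n := by
  refine Finset.sum_pos (fun m _ => E.δ_pos m) ?_
  rw [← Finset.card_pos, Finset.card_erase_of_mem (Finset.mem_univ n), Finset.card_univ,
    Fintype.card_fin]
  omega

section Frictionless

variable (hN : 2 ≤ N) (hζ : ∀ m, E.MemH2 (E.ζ m)) (hψ : E.MemH2 E.ψ) (n : Fin N)
include hN hζ hψ

theorem memH2_residual : E.MemH2 (E.residual n) := (MemH2.sum fun m _ => hζ m).sub hψ

theorem memH2_clearingReturn {φ : Proc d Ω} (hφ : E.MemH2 φ) : E.MemH2 (E.clearingReturn n φ) :=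
  (((memH2_residual hN hζ hψ n).sub hφ).mulVec _).smul _

theorem clears_clearingReturn {φ : Proc d Ω} (hφ : E.MemH2 φ) :
    E.Clears n φ (E.clearingReturn n φ) := by
  have hν := memH2_clearingReturn hN hζ hψ n hφ
  refine ⟨hν, fun m => E.takerDemand m (E.clearingReturn n φ),
    fun m _ => isOptimal_takerDemand (hζ m) hν, ae_of_all _ fun ω => ae_of_all _ fun t => ?_⟩
  have hδ := (δwithout_pos (E := E) hN n).ne'
  simp only [takerDemand, Finset.sum_sub_distrib, ← Finset.sum_smul, clearingReturn, mulVec_smul,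
    cov_inv_mulVec, smul_smul]
  rw [← Finset.sum_mul, show (∑ m ∈ Finset.univ.erase n, E.δ m) = E.δwithout n from rfl, mul_one_div_cancel hδ,
    one_smul, residual]
  abel

/-- Takers together demand `δwithout • Σ⁻¹ ν` minus their exposures, so the clearing condition can
be solved for `ν`. Hence any two price impacts agree almost everywhere at each demand. -/
theorem Clears.ae_eq {φ ν : Proc d Ω} (hφ : E.MemH2 φ) (h : E.Clears n φ ν) :
    ∀ᵐ p ∂E.Q, ν p.2 p.1 = E.clearingReturn n φ p.2 p.1 := by
  obtain ⟨hν, θ, hθ, hc⟩ := h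
  have h1 : ∀ᵐ p ∂E.Q, ∀ m, m ≠ n → θ m p.2 p.1 = E.takerDemand m ν p.2 p.1 :=
    ae_all_iff.2 fun m => by
      by_cases hm : m = n
      · exact ae_of_all _ fun _ h => absurd hm h
      · filter_upwards [(hθ m hm).ae_eq (hζ m) hν] with p hp _ using hp
  have hsum : E.MemH2 fun t ω => ∑ m ∈ Finset.univ.erase n, θ m t ω :=
    MemH2.sum fun m hm => (hθ m (Finset.ne_of_mem_erase hm)).1
  have h2 := (aeEqual_iff (X := fun t ω => φ t ω + (∑ m ∈ Finset.univ.erase n, θ m t ω) + E.ψ t ω)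
    (Y := fun _ _ => 0) ((hφ.add hsum).add hψ).1 measurable_const).1 hc
  have hδ := (δwithout_pos (E := E) hN n).ne'
  filter_upwards [h1, h2] with p hp hp2
  rw [Finset.sum_congr rfl fun m hm => hp m (Finset.ne_of_mem_erase hm)] at hp2
  simp only [takerDemand, Finset.sum_sub_distrib, ← Finset.sum_smul] at hp2
  have h3 : E.δwithout n • (E.cov⁻¹ *ᵥ ν p.2 p.1) = E.residual n p.2 p.1 - φ p.2 p.1 := by
    simp only [δwithout, residual]
    rw [← sub_eq_zero, ← hp2]
    abel
  simp only [clearingReturn, ← h3, mulVec_smul, cov_mulVec_inv, smul_smul]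
  rw [one_div_mul_cancel hδ, one_smul]

/-- The demand of the strategic investor. -/
def strategicDemand (E : Economy d N P) (n : Fin N) : Proc d Ω := fun t ω =>
  (1 / (2 * (1 / E.δwithout n) + 1 / E.δ n)) •
    ((1 / E.δwithout n) • E.residual n t ω - (1 / E.δ n) • E.ζ n t ω)

theorem memH2_strategicDemand : E.MemH2 (E.strategicDemand n) :=
  (((memH2_residual hN hζ hψ n).smul _).sub ((hζ n).smul _)).smul _

omit hζ hψ in
-- Both sides are combinations of `Σ residual` and `Σ ζ n`, which leaves an identity of rational
-- functions in the two tolerances `δwithout n` and `δ n`.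
theorem clearingReturn_strategicDemand :
    E.clearingReturn n (E.strategicDemand n) = E.μstrategic n := by
  have h1 := δwithout_pos (E := E) hN n
  have h2 := E.δ_pos n
  have hδ : E.δtot = E.δ n + E.δwithout n :=
    (Finset.add_sum_erase _ _ (Finset.mem_univ n)).symm
  funext t ω
  have hζs : ∑ m, E.ζ m t ω = E.ζ n t ω + ∑ m ∈ Finset.univ.erase n, E.ζ m t ω :=
    (Finset.add_sum_erase _ _ (Finset.mem_univ n)).symm
  have hres : (∑ m, E.ζ m t ω) - E.ψ t ω = E.ζ n t ω + E.residual n t ω := by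
    rw [hζs, residual]; abel
  have hlam : E.relTol n = E.δ n / (E.δ n + E.δwithout n) := by rw [relTol, hδ]
  simp only [clearingReturn, strategicDemand, μstrategic, μwithout, μcomp, hres]
  change _ = (E.relTol n / (E.relTol n + 1)) • ((1 / E.δwithout n) • (E.cov *ᵥ E.residual n t ω)) + _
  rw [hlam, hδ]
  generalize E.δwithout n = a at *
  generalize E.δ n = b at *
  simp only [mulVec_add, mulVec_sub, mulVec_smul]
  ext i
  simp only [Pi.add_apply, Pi.sub_apply, Pi.smul_apply, smul_eq_mul]
  field_simp
  ring

/-- Clearing returns being essentially unique, the formula holds for every price impact. The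
coefficient adds the price impact `1 / δwithout` to the risk aversion `1 / (2 δ n)`. -/
theorem strategic_gap {θ ν ν' : Proc d Ω} (hθ : E.MemH2 θ) (h : E.Clears n θ ν)
    (h' : E.Clears n (E.strategicDemand n) ν') :
    E.objective n ν θ = E.objective n ν' (E.strategicDemand n) -
      ∫ p, E.disc p.2 * ((1 / E.δwithout n + 1 / (2 * E.δ n)) *
        ((θ p.2 p.1 - E.strategicDemand n p.2 p.1) ⬝ᵥ
        E.cov *ᵥ (θ p.2 p.1 - E.strategicDemand n p.2 p.1))) ∂E.Q := by
  have hs := memH2_strategicDemand hN hζ hψ n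
  rw [objective_eq (hζ n) h.1 hθ, objective_eq (hζ n) h'.1 hs, ← integral_sub
    (integrable_payoff hs.memLp h'.1.memLp (hζ n).memLp)
    (integrable_disc_cov (F := fun p => θ p.2 p.1 - E.strategicDemand n p.2 p.1)
      (hθ.memLp.sub hs.memLp) _)]
  refine integral_congr_ae ?_
  have h1 := δwithout_pos (E := E) hN n
  have h2 := E.δ_pos n
  filter_upwards [h.ae_eq hN hζ hψ n hθ, h'.ae_eq hN hζ hψ n hs] with p hp hp'
  have hy : (1 / E.δwithout n) • E.residual n p.2 p.1 =
      (2 * (1 / E.δwithout n) + 2 * (1 / (2 * E.δ n))) • E.strategicDemand n p.2 p.1 +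
      (2 * (1 / (2 * E.δ n))) • E.ζ n p.2 p.1 := by
    have e1 : 2 * (1 / (2 * E.δ n)) = 1 / E.δ n := by field_simp
    rw [e1, strategicDemand, smul_smul, mul_one_div_cancel (by positivity), one_smul]
    abel
  have := quad_strategic (cov_transpose (E := E)) hy (x := θ p.2 p.1)
  simp only [payoff, hp, hp', clearingReturn]
  rw [this]
  ring

theorem isEquilibrium_μstrategic : E.IsEquilibrium n (E.μstrategic n) := by
  have hs := memH2_strategicDemand hN hζ hψ n
  have hcl : ∀ θ, E.MemH2 θ → E.Clears n θ (E.clearingReturn n θ) :=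
    fun θ hθ => clears_clearingReturn hN hζ hψ n hθ
  refine ⟨E.clearingReturn n, E.strategicDemand n, hcl, hs, fun θ hθ => ?_,
    (clearingReturn_strategicDemand hN n).symm⟩
  rw [strategic_gap hN hζ hψ n hθ (hcl θ hθ) (hcl _ hs)]
  have h1 := δwithout_pos (E := E) hN n
  have h2 := E.δ_pos n
  have := integral_disc_cov_nonneg (E := E) (c := 1 / E.δwithout n + 1 / (2 * E.δ n))
    (by positivity) fun p => θ p.2 p.1 - E.strategicDemand n p.2 p.1
  linarith

theorem isEquilibrium_unique {ν : Proc d Ω} (h : E.IsEquilibrium n ν) :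
    E.AEEqual ν (E.μstrategic n) := by
  obtain ⟨imp, φ, hcl, hφ, hopt, rfl⟩ := h
  have hs := memH2_strategicDemand hN hζ hψ n
  have h0 := hopt _ hs
  rw [strategic_gap hN hζ hψ n hφ (hcl φ hφ) (hcl _ hs)] at h0
  have h1 := δwithout_pos (E := E) hN n
  have h2 := E.δ_pos n
  have h3 := ae_eq_zero_of_integral_disc_cov (c := 1 / E.δwithout n + 1 / (2 * E.δ n))
    (by positivity) (F := fun p => φ p.2 p.1 - E.strategicDemand n p.2 p.1)
    (hφ.memLp.sub hs.memLp) (by linarith)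
  rw [← clearingReturn_strategicDemand hN n,
    aeEqual_iff (hcl φ hφ).1.1 (memH2_clearingReturn hN hζ hψ n hs).1]
  filter_upwards [h3, (hcl φ hφ).ae_eq hN hζ hψ n hφ] with p hp hp'
  rw [hp', clearingReturn, clearingReturn, sub_eq_zero.1 hp]

end Frictionless

end Economy

/-! ### Solvability of the vector forward-backward system. -/

/-- A positive definite matrix is diagonalized relative to a positive diagonal matrix. -/
theorem exists_relative_diagonalization {ι : Type*} [Fintype ι] [DecidableEq ι] {c : ι → ℝ}
    (hc : ∀ i, 0 < c i) {S : Matrix ι ι ℝ} (hS : S.PosDef) :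
    ∃ (R R' : Matrix ι ι ℝ) (l : ι → ℝ), R * R' = 1 ∧ (∀ i, 0 < l i) ∧
      S * R = diagonal c * R * diagonal l := by
  -- With `D` the inverse square root of the cost matrix, `D S D` is diagonalized by a unitary `U`,
  -- and `R = D U` is the required change of variables.
  obtain ⟨D, hD⟩ : ∃ D : Matrix ι ι ℝ, D = diagonal fun i => (√(c i))⁻¹ := ⟨_, rfl⟩
  obtain ⟨D', hD'⟩ : ∃ D' : Matrix ι ι ℝ, D' = diagonal fun i => √(c i) := ⟨_, rfl⟩
  have hs : ∀ i, √(c i) ≠ 0 := fun i => (Real.sqrt_pos.2 (hc i)).ne'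
  have h1 : D * D' = 1 := by
    rw [hD, hD', diagonal_mul_diagonal, ← diagonal_one]
    exact congrArg _ (funext fun i => inv_mul_cancel₀ (hs i))
  have h2 : D' * D = 1 := by
    rw [hD, hD', diagonal_mul_diagonal, ← diagonal_one]
    exact congrArg _ (funext fun i => mul_inv_cancel₀ (hs i))
  have h3 : D' * D' = diagonal c := by
    rw [hD', diagonal_mul_diagonal]
    exact congrArg _ (funext fun i => Real.mul_self_sqrt (hc i).le)
  have hDt : Dᴴ = D := by
    rw [hD, diagonal_conjTranspose]
    simp
  have hinj : Function.Injective D.mulVec := fun x y hxy => by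
    have := congrArg (fun v => D' *ᵥ v) hxy
    simpa only [mulVec_mulVec, h2, one_mulVec] using this
  have hA : (D * S * D).PosDef := by
    have := hS.conjTranspose_mul_mul_same hinj
    rwa [hDt] at this
  obtain ⟨U, hU⟩ : ∃ U : Matrix ι ι ℝ, U = hA.1.eigenvectorUnitary := ⟨_, rfl⟩
  have hUU : U * star U = 1 := by rw [hU]; exact Unitary.coe_mul_star_self _
  have hUU' : star U * U = 1 := by rw [hU]; exact Unitary.coe_star_mul_self _
  obtain ⟨l, hl⟩ : ∃ l, l = hA.1.eigenvalues := ⟨_, rfl⟩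
  have hspec : D * S * D = U * diagonal l * star U := by
    have h4 := hA.1.spectral_theorem
    rw [Unitary.conjStarAlgAut_apply, ← hU] at h4
    rw [hl]
    exact h4
  refine ⟨D * U, star U * D', l, ?_, fun i => hl ▸ hA.eigenvalues_pos i, ?_⟩
  · rw [Matrix.mul_assoc, ← Matrix.mul_assoc U, hUU, Matrix.one_mul, h1]
  · have h5 : D * S * D * U = U * diagonal l := by
      rw [hspec, Matrix.mul_assoc, hUU', Matrix.mul_one]
    calc S * (D * U) = (D' * D) * (S * (D * U)) := by rw [h2, Matrix.one_mul]
      _ = D' * (D * S * D * U) := by simp only [Matrix.mul_assoc]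
      _ = D' * (U * diagonal l) := by rw [h5]
      _ = D' * (D' * D * (U * diagonal l)) := by rw [h2, Matrix.one_mul]
      _ = diagonal c * (D * U) * diagonal l := by
        rw [← h3]; simp only [Matrix.mul_assoc]

namespace Economy

variable {d N : ℕ} {Ω : Type*} [mΩ : MeasurableSpace Ω] {P : Measure Ω} [IsProbabilityMeasure P]
  {E : Economy d N P}

theorem martingale_sum {Ω : Type*} {mΩ : MeasurableSpace Ω} {P : Measure Ω} {ι κ : Type*} [Preorder ι] {ℱ : Filtration ι mΩ} (s : Finset κ)
    {c : κ → ℝ} {M : κ → ι → Ω → ℝ} (h : ∀ j ∈ s, Martingale (M j) ℱ P) :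
    Martingale (fun t ω => ∑ j ∈ s, c j * M j t ω) ℱ P := by
  classical
  induction s using Finset.induction_on with
  | empty =>
    simp only [Finset.sum_empty]
    exact martingale_zero _ _ _
  | insert i s hi ih =>
    simp only [Finset.sum_insert hi]
    exact ((h i (Finset.mem_insert_self i s)).smul (c i)).add
      (ih fun j hj => h j (Finset.mem_insert_of_mem hj))

/-- The linear forward-backward system for trading rates is solvable within the class `𝒜`. -/
theorem exists_isDrift {β κ : ℝ} (hβ : 0 < β) (hκ : 0 < κ) {g : Proc d Ω} (hg : E.MemHInf g) :
    ∃ u a, E.IsDrift u a ∧ ∀ᵐ p ∂E.Q, (2 * κ) • E.Λ *ᵥ (a p.2 p.1 - E.r • u p.2 p.1) =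
      β • E.cov *ᵥ coordPosition u p.2 p.1 - g p.2 p.1 := by
  have hT := E.T_pos.le
  obtain ⟨R, R', l, hRR, hl, hdiag⟩ := exists_relative_diagonalization E.cost_pos E.cov_posDef
  -- Substituting `u = R v` turns the system into scalar equations with coefficients `b j = β l j /
  -- (2 κ)` and inhomogeneity `R' (2 κ Λ)⁻¹ g`.
  obtain ⟨k, hk⟩ : ∃ k : Proc d Ω, k = fun t ω =>
      (R' * diagonal fun i => (2 * κ * E.cost i)⁻¹) *ᵥ g t ω := ⟨_, rfl⟩
  have hkI : E.MemHInf k := by rw [hk]; exact hg.mulVec _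
  obtain ⟨hko, C, hC⟩ := memHInf_iff.1 hkI
  -- Clipped because the scalar equation is solved for data bounded everywhere, while `k` is bounded
  -- only almost everywhere.
  obtain ⟨h, hh⟩ : ∃ h : Fin d → ℝ → Ω → ℝ, h = fun j t ω =>
    max (-|C|) (min |C| (k t ω j)) := ⟨_, rfl⟩
  have hho : ∀ j, IsOpt E.filtration (h j) := fun j => by
    rw [hh]; exact (isOptional_iff.1 hko j).clip _
  have hhb : ∀ j t ω, |h j t ω| ≤ |C| := fun j t ω => by
    rw [hh]
    exact abs_le.2 ⟨le_max_left _ _, max_le (by linarith [abs_nonneg C]) (min_le_left _ _)⟩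
  have hhk : ∀ᵐ p ∂E.Q, ∀ j, h j p.2 p.1 = k p.2 p.1 j := by
    filter_upwards [hC] with p hp j
    have := abs_le.1 (((norm_le_pi_norm _ j).trans hp).trans (le_abs_self C))
    rw [hh]
    simp only
    rw [min_eq_right this.2, max_eq_right this.1]
  obtain ⟨b, hb⟩ : ∃ b : Fin d → ℝ, b = fun j => β / (2 * κ) * l j := ⟨_, rfl⟩
  have hbpos : ∀ j, 0 < b j := fun j => by
    have := hl j
    rw [hb]; positivity
  choose v M K hvm hMm hvc hMc hvb hMb hM heq hterm using
    fun j => E.exists_scalar_solution (hbpos j) (hho j) (hhb j)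
  have hvo : ∀ j, IsOpt E.filtration (v j) := fun j => isOpt_of_continuousOn (hvm j) (hvc j)
  have hVo : ∀ j, IsOpt E.filtration fun t ω => ∫ s in (0 : ℝ)..t, v j s ω :=
    fun j => (hvo j).integral hT (hvb j)
  have hVb : ∀ j ω, ∀ t ∈ Set.Icc 0 E.T, |∫ s in (0 : ℝ)..t, v j s ω| ≤ |K j| * E.T := by
    intro j ω t ht
    have h1 : ‖∫ s in (0 : ℝ)..t, v j s ω‖ ≤ |K j| * |t - 0| := by
      refine intervalIntegral.norm_integral_le_of_norm_le_const fun s hs => ?_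
      rw [Set.uIoc_of_le ht.1] at hs
      exact (hvb j ω s ⟨hs.1.le, hs.2.trans ht.2⟩).trans (le_abs_self _)
    refine h1.trans (mul_le_mul_of_nonneg_left ?_ (abs_nonneg _))
    rw [sub_zero, abs_of_nonneg ht.1]
    exact ht.2
  obtain ⟨q, hq⟩ : ∃ q : Fin d → ℝ → Ω → ℝ, q = fun j s ω =>
    E.r * v j s ω + b j * (∫ x in (0 : ℝ)..s, v j x ω) - h j s ω := ⟨_, rfl⟩
  have hqo : ∀ j, IsOpt E.filtration (q j) := fun j => by
    rw [hq]
    exact (((hvo j).const_mul _).add ((hVo j).const_mul _)).sub (hho j)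
  have hqb : ∀ j, ∀ t ∈ Set.Icc 0 E.T, ∀ ω,
      |q j t ω| ≤ E.r * K j + b j * (|K j| * E.T) + |C| := by
    intro j t ht ω
    have h1 := hvb j ω t ht
    have h2 := hVb j ω t ht
    have h3 := hhb j t ω
    rw [hq]
    refine (abs_sub _ _).trans (add_le_add ((abs_add_le _ _).trans (add_le_add ?_ ?_)) h3)
    · rw [abs_mul, abs_of_nonneg E.r_nonneg]
      exact mul_le_mul_of_nonneg_left h1 E.r_nonneg
    · rw [abs_mul, abs_of_pos (hbpos j)]
      exact mul_le_mul_of_nonneg_left h2 (hbpos j).le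
  have hint : ∀ {f : ℝ → Ω → ℝ} {D : ℝ}, IsOpt E.filtration f →
      (∀ t ∈ Set.Icc 0 E.T, ∀ ω, |f t ω| ≤ D) → ∀ ω, ∀ t ∈ Set.Icc 0 E.T,
      IntervalIntegrable (fun s => f s ω) volume 0 t := fun hf hD ω t ht =>
    hf.intervalIntegrable_of_bound hT
      ((ae_restrict_mem measurableSet_Icc).mono fun t ht => hD t ht ω) ⟨le_rfl, hT⟩ ht
  have hsum : ∀ {f : Fin d → ℝ → Ω → ℝ} {D : Fin d → ℝ},
      (∀ j, ∀ t ∈ Set.Icc 0 E.T, ∀ ω, |f j t ω| ≤ D j) → ∀ i, ∀ t ∈ Set.Icc 0 E.T, ∀ ω,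
      |∑ j, R i j * f j t ω| ≤ ∑ j, |R i j| * D j := fun hD i t ht ω => by
    refine (Finset.abs_sum_le_sum_abs _ _).trans (Finset.sum_le_sum fun j _ => ?_)
    rw [abs_mul]
    exact mul_le_mul_of_nonneg_left (hD j t ht ω) (abs_nonneg _)
  have hisum : ∀ {f : Fin d → ℝ → Ω → ℝ} {D : Fin d → ℝ}, (∀ j, IsOpt E.filtration (f j)) →
      (∀ j, ∀ t ∈ Set.Icc 0 E.T, ∀ ω, |f j t ω| ≤ D j) → ∀ i, ∀ t ∈ Set.Icc 0 E.T, ∀ ω,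
      ∫ s in (0 : ℝ)..t, (∑ j, R i j * f j s ω) = ∑ j, R i j * ∫ s in (0 : ℝ)..t, f j s ω := by
    intro f D hf hD i t ht ω
    rw [intervalIntegral.integral_finsetSum fun j _ =>
      (hint (hf j) (hD j) ω t ht).const_mul (R i j)]
    simp only [intervalIntegral.integral_const_mul]
  have hosum : ∀ {f : Fin d → ℝ → Ω → ℝ}, (∀ j, IsOpt E.filtration (f j)) → ∀ i,
      IsOpt E.filtration fun t ω => (R *ᵥ fun j => f j t ω) i := fun hf i => by
    have := IsOpt.sum Finset.univ fun j _ => (hf j).const_mul (R i j)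
    exact this
  refine ⟨fun t ω => R *ᵥ fun j => v j t ω, fun t ω => R *ᵥ fun j => q j t ω,
    isDrift_of_coordinates fun i => ⟨fun t ω => ∑ j, R i j * M j t ω, _, _,
      hosum hvo i, hosum hqo i,
      hsum hqb i, hsum (fun j t ht ω => hMb j ω t ht) i, martingale_sum _ fun j _ => hM j,
      fun ω => continuousOn_finsetSum _ fun j _ => continuousOn_const.mul (hMc j ω),
      fun ω t ht => ?_, ?_⟩, ?_⟩
  · refine Eq.trans ?_ (congrArg (fun x => _ + x + _) (hisum hqo hqb i t ht ω).symm)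
    simp only [mulVec, dotProduct]
    rw [← Finset.sum_add_distrib, ← Finset.sum_sub_distrib, ← Finset.sum_add_distrib]
    refine Finset.sum_congr rfl fun j _ => ?_
    rw [heq j ω t ht, hq]
    ring
  · filter_upwards [ae_all_iff.2 hterm] with ω hω
    simp [mulVec, dotProduct, hω]
  · filter_upwards [hhk, ae_mem_Icc] with p hp hm
    have hpos : coordPosition (fun t ω => R *ᵥ fun j => v j t ω) p.2 p.1 =
        R *ᵥ fun j => ∫ s in (0 : ℝ)..p.2, v j s p.1 :=
      funext fun i => hisum hvo (fun j t ht ω => hvb j ω t ht) i p.2 hm p.1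
    have hdrift : (R *ᵥ fun j => q j p.2 p.1) - E.r • (R *ᵥ fun j => v j p.2 p.1) =
        R *ᵥ ((β / (2 * κ)) • (diagonal l *ᵥ fun j => ∫ s in (0 : ℝ)..p.2, v j s p.1)
          - k p.2 p.1) := by
      rw [← mulVec_smul, ← mulVec_sub]
      congr 1
      ext j
      simp only [hq, Pi.sub_apply, Pi.smul_apply, smul_eq_mul, mulVec_diagonal, hp j, hb]
      ring
    rw [hpos, hdrift, mulVec_mulVec, mulVec_sub, mulVec_smul, mulVec_mulVec]
    have e1 : E.Λ * R * diagonal l = E.cov * R := hdiag.symm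
    have e2 : (E.Λ * R) *ᵥ k p.2 p.1 = (1 / (2 * κ)) • g p.2 p.1 := by
      rw [hk, mulVec_mulVec, Matrix.mul_assoc, ← Matrix.mul_assoc R, hRR, Matrix.one_mul, Λ,
        diagonal_mul_diagonal]
      ext i
      simp only [mulVec_diagonal, Pi.smul_apply, smul_eq_mul]
      have := (E.cost_pos i).ne'
      field_simp
    rw [e1, e2, smul_sub, smul_smul, smul_smul, mul_one_div_cancel (by positivity), one_smul,
      mulVec_mulVec]
    congr 2
    field_simp

end Economy

/-! ### Linear-quadratic trading objectives and their gap formula. -/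

section Algebra

variable {ι : Type*} [Fintype ι] {A B : Matrix ι ι ℝ}

/-- With the first order condition `hf`, the linear terms collect into a form that integrates to
zero by parts when `x - y` is the primitive of `v - w`. -/
theorem quad_trading (hA : Aᵀ = A) (hB : Bᵀ = B) {β κ : ℝ} {g x y v w f : ι → ℝ}
    (hf : (2 * κ) • B *ᵥ f = β • A *ᵥ y - g) :
    x ⬝ᵥ g - β / 2 * (x ⬝ᵥ A *ᵥ x) - κ * (v ⬝ᵥ B *ᵥ v) =
      (y ⬝ᵥ g - β / 2 * (y ⬝ᵥ A *ᵥ y) - κ * (w ⬝ᵥ B *ᵥ w)) -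
        (2 * κ) * ((x - y) ⬝ᵥ B *ᵥ f + (v - w) ⬝ᵥ B *ᵥ w) -
        (β / 2 * ((x - y) ⬝ᵥ A *ᵥ (x - y)) + κ * ((v - w) ⬝ᵥ B *ᵥ (v - w))) := by
  have h : ∀ x : ι → ℝ, 2 * κ * (x ⬝ᵥ B *ᵥ f) = β * (x ⬝ᵥ A *ᵥ y) - x ⬝ᵥ g := fun x => by
    have h1 := congrArg (fun v => x ⬝ᵥ v) hf
    simpa only [dotProduct_sub, dotProduct_smul, smul_eq_mul] using h1
  simp only [mulVec_sub, dotProduct_sub, sub_dotProduct]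
  linear_combination h x - h y + (β / 2) * dotProduct_mulVec_symm hA x y
    + κ * dotProduct_mulVec_symm hB v w

theorem dotProduct_diagonal_mulVec [DecidableEq ι] (c x y : ι → ℝ) :
    x ⬝ᵥ diagonal c *ᵥ y = ∑ i, c i * (x i * y i) := by
  simp only [dotProduct, mulVec_diagonal]
  exact Finset.sum_congr rfl fun i _ => by ring

end Algebra

namespace Economy

variable {d N : ℕ} {Ω : Type*} [mΩ : MeasurableSpace Ω] {P : Measure Ω} [IsProbabilityMeasure P]
  {E : Economy d N P}

theorem Λ_transpose : E.Λᵀ = E.Λ := diagonal_transpose _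

theorem Λ_nonneg (x : Fin d → ℝ) : 0 ≤ x ⬝ᵥ E.Λ *ᵥ x := by
  rw [Λ, dotProduct_diagonal_mulVec]
  exact Finset.sum_nonneg fun i _ => mul_nonneg (E.cost_pos i).le (mul_self_nonneg _)

theorem eq_zero_of_Λ {x : Fin d → ℝ} (h : x ⬝ᵥ E.Λ *ᵥ x ≤ 0) : x = 0 := by
  rw [Λ, dotProduct_diagonal_mulVec] at h
  have h1 : ∀ i ∈ Finset.univ, 0 ≤ E.cost i * (x i * x i) :=
    fun i _ => mul_nonneg (E.cost_pos i).le (mul_self_nonneg _)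
  have h2 := (Finset.sum_eq_zero_iff_of_nonneg h1).1 (le_antisymm h (Finset.sum_nonneg h1))
  ext i
  have h3 := h2 i (Finset.mem_univ i)
  simpa [(E.cost_pos i).ne'] using h3

theorem ae_coordPosition_sub {u v : Proc d Ω} (hu : E.MemH2 u) (hv : E.MemH2 v) :
    ∀ᵐ p ∂E.Q, coordPosition (fun t ω => u t ω - v t ω) p.2 p.1 =
      coordPosition u p.2 p.1 - coordPosition v p.2 p.1 := by
  have h : ∀ {u : Proc d Ω}, E.MemH2 u → ∀ᵐ p ∂E.Q, ∀ i, ∀ t ∈ Set.Icc 0 E.T,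
      IntervalIntegrable (fun s => u s p.1 i) volume 0 t := fun {u} hu =>
    Measure.quasiMeasurePreserving_fst.ae
      (ae_all_iff.2 fun i => ae_intervalIntegrable (h := fun t ω => u t ω i) (hu.memLp.eval i))
  filter_upwards [h hu, h hv, ae_mem_Icc] with p h1 h2 hm
  ext i
  exact intervalIntegral.integral_sub (h1 i _ hm) (h2 i _ hm)

/-- Two rates that agree almost everywhere lead to the same positions. -/
theorem ae_coordPosition_congr {u v : Proc d Ω} (h : ∀ᵐ p ∂E.Q, u p.2 p.1 = v p.2 p.1) :
    ∀ᵐ ω ∂P, ∀ t ∈ Set.Icc 0 E.T, coordPosition u t ω = coordPosition v t ω := by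
  have h1 : ∀ᵐ ω ∂P, ∀ᵐ t ∂(volume.restrict (Set.Icc 0 E.T)), u t ω = v t ω :=
    Measure.ae_ae_of_ae_prod h
  filter_upwards [h1] with ω hω t ht
  ext i
  refine intervalIntegral.integral_congr_ae ?_
  filter_upwards [(ae_restrict_iff' measurableSet_Icc).1 hω] with s hs hst
  rw [Set.uIoc_of_le ht.1] at hst
  rw [hs ⟨hst.1.le, hst.2.trans ht.2⟩]

theorem ae_Q_of_forall {S : Ω → ℝ → Prop} (h : ∀ᵐ ω ∂P, ∀ t ∈ Set.Icc 0 E.T, S ω t) :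
    ∀ᵐ p ∂E.Q, S p.1 p.2 := by
  have h1 : ∀ᵐ p ∂E.Q, ∀ t ∈ Set.Icc 0 E.T, S p.1 t := Measure.quasiMeasurePreserving_fst.ae h
  filter_upwards [h1, ae_mem_Icc] with p hp hm using hp _ hm

/-- Discounted integration by parts in matrix form. -/
theorem VecDrift.ibp {u a : Proc d Ω} (h : E.VecDrift u a) {v : Proc d Ω} (hv : E.MemH2 v) :
    ∫ p, E.disc p.2 * (coordPosition v p.2 p.1 ⬝ᵥ E.Λ *ᵥ (a p.2 p.1 - E.r • u p.2 p.1) +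
      v p.2 p.1 ⬝ᵥ E.Λ *ᵥ u p.2 p.1) ∂E.Q = 0 := by
  have h1 : ∀ p : Ω × ℝ, E.disc p.2 * (coordPosition v p.2 p.1 ⬝ᵥ E.Λ *ᵥ
      (a p.2 p.1 - E.r • u p.2 p.1) + v p.2 p.1 ⬝ᵥ E.Λ *ᵥ u p.2 p.1) =
      ∑ i, E.cost i * (E.disc p.2 * ((∫ s in (0 : ℝ)..p.2, v s p.1 i) *
        (a p.2 p.1 i - E.r * u p.2 p.1 i) + v p.2 p.1 i * u p.2 p.1 i)) := fun p => by
    rw [Λ, dotProduct_diagonal_mulVec, dotProduct_diagonal_mulVec, ← Finset.sum_add_distrib,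
      Finset.mul_sum]
    refine Finset.sum_congr rfl fun i _ => ?_
    simp only [coordPosition, Pi.sub_apply, Pi.smul_apply, smul_eq_mul]
    ring
  simp only [h1]
  rw [integral_finsetSum]
  · refine Finset.sum_eq_zero fun i _ => ?_
    rw [integral_const_mul, (h i).ibp_disc (isOptional_iff.1 hv.1 i) (hv.memLp.eval i), mul_zero]
  · intro i _
    refine Integrable.const_mul ?_ _
    have hV := memLp_integral (E.jointlyMeasurable_of_isOpt (isOptional_iff.1 hv.1 i))
      (hv.memLp.eval i)
    have i1 := hV.integrable_mul ((h i).memLp_drift.sub ((h i).memLp.const_mul E.r))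
    have i2 := (hv.memLp.eval i).integrable_mul (h i).memLp
    exact (i1.add i2).bdd_mul
      (continuous_disc.measurable.comp measurable_snd).aestronglyMeasurable
      (ae_abs_disc_le (E := E))

theorem VecDrift.memLp_drift {u a : Proc d Ω} (h : E.VecDrift u a) :
    MemLp (fun p : Ω × ℝ => a p.2 p.1) 2 E.Q := MemLp.of_eval fun i => (h i).memLp_drift

/-- The loss relative to the optimal trading rate. -/
def loss (E : Economy d N P) (β κ : ℝ) (x v : Fin d → ℝ) : ℝ :=
  β / 2 * (x ⬝ᵥ E.cov *ᵥ x) + κ * (v ⬝ᵥ E.Λ *ᵥ v)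

theorem integrable_loss (β κ : ℝ) {F G : Ω × ℝ → Fin d → ℝ} (hF : MemLp F 2 E.Q)
    (hG : MemLp G 2 E.Q) : Integrable (fun p => E.disc p.2 * E.loss β κ (F p) (G p)) E.Q := by
  refine ((integrable_disc_quad hF E.cov (β / 2)).add
    (integrable_disc_quad hG E.Λ κ)).congr (ae_of_all _ fun p => ?_)
  simp only [loss, Pi.add_apply]
  ring

theorem loss_nonneg {β κ : ℝ} (hβ : 0 < β) (hκ : 0 < κ) (x v : Fin d → ℝ) :
    0 ≤ E.loss β κ x v :=
  add_nonneg (mul_nonneg (by positivity) (cov_nonneg x)) (mul_nonneg hκ.le (Λ_nonneg v))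

theorem integral_loss_nonneg {β κ : ℝ} (hβ : 0 < β) (hκ : 0 < κ) (F G : Ω × ℝ → Fin d → ℝ) :
    0 ≤ ∫ p, E.disc p.2 * E.loss β κ (F p) (G p) ∂E.Q :=
  integral_nonneg fun _ => mul_nonneg (disc_pos _).le (loss_nonneg hβ hκ _ _)

theorem ae_eq_zero_of_integral_loss {β κ : ℝ} (hβ : 0 < β) (hκ : 0 < κ)
    {F G : Ω × ℝ → Fin d → ℝ} (hF : MemLp F 2 E.Q) (hG : MemLp G 2 E.Q)
    (h : ∫ p, E.disc p.2 * E.loss β κ (F p) (G p) ∂E.Q ≤ 0) : ∀ᵐ p ∂E.Q, G p = 0 := by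
  have h0 := le_antisymm h (integral_loss_nonneg hβ hκ F G)
  rw [integral_eq_zero_iff_of_nonneg
    (fun _ => mul_nonneg (disc_pos _).le (loss_nonneg hβ hκ _ _)) (integrable_loss β κ hF hG)] at h0
  filter_upwards [h0] with p hp
  have h1 : E.loss β κ (F p) (G p) = 0 := (mul_eq_zero.1 hp).resolve_left (disc_pos p.2).ne'
  refine eq_zero_of_Λ (E := E) ?_
  have h2 : 0 ≤ β / 2 * (F p ⬝ᵥ E.cov *ᵥ F p) := mul_nonneg (by positivity) (cov_nonneg _)
  unfold loss at h1
  by_contra hne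
  have := mul_pos hκ (not_le.1 hne)
  linarith

/-- The integrand of a linear-quadratic trading objective. -/
def tradingPayoff (E : Economy d N P) (β κ : ℝ) (g x v : Fin d → ℝ) : ℝ :=
  x ⬝ᵥ g - β / 2 * (x ⬝ᵥ E.cov *ᵥ x) - κ * (v ⬝ᵥ E.Λ *ᵥ v)

theorem integrable_tradingPayoff (β κ : ℝ) {F G g : Ω × ℝ → Fin d → ℝ} (hF : MemLp F 2 E.Q)
    (hG : MemLp G 2 E.Q) (hg : MemLp g 2 E.Q) :
    Integrable (fun p => E.disc p.2 * E.tradingPayoff β κ (g p) (F p) (G p)) E.Q := by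
  refine ((integrable_disc_dot hF hg).sub (integrable_loss β κ hF hG)).congr
    (ae_of_all _ fun p => ?_)
  simp only [loss, tradingPayoff, Pi.sub_apply]
  ring

/-- A linear-quadratic trading objective in terms of the distance to the rate satisfying the first
order condition. -/
theorem trading_gap {β κ : ℝ} {g u a : Proc d Ω}
    (hg : MemLp (fun p : Ω × ℝ => g p.2 p.1) 2 E.Q) (hu : E.VecDrift u a)
    (hfoc : ∀ᵐ p ∂E.Q, (2 * κ) • E.Λ *ᵥ (a p.2 p.1 - E.r • u p.2 p.1) =
      β • E.cov *ᵥ coordPosition u p.2 p.1 - g p.2 p.1) {v : Proc d Ω} (hv : E.MemH2 v) :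
    ∫ p, E.disc p.2 * E.tradingPayoff β κ (g p.2 p.1) (coordPosition v p.2 p.1) (v p.2 p.1) ∂E.Q =
      ∫ p, E.disc p.2 * E.tradingPayoff β κ (g p.2 p.1) (coordPosition u p.2 p.1) (u p.2 p.1) ∂E.Q -
        ∫ p, E.disc p.2 * E.loss β κ (coordPosition v p.2 p.1 - coordPosition u p.2 p.1)
          (v p.2 p.1 - u p.2 p.1) ∂E.Q := by
  have hu2 := hu.memH2
  have hVp := memLp_coordPosition hv
  have hUp := memLp_coordPosition hu2
  have i1 := integrable_tradingPayoff β κ hUp hu2.memLp hg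
  have i2 := integrable_loss (E := E) β κ (F := fun p => coordPosition v p.2 p.1 - coordPosition u p.2 p.1)
    (G := fun p => v p.2 p.1 - u p.2 p.1) (hVp.sub hUp) (hv.memLp.sub hu2.memLp)
  have hibp := hu.ibp (hv.sub hu2)
  have i3 : Integrable (fun p : Ω × ℝ => E.disc p.2 *
      (coordPosition (fun t ω => v t ω - u t ω) p.2 p.1 ⬝ᵥ E.Λ *ᵥ (a p.2 p.1 - E.r • u p.2 p.1) +
      (v p.2 p.1 - u p.2 p.1) ⬝ᵥ E.Λ *ᵥ u p.2 p.1)) E.Q := by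
    have j1 := integrable_disc_dot (memLp_coordPosition (hv.sub hu2))
      (memLp_mulVec (hu.memLp_drift.sub (hu2.memLp.const_smul E.r)) E.Λ)
    have j2 := integrable_disc_dot (hv.memLp.sub hu2.memLp) (memLp_mulVec hu2.memLp E.Λ)
    refine (j1.add j2).congr (ae_of_all _ fun p => ?_)
    simp only [Pi.add_apply, Pi.sub_apply, Pi.smul_apply]
    ring
  have i4 := i3.const_mul (2 * κ)
  rw [← integral_sub i1 i2]
  -- This integral vanishes, so the linear terms of `quad_trading` can be subtracted without
  -- changing the value.
  have h1 : ∫ p, 2 * κ * (E.disc p.2 *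
      (coordPosition (fun t ω => v t ω - u t ω) p.2 p.1 ⬝ᵥ E.Λ *ᵥ (a p.2 p.1 - E.r • u p.2 p.1) +
      (v p.2 p.1 - u p.2 p.1) ⬝ᵥ E.Λ *ᵥ u p.2 p.1)) ∂E.Q = 0 := by
    rw [integral_const_mul, hibp, mul_zero]
  have h2 := integral_sub (i1.sub i2) i4
  rw [h1, sub_zero] at h2
  refine Eq.trans ?_ h2
  refine integral_congr_ae ?_
  filter_upwards [hfoc, ae_coordPosition_sub hv hu2] with p hp hc
  have := quad_trading (cov_transpose (E := E)) (Λ_transpose (E := E)) hp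
    (x := coordPosition v p.2 p.1) (v := v p.2 p.1) (w := u p.2 p.1)
  simp only [tradingPayoff, loss, Pi.sub_apply, hc, this]
  ring

end Economy

/-! ### Aggregation of rates and price takers with transaction costs. -/

namespace Economy

variable {d N : ℕ} {Ω : Type*} [mΩ : MeasurableSpace Ω] {P : Measure Ω} [IsProbabilityMeasure P]
  {E : Economy d N P}

/-! ### Linear combinations of rates -/

theorem VecDrift.add {u a u' a' : Proc d Ω} (h : E.VecDrift u a) (h' : E.VecDrift u' a') :
    E.VecDrift (fun t ω => u t ω + u' t ω) (fun t ω => a t ω + a' t ω) :=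
  fun i => (h i).add (h' i)

theorem VecDrift.sum {ι : Type*} (s : Finset ι) {u a : ι → Proc d Ω}
    (h : ∀ j ∈ s, E.VecDrift (u j) (a j)) :
    E.VecDrift (fun t ω => ∑ j ∈ s, u j t ω) (fun t ω => ∑ j ∈ s, a j t ω) := fun i => by
  simp only [Finset.sum_apply]
  exact WeakDrift.sum s fun j hj => h j hj i

theorem VecDrift.drift_eq_zero {u a : Proc d Ω} (h : E.VecDrift u a)
    (hu : ∀ᵐ p ∂E.Q, u p.2 p.1 = 0) : ∀ᵐ p ∂E.Q, a p.2 p.1 = 0 := by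
  have h1 : ∀ i, ∀ᵐ p ∂E.Q, a p.2 p.1 i = 0 := fun i => by
    refine (h i).drift_unique WeakDrift.zero ?_
    filter_upwards [hu] with p hp
    rw [hp, Pi.zero_apply]
  filter_upwards [ae_all_iff.2 h1] with p hp using funext hp

theorem VecDrift.drift_unique {u a u' a' : Proc d Ω} (h : E.VecDrift u a)
    (h' : E.VecDrift u' a') (hu : ∀ᵐ p ∂E.Q, u p.2 p.1 = u' p.2 p.1) :
    ∀ᵐ p ∂E.Q, a p.2 p.1 = a' p.2 p.1 := by
  have h1 : ∀ i, ∀ᵐ p ∂E.Q, a p.2 p.1 i = a' p.2 p.1 i := fun i => by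
    refine (h i).drift_unique (h' i) ?_
    filter_upwards [hu] with p hp
    rw [hp]
  filter_upwards [ae_all_iff.2 h1] with p hp using funext hp

theorem ae_integrable_path {u : Proc d Ω} (hu : E.MemH2 u) : ∀ᵐ ω ∂P, ∀ i, ∀ t ∈ Set.Icc 0 E.T,
    IntervalIntegrable (fun s => u s ω i) volume 0 t :=
  ae_all_iff.2 fun i => ae_intervalIntegrable (h := fun t ω => u t ω i) (hu.memLp.eval i)

theorem ae_coordPosition_add {u v : Proc d Ω} (hu : E.MemH2 u) (hv : E.MemH2 v) :
    ∀ᵐ ω ∂P, ∀ t ∈ Set.Icc 0 E.T, coordPosition (fun t ω => u t ω + v t ω) t ω =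
      coordPosition u t ω + coordPosition v t ω := by
  filter_upwards [ae_integrable_path hu, ae_integrable_path hv] with ω h1 h2 t ht
  ext i
  exact intervalIntegral.integral_add (h1 i _ ht) (h2 i _ ht)

theorem ae_coordPosition_sum {ι : Type*} [Countable ι] {s : Finset ι} {u : ι → Proc d Ω}
    (hu : ∀ j ∈ s, E.MemH2 (u j)) : ∀ᵐ ω ∂P, ∀ t ∈ Set.Icc 0 E.T,
      coordPosition (fun t ω => ∑ j ∈ s, u j t ω) t ω = ∑ j ∈ s, coordPosition (u j) t ω := by
  have h1 : ∀ᵐ ω ∂P, ∀ j, j ∈ s → ∀ i, ∀ t ∈ Set.Icc 0 E.T,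
      IntervalIntegrable (fun s => u j s ω i) volume 0 t := ae_all_iff.2 fun j => by
    by_cases hj : j ∈ s
    · filter_upwards [ae_integrable_path (hu j hj)] with ω hω _ using hω
    · exact ae_of_all _ fun _ h => absurd h hj
  filter_upwards [h1] with ω hω t ht
  ext i
  simp only [coordPosition, Finset.sum_apply]
  exact intervalIntegral.integral_finsetSum fun j hj => hω j hj i t ht

/-- A rate with vanishing position vanishes. -/
theorem ae_eq_zero_of_coordPosition {u : Proc d Ω} (hu : E.MemH2 u)
    (h : ∀ᵐ ω ∂P, ∀ t ∈ Set.Icc 0 E.T, coordPosition u t ω = 0) : ∀ᵐ p ∂E.Q, u p.2 p.1 = 0 := by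
  have h1 : ∀ i, ∀ᵐ p ∂E.Q, u p.2 p.1 i ∈ ({0} : Set ℝ) := fun i => by
    refine (JointlyMeasurable.ae_iff (X := fun t ω => u t ω i)
      (E.jointlyMeasurable_of_isOpt (isOptional_iff.1 hu.1 i)) (measurableSet_singleton 0)).2 ?_
    filter_upwards [h, ae_integrable_path hu] with ω h1 h2
    exact ae_eq_zero_of_primitive_eq_zero E.T_pos.le (h2 i _ ⟨E.T_pos.le, le_rfl⟩)
      fun t ht => congrFun (h1 t ht) i
  filter_upwards [ae_all_iff.2 h1] with p hp using funext hp

/-- A bounded rate has a position that agrees with a bounded optional process. -/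
theorem exists_memHInf_coordPosition {u : Proc d Ω} (hu : E.MemHInf u) :
    ∃ x, E.MemHInf x ∧ ∀ᵐ p ∂E.Q, x p.2 p.1 = coordPosition u p.2 p.1 := by
  obtain ⟨ho, C, hC⟩ := memHInf_iff.1 hu
  -- Clipping makes all paths of the rate bounded, hence all paths of the primitive continuous; only
  -- then is the primitive known to be optional.
  obtain ⟨v, hv⟩ : ∃ v : Proc d Ω, v = fun t ω i => max (-|C|) (min |C| (u t ω i)) := ⟨_, rfl⟩
  have hvo : ∀ i, IsOpt E.filtration fun t ω => v t ω i := fun i => by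
    rw [hv]; exact (isOptional_iff.1 ho i).clip _
  have hvb : ∀ i t ω, |v t ω i| ≤ |C| := fun i t ω => by
    rw [hv]
    exact abs_le.2 ⟨le_max_left _ _, max_le (by linarith [abs_nonneg C]) (min_le_left _ _)⟩
  have hvu : ∀ᵐ p ∂E.Q, v p.2 p.1 = u p.2 p.1 := by
    filter_upwards [hC] with p hp
    ext i
    have := abs_le.1 (((norm_le_pi_norm _ i).trans hp).trans (le_abs_self C))
    rw [hv]
    simp only
    rw [min_eq_right this.2, max_eq_right this.1]
  have hvI : E.MemHInf v := memHInf_iff.2 ⟨isOptional_iff.2 hvo, |C|, ae_of_all _ fun p =>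
    (pi_norm_le_iff_of_nonneg (abs_nonneg C)).2 fun i => hvb i p.2 p.1⟩
  obtain ⟨D, hD⟩ := ae_norm_coordPosition_le hvI
  refine ⟨coordPosition v, memHInf_iff.2 ⟨isOptional_iff.2 fun i =>
    (hvo i).integral E.T_pos.le fun ω t _ => hvb i t ω, D, hD⟩, ?_⟩
  exact ae_Q_of_forall (S := fun ω t => coordPosition v t ω = coordPosition u t ω)
    (ae_coordPosition_congr hvu)

/-! ### Price takers -/

theorem integrable_disc_payoff {m : Fin N} {ν u : Proc d Ω} (hζ : E.MemH2 (E.ζ m))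
    (hν : E.MemH2 ν) (hu : E.MemH2 u) : Integrable (fun p => E.disc p.2 *
      (E.payoff m (coordPosition u p.2 p.1) (ν p.2 p.1) (E.ζ m p.2 p.1) -
        u p.2 p.1 ⬝ᵥ E.Λ *ᵥ u p.2 p.1)) E.Q := by
  refine ((integrable_payoff (m := m) (memLp_coordPosition hu) hν.memLp hζ.memLp).sub
    (integrable_disc_dot hu.memLp (memLp_mulVec hu.memLp E.Λ))).congr (ae_of_all _ fun p => ?_)
  simp only [Pi.sub_apply]
  ring

theorem costObjective_eq {m : Fin N} {ν u : Proc d Ω} (hζ : E.MemH2 (E.ζ m)) (hν : E.MemH2 ν)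
    (hu : E.MemH2 u) : E.costObjective m ν u =
      ∫ p, E.disc p.2 * (E.payoff m (coordPosition u p.2 p.1) (ν p.2 p.1) (E.ζ m p.2 p.1) -
        u p.2 p.1 ⬝ᵥ E.Λ *ᵥ u p.2 p.1) ∂E.Q := by
  rw [integral_Q (F := fun t ω => E.disc t * (E.payoff m (coordPosition u t ω) (ν t ω)
    (E.ζ m t ω) - u t ω ⬝ᵥ E.Λ *ᵥ u t ω)) (integrable_disc_payoff hζ hν hu)]
  refine integral_congr_ae ?_
  filter_upwards [ae_position_eq hu.memLp] with ω hω
  refine intervalIntegral.integral_congr fun t ht => ?_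
  rw [Set.uIcc_of_le E.T_pos.le] at ht
  simp only [hω t ht, disc, payoff]

/-- The part of the objective that cannot be influenced. -/
def exposureCost (E : Economy d N P) (m : Fin N) : ℝ :=
  ∫ p, E.disc p.2 * (1 / (2 * E.δ m) * (E.ζ m p.2 p.1 ⬝ᵥ E.cov *ᵥ E.ζ m p.2 p.1)) ∂E.Q

/-- Moves the exposure into the linear coefficient and a constant, which puts the objective in the
form covered by `trading_gap`. -/
theorem payoff_eq (m : Fin N) (x ν z : Fin d → ℝ) : E.payoff m x ν z =
    x ⬝ᵥ (ν - (1 / E.δ m) • E.cov *ᵥ z) - 1 / E.δ m / 2 * (x ⬝ᵥ E.cov *ᵥ x) -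
      1 / (2 * E.δ m) * (z ⬝ᵥ E.cov *ᵥ z) := by
  have h := dotProduct_mulVec_symm (cov_transpose (E := E)) x z
  have h1 : 1 / (2 * E.δ m) = 1 / E.δ m / 2 := by rw [div_div, mul_comm]
  simp only [payoff, h1, mulVec_add, dotProduct_add, add_dotProduct, dotProduct_sub,
    dotProduct_smul, smul_eq_mul]
  linear_combination (1 / E.δ m / 2) * h

theorem costObjective_eq_trading {m : Fin N} {ν u : Proc d Ω} (hζ : E.MemH2 (E.ζ m))
    (hν : E.MemH2 ν) (hu : E.MemH2 u) : E.costObjective m ν u =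
      ∫ p, E.disc p.2 * E.tradingPayoff (1 / E.δ m) 1
        (ν p.2 p.1 - (1 / E.δ m) • E.cov *ᵥ E.ζ m p.2 p.1) (coordPosition u p.2 p.1) (u p.2 p.1)
        ∂E.Q - E.exposureCost m := by
  have hg := (hν.sub ((hζ.mulVec E.cov).smul (1 / E.δ m))).memLp
  rw [costObjective_eq hζ hν hu, exposureCost, ← integral_sub
    (integrable_tradingPayoff _ _ (memLp_coordPosition hu) hu.memLp hg)
    (integrable_disc_quad hζ.memLp E.cov _)]
  refine integral_congr_ae (ae_of_all _ fun p => ?_)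
  simp only [payoff_eq, tradingPayoff]
  ring

/-- The solution of the first order condition from `exists_isDrift` beats every rate in `ℋ²` by
`trading_gap`. Every optimal rate therefore agrees almost everywhere with one that has a bounded
drift, which clearing will exploit. -/
theorem exists_unique_costOptimal {m : Fin N} {ν : Proc d Ω} (hζ : E.MemHInf (E.ζ m))
    (hν : E.MemHInf ν) : ∃ u a, E.VecDrift u a ∧
      (∀ᵐ p ∂E.Q, (2 : ℝ) • E.Λ *ᵥ (a p.2 p.1 - E.r • u p.2 p.1) =
        (1 / E.δ m) • E.cov *ᵥ coordPosition u p.2 p.1 -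
          (ν p.2 p.1 - (1 / E.δ m) • E.cov *ᵥ E.ζ m p.2 p.1)) ∧
      E.IsCostOptimal m ν u ∧
      ∀ v, E.IsCostOptimal m ν v → ∀ᵐ p ∂E.Q, v p.2 p.1 = u p.2 p.1 := by
  have hδ := E.δ_pos m
  have hβ : 0 < 1 / E.δ m := by positivity
  have hg := hν.sub ((hζ.mulVec E.cov).smul (1 / E.δ m))
  obtain ⟨u, a, hd, hfoc⟩ := exists_isDrift hβ one_pos hg
  have hu := vecDrift_of_isDrift hd
  have hgap := fun {v : Proc d Ω} (hv : E.MemH2 v) =>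
    trading_gap (β := 1 / E.δ m) (κ := 1)
      (g := fun t ω => ν t ω - (1 / E.δ m) • E.cov *ᵥ E.ζ m t ω) hg.memLp hu hfoc hv
  simp only [mul_one] at hfoc
  refine ⟨u, a, hu, hfoc, ⟨hu.memH2, fun v hv => ?_⟩, fun v hv => ?_⟩
  · rw [costObjective_eq_trading hζ.memH2 hν.memH2 hv,
      costObjective_eq_trading hζ.memH2 hν.memH2 hu.memH2, hgap hv]
    have := integral_loss_nonneg (E := E) hβ one_pos
      (fun p => coordPosition v p.2 p.1 - coordPosition u p.2 p.1)
      (fun p => v p.2 p.1 - u p.2 p.1)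
    linarith
  · have h1 := hv.2 u hu.memH2
    rw [costObjective_eq_trading hζ.memH2 hν.memH2 hv.1,
      costObjective_eq_trading hζ.memH2 hν.memH2 hu.memH2, hgap hv.1] at h1
    have h2 := ae_eq_zero_of_integral_loss hβ one_pos
      (F := fun p => coordPosition v p.2 p.1 - coordPosition u p.2 p.1)
      (G := fun p => v p.2 p.1 - u p.2 p.1)
      ((memLp_coordPosition hv.1).sub (memLp_coordPosition hu.memH2))
      (hv.1.memLp.sub hu.memLp) (by linarith)
    filter_upwards [h2] with p hp using sub_eq_zero.1 hp

end Economy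

/-! ### Market clearing with transaction costs. -/

namespace Economy

variable {d N : ℕ} {Ω : Type*} [mΩ : MeasurableSpace Ω] {P : Measure Ω} [IsProbabilityMeasure P]
  {E : Economy d N P}

theorem MemWA.ae_eq_coordPosition {X u : Proc d Ω} (h : E.MemWA X u) :
    ∀ᵐ ω ∂P, ∀ t ∈ Set.Icc 0 E.T, X t ω = coordPosition u t ω := by
  obtain ⟨a, ha⟩ := h.rate_mem
  filter_upwards [h.eq, ae_position_eq (vecDrift_of_isDrift ha).memLp] with ω h1 h2 t ht
  rw [h1 t ht, ← h2 t ht, position]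

theorem MemWA.memHInf {X u : Proc d Ω} (h : E.MemWA X u) : E.MemHInf X := by
  obtain ⟨a, ha⟩ := h.rate_mem
  obtain ⟨C, hC⟩ := ae_norm_coordPosition_le (vecDrift_of_isDrift ha).memHInf
  refine memHInf_iff.2 ⟨h.optional, C, ?_⟩
  filter_upwards [hC, ae_Q_of_forall (S := fun ω t => X t ω = coordPosition u t ω)
    h.ae_eq_coordPosition] with p h1 h2
  rw [h2]
  exact h1

theorem sum_erase_const (n : Fin N) (x : Fin d → ℝ) :
    ∑ _m ∈ Finset.univ.erase n, x = ((N : ℝ) - 1) • x := by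
  have hN : 1 ≤ N := n.pos
  rw [Finset.sum_const, Finset.card_erase_of_mem (Finset.mem_univ n), Finset.card_univ,
    Fintype.card_fin, ← Nat.cast_smul_eq_nsmul ℝ, Nat.cast_sub hN, Nat.cast_one]

/-- The returns clearing the market with transaction costs when investor `n` trades at the rate `v`
with drift `av`. -/
def costReturn (E : Economy d N P) (n : Fin N) (ψdot aψ v av : Proc d Ω) : Proc d Ω := fun t ω =>
  (1 / ((N : ℝ) - 1)) • ((1 / E.δ n) • E.cov *ᵥ (E.residual n t ω - coordPosition v t ω) +
    (2 : ℝ) • E.Λ *ᵥ ((av t ω + aψ t ω) - E.r • (v t ω + ψdot t ω)))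

section CostClearing

variable (hN : 2 ≤ N) (hδ : ∀ m k : Fin N, E.δ m = E.δ k) (hζ : ∀ m, E.MemHInf (E.ζ m))
  {ψdot aψ : Proc d Ω} (hψ : E.MemWA E.ψ ψdot) (haψ : E.IsDrift ψdot aψ) (n : Fin N)
include hδ hζ

/-- The optimal trading rates of all price takers and their aggregate first order condition. -/
theorem exists_takers {ν : Proc d Ω} (hν : E.MemHInf ν) : ∃ u a : Fin N → Proc d Ω,
    (∀ m, E.VecDrift (u m) (a m)) ∧ (∀ m, E.IsCostOptimal m ν (u m)) ∧
    (∀ m v, E.IsCostOptimal m ν v → ∀ᵐ p ∂E.Q, v p.2 p.1 = u m p.2 p.1) ∧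
    ∀ᵐ p ∂E.Q, (2 : ℝ) • E.Λ *ᵥ ((∑ m ∈ Finset.univ.erase n, a m p.2 p.1) -
        E.r • ∑ m ∈ Finset.univ.erase n, u m p.2 p.1) =
      (1 / E.δ n) • E.cov *ᵥ (∑ m ∈ Finset.univ.erase n, coordPosition (u m) p.2 p.1) -
        (((N : ℝ) - 1) • ν p.2 p.1 -
          (1 / E.δ n) • E.cov *ᵥ ∑ m ∈ Finset.univ.erase n, E.ζ m p.2 p.1) := by
  choose u a hu hfoc hopt huniq using fun m => exists_unique_costOptimal (hζ m) hν
  refine ⟨u, a, hu, hopt, huniq, ?_⟩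
  filter_upwards [ae_all_iff.2 hfoc] with p hp
  -- Equal risk tolerances give all these equations the same coefficients, so their sum closes in
  -- terms of aggregate rate, drift and position.
  have h1 := Finset.sum_congr (rfl : Finset.univ.erase n = _) fun m _ => hp m
  simp only [hδ _ n, Finset.sum_sub_distrib, ← Finset.smul_sum, ← Matrix.mulVec_sum,
    sum_erase_const] at h1
  exact h1

include hN hψ haψ

/-- Returns clearing the market are determined by the trading rate of the strategic investor. -/
theorem CostClears.ae_eq {v av ν : Proc d Ω} (hv : E.VecDrift v av) (h : E.CostClears n v ν) :
    ∀ᵐ p ∂E.Q, ν p.2 p.1 = E.costReturn n ψdot aψ v av p.2 p.1 := by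
  obtain ⟨hν, w, hw, hc⟩ := h
  obtain ⟨u, a, hu, -, huniq, hfoc⟩ := exists_takers hδ hζ n hν
  have hψd := vecDrift_of_isDrift haψ
  -- Clearing says that the position of the total rate vanishes. Then so do the rate and, by
  -- uniqueness, its drift, and the aggregate first order condition of the takers becomes a formula
  -- for `ν`.
  have hS := (hv.add hψd).add (VecDrift.sum (Finset.univ.erase n) fun m _ => hu m)
  have hwpos : ∀ᵐ ω ∂P, ∀ m, m ≠ n → ∀ t ∈ Set.Icc 0 E.T,
      position (w m) t ω = coordPosition (u m) t ω := ae_all_iff.2 fun m => by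
    by_cases hm : m = n
    · exact ae_of_all _ fun _ h => absurd hm h
    · filter_upwards [ae_position_eq (hw m hm).1.memLp,
        ae_coordPosition_congr (huniq m _ (hw m hm))] with ω h1 h2 _ t ht
      rw [h1 t ht, h2 t ht]
  have hagg : ∀ᵐ ω ∂P, ∀ t ∈ Set.Icc 0 E.T, coordPosition v t ω +
      (∑ m ∈ Finset.univ.erase n, coordPosition (u m) t ω) + E.ψ t ω = 0 := by
    filter_upwards [hc, hwpos, ae_position_eq hv.memLp] with ω h1 h2 h3 t ht
    rw [← h1 t ht, h3 t ht]
    congr 2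
    exact Finset.sum_congr rfl fun m hm => (h2 m (Finset.ne_of_mem_erase hm) t ht).symm
  have hpos : ∀ᵐ ω ∂P, ∀ t ∈ Set.Icc 0 E.T, coordPosition (fun t ω =>
      v t ω + ψdot t ω + ∑ m ∈ Finset.univ.erase n, u m t ω) t ω = 0 := by
    filter_upwards [hagg, ae_coordPosition_add (hv.add hψd).memH2
      (VecDrift.sum (Finset.univ.erase n) fun m _ => hu m).memH2,
      ae_coordPosition_add hv.memH2 hψd.memH2,
      ae_coordPosition_sum (s := Finset.univ.erase n) fun m _ => (hu m).memH2,
      hψ.ae_eq_coordPosition] with ω h1 h2 h3 h4 h5 t ht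
    rw [h2 t ht, h3 t ht, h4 t ht, ← h5 t ht, ← h1 t ht]
    abel
  have hS0 := ae_eq_zero_of_coordPosition hS.memH2 hpos
  filter_upwards [hfoc, hS0, hS.drift_eq_zero hS0, ae_Q_of_forall (S := fun ω t =>
    coordPosition v t ω + (∑ m ∈ Finset.univ.erase n, coordPosition (u m) t ω) + E.ψ t ω = 0)
    hagg] with p h1 h2 h3 h4
  have e1 : ∑ m ∈ Finset.univ.erase n, u m p.2 p.1 = -(v p.2 p.1 + ψdot p.2 p.1) :=
    eq_neg_of_add_eq_zero_right h2
  have e2 : ∑ m ∈ Finset.univ.erase n, a m p.2 p.1 = -(av p.2 p.1 + aψ p.2 p.1) :=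
    eq_neg_of_add_eq_zero_right h3
  have e3 : ∑ m ∈ Finset.univ.erase n, coordPosition (u m) p.2 p.1 =
      -(coordPosition v p.2 p.1 + E.ψ p.2 p.1) := by
    rw [eq_neg_iff_add_eq_zero, ← h4]; abel
  rw [e1, e2, e3] at h1
  have hN1 : (N : ℝ) - 1 ≠ 0 := by
    have : (2 : ℝ) ≤ N := by exact_mod_cast hN
    linarith
  have h5 : ((N : ℝ) - 1) • ν p.2 p.1 =
      (1 / E.δ n) • E.cov *ᵥ (E.residual n p.2 p.1 - coordPosition v p.2 p.1) +
      (2 : ℝ) • E.Λ *ᵥ ((av p.2 p.1 + aψ p.2 p.1) - E.r • (v p.2 p.1 + ψdot p.2 p.1)) := by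
    simp only [residual, mulVec_add, mulVec_sub, mulVec_neg, mulVec_smul] at h1 ⊢
    ext i
    have h6 := congrFun h1 i
    simp only [Pi.add_apply, Pi.sub_apply, Pi.smul_apply, Pi.neg_apply, smul_eq_mul] at h6 ⊢
    linarith
  rw [costReturn, ← h5, smul_smul, one_div_mul_cancel hN1, one_smul]

/-- For these returns the total rate `S` satisfies the homogeneous equation `2 Λ (A - r S) = Σ x /
δ`, with `x` its position. Pairing with `x` and integrating by parts shows that the loss of `S`
integrates to zero, so `S = 0` and the market clears. -/
theorem costClears_of_ae_eq {v av ν : Proc d Ω} (hv : E.VecDrift v av) (hν : E.MemHInf ν)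
    (h : ∀ᵐ p ∂E.Q, ν p.2 p.1 = E.costReturn n ψdot aψ v av p.2 p.1) : E.CostClears n v ν := by
  obtain ⟨u, a, hu, hopt, -, hfoc⟩ := exists_takers hδ hζ n hν
  have hψd := vecDrift_of_isDrift haψ
  have hU := VecDrift.sum (Finset.univ.erase n) fun m _ => hu m
  obtain ⟨S, hSdef⟩ : ∃ S : Proc d Ω, S = fun t ω =>
    v t ω + ψdot t ω + ∑ m ∈ Finset.univ.erase n, u m t ω := ⟨_, rfl⟩
  obtain ⟨A, hAdef⟩ : ∃ A : Proc d Ω, A = fun t ω =>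
    av t ω + aψ t ω + ∑ m ∈ Finset.univ.erase n, a m t ω := ⟨_, rfl⟩
  have hS : E.VecDrift S A := by rw [hSdef, hAdef]; exact (hv.add hψd).add hU
  have hpos : ∀ᵐ ω ∂P, ∀ t ∈ Set.Icc 0 E.T, coordPosition S t ω =
      coordPosition v t ω + E.ψ t ω + ∑ m ∈ Finset.univ.erase n, coordPosition (u m) t ω := by
    rw [hSdef]
    filter_upwards [ae_coordPosition_add (hv.add hψd).memH2 hU.memH2,
      ae_coordPosition_add hv.memH2 hψd.memH2,
      ae_coordPosition_sum (s := Finset.univ.erase n) fun m _ => (hu m).memH2,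
      hψ.ae_eq_coordPosition] with ω h2 h3 h4 h5 t ht
    rw [h2 t ht, h3 t ht, h4 t ht, ← h5 t ht]
  have hN1 : (N : ℝ) - 1 ≠ 0 := by
    have : (2 : ℝ) ≤ N := by exact_mod_cast hN
    linarith
  have hSfoc : ∀ᵐ p ∂E.Q, (2 : ℝ) • E.Λ *ᵥ (A p.2 p.1 - E.r • S p.2 p.1) =
      (1 / E.δ n) • E.cov *ᵥ coordPosition S p.2 p.1 := by
    filter_upwards [hfoc, h, ae_Q_of_forall (S := fun ω t => coordPosition S t ω =
      coordPosition v t ω + E.ψ t ω + ∑ m ∈ Finset.univ.erase n, coordPosition (u m) t ω)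
      hpos] with p h1 h2 h3
    rw [h2, costReturn, smul_smul, mul_one_div_cancel hN1, one_smul] at h1
    rw [h3, hSdef, hAdef]
    simp only [residual, mulVec_add, mulVec_sub, mulVec_smul] at h1 ⊢
    ext i
    have h6 := congrFun h1 i
    simp only [Pi.add_apply, Pi.sub_apply, Pi.smul_apply, smul_eq_mul] at h6 ⊢
    linarith
  have hβ : 0 < 1 / E.δ n := by have := E.δ_pos n; positivity
  have hS0 : ∀ᵐ p ∂E.Q, S p.2 p.1 = 0 := by
    refine ae_eq_zero_of_integral_loss hβ one_pos (F := fun p => coordPosition S p.2 p.1)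
      (G := fun p => S p.2 p.1) (memLp_coordPosition hS.memH2) hS.memLp (le_of_eq ?_)
    refine Eq.trans (integral_congr_ae ?_) (hS.ibp hS.memH2)
    filter_upwards [hSfoc] with p hp
    have h1 := congrArg (fun x => coordPosition S p.2 p.1 ⬝ᵥ x) hp
    simp only [dotProduct_smul, smul_eq_mul] at h1
    simp only [loss]
    linear_combination (-E.disc p.2 / 2) * h1
  refine ⟨hν, u, fun m _ => hopt m, ?_⟩
  have hzero : ∀ᵐ ω ∂P, ∀ t ∈ Set.Icc 0 E.T, coordPosition S t ω = 0 := by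
    filter_upwards [ae_coordPosition_congr (v := fun _ _ => 0) hS0] with ω hω t ht
    rw [hω t ht]
    ext i
    simp [coordPosition]
  filter_upwards [hpos, hzero, ae_position_eq hv.memLp,
    ae_all_iff.2 fun m => ae_position_eq (hu m).memLp] with ω h1 h2 h3 h4 t ht
  have h5 := h1 t ht
  rw [h2 t ht] at h5
  rw [h3 t ht, Finset.sum_congr rfl fun m _ => h4 m t ht, h5]
  abel

omit hδ in
-- `costReturn` contains the coordinatewise position, which need not be optional on exceptional
-- paths; it is replaced by an optional version.
theorem exists_memHInf_costReturn {v av : Proc d Ω} (hv : E.IsDrift v av) :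
    ∃ ν, E.MemHInf ν ∧ ∀ᵐ p ∂E.Q, ν p.2 p.1 = E.costReturn n ψdot aψ v av p.2 p.1 := by
  have hvd := vecDrift_of_isDrift hv
  have hψd := vecDrift_of_isDrift haψ
  obtain ⟨x, hx, hxe⟩ := exists_memHInf_coordPosition hvd.memHInf
  have hres : E.MemHInf (E.residual n) := (MemHInf.sum fun m _ => hζ m).sub hψ.memHInf
  refine ⟨_, ((((hres.sub hx).mulVec E.cov).smul (1 / E.δ n)).add
    ((((isDrift_memHInf hv).add (isDrift_memHInf haψ)).sub
      ((hvd.memHInf.add hψd.memHInf).smul E.r)).mulVec E.Λ |>.smul 2)).smul (1 / ((N : ℝ) - 1)), ?_⟩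
  filter_upwards [hxe] with p hp
  rw [costReturn, hp]

theorem exists_costClears {v : Proc d Ω} (hv : E.MemA v) : ∃ ν, E.CostClears n v ν := by
  obtain ⟨av, hav⟩ := hv
  obtain ⟨ν, hν, h⟩ := exists_memHInf_costReturn hN hζ hψ haψ n hav
  exact ⟨ν, costClears_of_ae_eq hN hδ hζ hψ haψ n (vecDrift_of_isDrift hav) hν h⟩

end CostClearing

end Economy

/-! ### The strategic investor with transaction costs. -/

namespace Economy

variable {d N : ℕ} {Ω : Type*} [mΩ : MeasurableSpace Ω] {P : Measure Ω} [IsProbabilityMeasure P]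
  {E : Economy d N P}

/-- The linear coefficient in the objective of the strategic investor with transaction costs. -/
def strategicTarget (E : Economy d N P) (n : Fin N) (ψdot aψ : Proc d Ω) : Proc d Ω := fun t ω =>
  (1 / ((N : ℝ) - 1)) • ((1 / E.δ n) • E.cov *ᵥ E.residual n t ω +
    (2 : ℝ) • E.Λ *ᵥ (aψ t ω - E.r • ψdot t ω)) - (1 / E.δ n) • E.cov *ᵥ E.ζ n t ω

/-- The risk coefficient in the objective of the strategic investor with transaction costs. -/
def strategicRisk (E : Economy d N P) (n : Fin N) : ℝ := (1 + 2 / ((N : ℝ) - 1)) * (1 / E.δ n)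

section CostStrategic

variable (hN : 2 ≤ N) (hδ : ∀ m k : Fin N, E.δ m = E.δ k) (hζ : ∀ m, E.MemHInf (E.ζ m))
  {ψdot aψ : Proc d Ω} (hψ : E.MemWA E.ψ ψdot) (haψ : E.IsDrift ψdot aψ) (n : Fin N)
include hN hζ hψ haψ

theorem memHInf_strategicTarget : E.MemHInf (E.strategicTarget n ψdot aψ) := by
  have hψd := vecDrift_of_isDrift haψ
  have hres : E.MemHInf (E.residual n) := (MemHInf.sum fun m _ => hζ m).sub hψ.memHInf
  exact ((((hres.mulVec E.cov).smul (1 / E.δ n)).add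
    ((((isDrift_memHInf haψ).sub (hψd.memHInf.smul E.r)).mulVec E.Λ).smul 2)).smul
      (1 / ((N : ℝ) - 1))).sub (((hζ n).mulVec E.cov).smul (1 / E.δ n))

/-- The objective of the strategic investor against clearing returns is linear-quadratic in her
trading rate. -/
theorem costObjective_strategic {v av ν : Proc d Ω} (hv : E.VecDrift v av) (hν : E.MemHInf ν)
    (h : ∀ᵐ p ∂E.Q, ν p.2 p.1 = E.costReturn n ψdot aψ v av p.2 p.1) :
    E.costObjective n ν v = ∫ p, E.disc p.2 * E.tradingPayoff (E.strategicRisk n)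
      (1 + 2 / ((N : ℝ) - 1)) (E.strategicTarget n ψdot aψ p.2 p.1) (coordPosition v p.2 p.1)
      (v p.2 p.1) ∂E.Q - E.exposureCost n := by
  have hvp := memLp_coordPosition hv.memH2
  have i1 := integrable_tradingPayoff (E := E) (E.strategicRisk n) (1 + 2 / ((N : ℝ) - 1)) hvp
    hv.memLp (memHInf_strategicTarget hN hζ hψ haψ n).memLp
  have i2 : Integrable (fun p : Ω × ℝ => E.disc p.2 * (coordPosition v p.2 p.1 ⬝ᵥ
      E.Λ *ᵥ (av p.2 p.1 - E.r • v p.2 p.1) + v p.2 p.1 ⬝ᵥ E.Λ *ᵥ v p.2 p.1)) E.Q := by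
    refine ((integrable_disc_dot hvp (memLp_mulVec
      (hv.memLp_drift.sub (hv.memLp.const_smul E.r)) E.Λ)).add
      (integrable_disc_dot hv.memLp (memLp_mulVec hv.memLp E.Λ))).congr (ae_of_all _ fun p => ?_)
    simp only [Pi.add_apply, Pi.sub_apply, Pi.smul_apply]
    ring
  -- Adding `2 / (N - 1)` times a vanishing integral exchanges the drift term of the price impact
  -- for an additional trading cost.
  have h1 := integral_add i1 (i2.const_mul (2 / ((N : ℝ) - 1)))
  rw [integral_const_mul, hv.ibp hv.memH2, mul_zero, add_zero] at h1
  rw [costObjective_eq_trading (hζ n).memH2 hν.memH2 hv.memH2, ← h1]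
  congr 1
  refine integral_congr_ae ?_
  filter_upwards [h] with p hp
  rw [hp, costReturn, strategicTarget, strategicRisk]
  simp only [tradingPayoff, mulVec_add, mulVec_sub, mulVec_smul, dotProduct_add, dotProduct_sub,
    dotProduct_smul, smul_eq_mul]
  ring

include hδ

/-- Clearing returns at the optimal trading rate of the strategic investor. -/
theorem costReturn_of_foc {p : Ω × ℝ} {u a : Proc d Ω}
    (h : (2 * (1 + 2 / ((N : ℝ) - 1))) • E.Λ *ᵥ (a p.2 p.1 - E.r • u p.2 p.1) =
      E.strategicRisk n • E.cov *ᵥ coordPosition u p.2 p.1 - E.strategicTarget n ψdot aψ p.2 p.1) :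
    E.costReturn n ψdot aψ u a p.2 p.1 = E.μstrategic n p.2 p.1 +
      (2 * (N : ℝ) / ((N : ℝ) ^ 2 - 1)) • (E.Λ *ᵥ (aψ p.2 p.1 - E.r • ψdot p.2 p.1)) := by
  have h2N : (2 : ℝ) ≤ N := by exact_mod_cast hN
  have hN0 : (N : ℝ) ≠ 0 := by linarith
  have hN1 : (N : ℝ) - 1 ≠ 0 := by linarith
  have hN2 : (N : ℝ) + 1 ≠ 0 := by linarith
  have hN3 : (N : ℝ) ^ 2 - 1 ≠ 0 := by
    have : (N : ℝ) ^ 2 - 1 = (N - 1) * (N + 1) := by ring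
    rw [this]; exact mul_ne_zero hN1 hN2
  have hd := (E.δ_pos n).ne'
  have hwithout : ∑ m ∈ Finset.univ.erase n, E.δ m = ((N : ℝ) - 1) * E.δ n := by
    rw [Finset.sum_congr rfl fun m _ => hδ m n, Finset.sum_const,
      Finset.card_erase_of_mem (Finset.mem_univ n), Finset.card_univ, Fintype.card_fin,
      nsmul_eq_mul, Nat.cast_sub n.pos, Nat.cast_one]
  have htot : E.δtot = N * E.δ n := by
    rw [δtot, Finset.sum_congr rfl fun m _ => hδ m n, Finset.sum_const, Finset.card_univ,
      Fintype.card_fin, nsmul_eq_mul]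
  have hlam : E.relTol n = 1 / N := by
    rw [relTol, htot]; field_simp
  have hres : (∑ m, E.ζ m p.2 p.1) - E.ψ p.2 p.1 = E.ζ n p.2 p.1 + E.residual n p.2 p.1 := by
    rw [← Finset.add_sum_erase _ _ (Finset.mem_univ n), residual]; abel
  have hres' : (∑ m ∈ Finset.univ.erase n, E.ζ m p.2 p.1) - E.ψ p.2 p.1 =
      E.residual n p.2 p.1 := rfl
  simp only [μstrategic, μwithout, μcomp, hwithout, htot, hlam, hres, hres', costReturn]
  simp only [strategicTarget, strategicRisk] at h
  simp only [mulVec_add, mulVec_sub, mulVec_smul] at h ⊢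
  ext i
  have h6 := congrFun h i
  simp only [Pi.add_apply, Pi.sub_apply, Pi.smul_apply, smul_eq_mul] at h6 ⊢
  generalize (E.Λ *ᵥ a p.2 p.1) i = x1 at *
  generalize (E.Λ *ᵥ u p.2 p.1) i = x2 at *
  generalize (E.Λ *ᵥ aψ p.2 p.1) i = x3 at *
  generalize (E.Λ *ᵥ ψdot p.2 p.1) i = x4 at *
  generalize (E.cov *ᵥ coordPosition u p.2 p.1) i = x5 at *
  generalize (E.cov *ᵥ E.residual n p.2 p.1) i = x6 at *
  generalize (E.cov *ᵥ E.ζ n p.2 p.1) i = x7 at *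
  -- Dividing by `1 + 2 / (N - 1) = (N + 1) / (N - 1)`, a factor also contained in `strategicRisk`,
  -- leaves the coefficient `1 / δ n` in front of the position term `x5`. It then cancels in
  -- `costReturn`, and what remains depends on the data only.
  have h7 : 2 * (x1 - E.r * x2) = 1 / E.δ n * x5 - ((N : ℝ) - 1) / (N + 1) *
      (1 / ((N : ℝ) - 1) * (1 / E.δ n * x6 + 2 * (x3 - E.r * x4)) - 1 / E.δ n * x7) := by
    have e1 : 1 + 2 / ((N : ℝ) - 1) = (N + 1) / (N - 1) := by field_simp; ring
    rw [e1] at h6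
    have h8 := congrArg (fun x => ((N : ℝ) - 1) / (N + 1) * x) h6
    have e2 : ((N : ℝ) - 1) / (N + 1) * ((N + 1) / (N - 1)) = 1 := by field_simp
    linear_combination h8 + (1 / E.δ n * x5 - 2 * (x1 - E.r * x2)) * e2
  have e3 : 1 / ((N : ℝ) - 1) * (1 / E.δ n * (x6 - x5) +
      2 * (x1 + x3 - E.r * (x2 + x4))) = 1 / ((N : ℝ) - 1) * (1 / E.δ n * (x6 - x5) +
      2 * (x1 - E.r * x2) + 2 * (x3 - E.r * x4)) := by ring
  have e4 : x1 + x3 - E.r * (x2 + x4) = x1 + x3 - (E.r * x2 + E.r * x4) := by ring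
  have e5 : (N : ℝ) ^ 2 - 1 = (N - 1) * (N + 1) := by ring
  have e6 : 1 / (N : ℝ) + 1 = (N + 1) / N := by field_simp; ring
  refine Eq.trans ?_ (Eq.trans e3 ?_)
  · ring
  · rw [h7, e5, e6]
    field_simp
    ring

/-- The comparisons range over arbitrary clearing returns, since by `CostClears.ae_eq` the choice of
price impact does not affect the objective. -/
theorem costEquilibrium_characterization : ∃ u a, E.IsDrift u a ∧
    (∀ᵐ p ∂E.Q, E.costReturn n ψdot aψ u a p.2 p.1 = E.μstrategic n p.2 p.1 +
      (2 * (N : ℝ) / ((N : ℝ) ^ 2 - 1)) • (E.Λ *ᵥ (aψ p.2 p.1 - E.r • ψdot p.2 p.1))) ∧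
    (∀ v ν ν', E.MemA v → E.CostClears n v ν → E.CostClears n u ν' →
      E.costObjective n ν v ≤ E.costObjective n ν' u) ∧
    ∀ v ν ν', E.MemA v → E.CostClears n v ν → E.CostClears n u ν' →
      E.costObjective n ν' u ≤ E.costObjective n ν v → ∀ᵐ p ∂E.Q, v p.2 p.1 = u p.2 p.1 := by
  have h2N : (2 : ℝ) ≤ N := by exact_mod_cast hN
  have hN1 : 0 < (N : ℝ) - 1 := by linarith
  have hκ : 0 < 1 + 2 / ((N : ℝ) - 1) := by positivity
  have hβ : 0 < E.strategicRisk n := by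
    have := E.δ_pos n
    unfold strategicRisk; positivity
  have hg := memHInf_strategicTarget hN hζ hψ haψ n
  obtain ⟨u, a, hd, hfoc⟩ := exists_isDrift hβ hκ hg
  have hu := vecDrift_of_isDrift hd
  have hgap : ∀ v ν ν', E.MemA v → E.CostClears n v ν → E.CostClears n u ν' →
      E.costObjective n ν v = E.costObjective n ν' u - ∫ p, E.disc p.2 *
        E.loss (E.strategicRisk n) (1 + 2 / ((N : ℝ) - 1))
          (coordPosition v p.2 p.1 - coordPosition u p.2 p.1) (v p.2 p.1 - u p.2 p.1) ∂E.Q := by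
    rintro v ν ν' ⟨av, hav⟩ hc hc'
    have hv := vecDrift_of_isDrift hav
    rw [costObjective_strategic hN hζ hψ haψ n hv hc.1 (hc.ae_eq hN hδ hζ hψ haψ n hv),
      costObjective_strategic hN hζ hψ haψ n hu hc'.1 (hc'.ae_eq hN hδ hζ hψ haψ n hu),
      trading_gap hg.memLp hu hfoc hv.memH2]
    ring
  refine ⟨u, a, hd, ?_, fun v ν ν' hv hc hc' => ?_, fun v ν ν' hv hc hc' hle => ?_⟩
  · filter_upwards [hfoc] with p hp using costReturn_of_foc hN hδ hζ hψ haψ n hp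
  · rw [hgap v ν ν' hv hc hc']
    have := integral_loss_nonneg (E := E) hβ hκ
      (fun p => coordPosition v p.2 p.1 - coordPosition u p.2 p.1)
      (fun p => v p.2 p.1 - u p.2 p.1)
    linarith
  · rw [hgap v ν ν' hv hc hc'] at hle
    obtain ⟨av, hav⟩ := hv
    have hvd := vecDrift_of_isDrift hav
    have h2 := ae_eq_zero_of_integral_loss hβ hκ
      (F := fun p => coordPosition v p.2 p.1 - coordPosition u p.2 p.1)
      (G := fun p => v p.2 p.1 - u p.2 p.1)
      ((memLp_coordPosition hvd.memH2).sub (memLp_coordPosition hu.memH2))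
      (hvd.memLp.sub hu.memLp) (by linarith)
    filter_upwards [h2] with p hp using sub_eq_zero.1 hp

theorem costEquilibrium : ∃ μΛ : Proc d Ω,
    (∀ t ω, μΛ t ω = E.μstrategic n t ω +
      (2 * (N : ℝ) / ((N : ℝ) ^ 2 - 1)) • (E.Λ *ᵥ (aψ t ω - E.r • ψdot t ω))) ∧
    E.MemHInf μΛ ∧ E.IsCostEquilibrium n μΛ ∧ ∀ ν, E.IsCostEquilibrium n ν → E.AEEqual ν μΛ := by
  classical
  obtain ⟨u, a, hd, hret, hle, huniq⟩ := costEquilibrium_characterization hN hδ hζ hψ haψ n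
  have hu := vecDrift_of_isDrift hd
  have huA : E.MemA u := ⟨a, hd⟩
  have hψd := vecDrift_of_isDrift haψ
  obtain ⟨μ, hμ⟩ : ∃ μ : Proc d Ω, ∀ t ω, μ t ω = E.μstrategic n t ω +
    (2 * (N : ℝ) / ((N : ℝ) ^ 2 - 1)) • (E.Λ *ᵥ (aψ t ω - E.r • ψdot t ω)) := ⟨_, fun _ _ => rfl⟩
  have hwithout : E.MemHInf (E.μwithout n) :=
    (((MemHInf.sum fun m _ => hζ m).sub hψ.memHInf).mulVec E.cov).smul _
  have hcomp : E.MemHInf E.μcomp :=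
    (((MemHInf.sum fun m _ => hζ m).sub hψ.memHInf).mulVec E.cov).smul _
  have hμI : E.MemHInf μ := by
    have := ((hwithout.smul (E.relTol n / (E.relTol n + 1))).add
      (hcomp.smul (1 / (E.relTol n + 1)))).add
      ((((isDrift_memHInf haψ).sub (hψd.memHInf.smul E.r)).mulVec E.Λ).smul
        (2 * (N : ℝ) / ((N : ℝ) ^ 2 - 1)))
    rw [show μ = _ from funext fun t => funext fun ω => hμ t ω]
    exact this
  have hμc : E.CostClears n u μ := by
    refine costClears_of_ae_eq hN hδ hζ hψ haψ n hu hμI ?_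
    filter_upwards [hret] with p hp
    rw [hp, hμ]
  have hex : ∀ v, ∃ ν, E.MemA v → E.CostClears n v ν := fun v => by
    by_cases hv : E.MemA v
    · obtain ⟨ν, hν⟩ := exists_costClears hN hδ hζ hψ haψ n hv
      exact ⟨ν, fun _ => hν⟩
    · exact ⟨0, fun h => absurd h hv⟩
  choose imp himp using hex
  -- Clearing returns are determined only almost everywhere; updating the chosen impact at `u` makes
  -- the equilibrium process exactly `μ`.
  have hcl : ∀ v, E.MemA v → E.CostClears n v (Function.update imp u μ v) := fun v hv => by
    by_cases hvu : v = u
    · rw [hvu, Function.update_self]; exact hμc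
    · rw [Function.update_of_ne hvu]; exact himp v hv
  refine ⟨μ, hμ, hμI, ⟨Function.update imp u μ, u, hcl, huA, fun v hv => ?_,
    by rw [Function.update_self]⟩, ?_⟩
  · exact hle v _ _ hv (hcl v hv) (hcl u huA)
  · rintro ν ⟨imp', v, hcl', hvA, hopt, rfl⟩
    -- The candidate rate is compared with `u` under its own price impact `imp'`.
    have hvu := huniq v _ _ hvA (hcl' v hvA) (hcl' u huA) (hopt u huA)
    obtain ⟨av, hav⟩ := hvA
    have hv := vecDrift_of_isDrift hav
    have hc := hcl' v ⟨av, hav⟩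
    rw [aeEqual_iff hc.1.1 hμI.1]
    filter_upwards [hc.ae_eq hN hδ hζ hψ haψ n hv, hμc.ae_eq hN hδ hζ hψ haψ n hu, hvu,
      hv.drift_unique hu hvu, ae_Q_of_forall
        (S := fun ω t => coordPosition v t ω = coordPosition u t ω) (ae_coordPosition_congr hvu)]
      with p h1 h2 h3 h4 h5
    rw [h1, h2, costReturn, costReturn, h3, h4, h5]

end CostStrategic

end Economy

end

theorem corollary4p4 {d N : ℕ} (hN : 2 ≤ N) {Ω : Type*} [MeasurableSpace Ω] (P : Measure Ω)
    [IsProbabilityMeasure P] (E : Economy d N P)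
    (hδ : ∀ m k : Fin N, E.δ m = E.δ k)
    (hζ : ∀ m, E.MemHInf (E.ζ m))
    (ψdot aψ : Proc d Ω) (hψ : E.MemWA E.ψ ψdot) (haψ : E.IsDrift ψdot aψ)
    (n : Fin N) :
    -- the frictionless equilibrium returns when only investor `n` is strategic
    (E.IsEquilibrium n (E.μstrategic n) ∧
      ∀ ν, E.IsEquilibrium n ν → E.AEEqual ν (E.μstrategic n)) ∧
    -- the equilibrium returns with transaction costs when only investor `n` is strategic
    ∃ μΛ : Proc d Ω,
      (∀ t ω, μΛ t ω = E.μstrategic n t ω +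
        (2 * (N : ℝ) / ((N : ℝ) ^ 2 - 1)) • (E.Λ *ᵥ (aψ t ω - E.r • ψdot t ω))) ∧
      E.MemHInf μΛ ∧
      E.IsCostEquilibrium n μΛ ∧
      ∀ ν, E.IsCostEquilibrium n ν → E.AEEqual ν μΛ := by
  have hζ2 := fun m => (hζ m).memH2
  have hψ2 := hψ.memHInf.memH2
  exact ⟨⟨Economy.isEquilibrium_μstrategic hN hζ2 hψ2 n,
    fun ν hν => Economy.isEquilibrium_unique hN hζ2 hψ2 n hν⟩,
    Economy.costEquilibrium hN hδ hζ hψ haψ n⟩
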